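/- Let $d\ge 1$, $\mu\ge 0$, $1\le q\le\infty$, $r>(d+2\mu)\left(\tfrac12-\tfrac1q\right)_+$, $s>d$ and $\rho=r+s/2$ (with $1/\infty=0$). Setting. Let $\mathbb B^d$ be the closed Euclidean unit ball of $\mathbb R^d$ and $W_\mu(x)=(1-\|x\|_2^2)^{\mu-1/2}$. Let $L_{q,\mu}=L_q(\mathbb B^d,W_\mu\,dx)$ for $q<\infty$, and let $L_{\infty,\mu}=C(\mathbb B^d)$ with the uniform norm; write $\langle\cdot,\cdot\rangle$ for the inner product of $L_{2,\mu}$. Let $\mathcal V_n^d$ be the space of polynomials of degree at most $n$ that are orthogonal in $L_{2,\mu}$ to all polynomials of degree less than $n$, let $\mathrm{Proj}_n$ be the orthogonal projector of $L_{2,\mu}$ onto $\mathcal V_n^d$, and put $\lambda_n=n(n+2\mu+d-1)$. Let $$W^r_{2,\mu}=\Big\{f\in L_{2,\mu}:\ f=\sum_{n\ge1}\mathrm{Proj}_nf,\ \int_{\mathbb B^d}f\,W_\mu\,dx=0,\ \sum_{n\ge1}\lambda_n^r\|\mathrm{Proj}_nf\|_{2,\mu}^2<\infty\Big\},$$ a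 Hilbert space with inner product $\langle f,g\rangle_r=\sum_{n\ge1}\lambda_n^r\langle \mathrm{Proj}_nf,\mathrm{Proj}_ng\rangle$. Let $\nu$ be the centered Gaussian measure on $W^r_{2,\mu}$ whose correlation operator $C_\nu$, defined by $\langle C_\nu f,g\rangle_r=\int\langle f,h\rangle_r\langle g,h\rangle_r\,\nu(dh)$, satisfies $C_\nu\phi=\lambda_l^{-s/2}\phi$ for all $\phi\in\mathcal V_l^d$, $l\ge1$. For $\delta\in(0,1)$ put $$\lambda_{n,\delta}(W^r_{2,\mu},\nu,L_{q,\mu})=\inf_{G}\ \inf_{T}\ \sup_{f\in W^r_{2,\mu}\setminus G}\|f-Tf\|_{q,\mu},$$ where $G$ runs over the measurable subsets of $W^r_{2,\mu}$ with $\nu(G)\le\delta$ and $T$ over all linear operators from $L_{q,\mu}$ to $L_{q,\mu}$ of rank at most $n$. Let $\gamma_N$ be the standard Gaussian measure on $\mathbb R^N$, $I_N$ the identity of $\mathbb R^N$, and $$\lambda_{n,\delta}(I_N:\mathbb R^N\to\ell_q^N,\gamma_N)=\inf_{G}\ \inf_{S}\ \sup_{x\in\mathbb R^N\setminus G}\|x-Sx\|_{\ell_q^N},$$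 where $G$ runs over the Borel sets with $\gamma_N(G)\le\delta$ and $S$ over all linear operators on $\mathbb R^N$ of rank at most $n$. Theorem (lower discretization). For every $K\ge2$ there is a constant $c>0$, depending only on $d,\mu,q,r,s,K$, such that for all integers $n\ge1$ and $N$ with $2n\le N\le Kn$ and all $\delta\in(0,1)$, $$\lambda_{n,\delta}(W^r_{2,\mu},\nu,L_{q,\mu})\ \ge\ c\,n^{-\rho/d+1/2-1/q}\ \lambda_{n,\delta}(I_N:\mathbb R^N\to\ell_q^N,\gamma_N).$$ -/

import Mathlib

open MeasureTheory ProbabilityTheory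
open scoped ENNReal NNReal RealInnerProductSpace

noncomputable section

/-- Euclidean space `ℝ^d`. -/
abbrev EucSp (d : ℕ) : Type := EuclideanSpace ℝ (Fin d)

/-- The measure `W_μ(x) dx` on the closed unit ball, `W_μ(x) = (1 - ‖x‖²)^(μ - 1/2)`,
regarded as a measure on `ℝ^d` carried by the ball. -/
def ballMeasure (d : ℕ) (μ : ℝ≥0) : Measure (EucSp d) :=
  (volume.restrict (Metric.closedBall 0 1)).withDensity
    (fun x => ENNReal.ofReal ((1 - ‖x‖ ^ 2) ^ ((μ : ℝ) - 1 / 2)))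

theorem integrableOn_ballWeight (d : ℕ) [NeZero d] (μ : ℝ≥0) :
    IntegrableOn (fun x : EucSp d => (1 - ‖x‖ ^ 2) ^ ((μ : ℝ) - 1 / 2))
      (Metric.closedBall 0 1) := by
  rw [← integrable_indicator_iff Metric.isClosed_closedBall.measurableSet]
  have h0 : (Metric.closedBall (0 : EucSp d) 1).indicator
      (fun x : EucSp d => (1 - ‖x‖ ^ 2) ^ ((μ : ℝ) - 1 / 2))
      = fun x => (Set.Iic (1 : ℝ)).indicator
          (fun y : ℝ => (1 - y ^ 2) ^ ((μ : ℝ) - 1 / 2)) ‖x‖ := by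
    ext x
    by_cases hx : ‖x‖ ≤ 1 <;> simp [Set.indicator, hx]
  rw [h0, integrable_fun_norm_addHaar]
  have hI : IntervalIntegrable (fun y : ℝ => (1 - y) ^ (-(1 / 2) : ℝ)) volume 0 1 := by
    have := (intervalIntegral.intervalIntegrable_rpow' (a := 1) (b := 0)
      (r := -(1 / 2)) (by norm_num)).comp_sub_left 1
    simpa using this
  have hI' : IntegrableOn (fun y : ℝ => (1 - y) ^ (-(1 / 2) : ℝ)) (Set.Ioo 0 1) :=
    ((intervalIntegrable_iff_integrableOn_Ioc_of_le zero_le_one).1 hI).mono_set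
      Set.Ioo_subset_Ioc_self
  have h1 : IntegrableOn (fun y : ℝ => y ^ (Module.finrank ℝ (EucSp d) - 1) •
      (1 - y ^ 2) ^ ((μ : ℝ) - 1 / 2)) (Set.Ioo 0 1) := by
    refine Integrable.mono hI' (Measurable.aestronglyMeasurable (by fun_prop)) ?_
    refine (ae_restrict_mem measurableSet_Ioo).mono fun y hy => ?_
    obtain ⟨hy0, hy1⟩ := hy
    have hpos : 0 < 1 - y := by linarith
    have hle : 1 - y ≤ 1 - y ^ 2 := by nlinarith
    have hle1 : 1 - y ^ 2 ≤ 1 := by nlinarith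
    have hp2 : 0 < 1 - y ^ 2 := lt_of_lt_of_le hpos hle
    rw [smul_eq_mul, norm_mul, Real.norm_of_nonneg (Real.rpow_nonneg hp2.le _),
      Real.norm_of_nonneg (Real.rpow_nonneg hpos.le _), norm_pow, Real.norm_of_nonneg hy0.le]
    calc y ^ (Module.finrank ℝ (EucSp d) - 1) * (1 - y ^ 2) ^ ((μ : ℝ) - 1 / 2)
        ≤ 1 * (1 - y ^ 2) ^ ((μ : ℝ) - 1 / 2) := by
          gcongr
          exact pow_le_one₀ hy0.le hy1.le
      _ ≤ (1 - y ^ 2) ^ (-(1 / 2) : ℝ) := by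
          rw [one_mul]
          apply Real.rpow_le_rpow_of_exponent_ge hp2 hle1
          have := μ.coe_nonneg
          linarith
      _ ≤ (1 - y) ^ (-(1 / 2) : ℝ) :=
          Real.rpow_le_rpow_of_nonpos hpos hle (by norm_num)
  have h2 : IntegrableOn (fun y : ℝ => y ^ (Module.finrank ℝ (EucSp d) - 1) •
      (1 - y ^ 2) ^ ((μ : ℝ) - 1 / 2)) (Set.Ioc 0 1) :=
    h1.congr_set_ae Ioo_ae_eq_Ioc.symm
  have h3 : (fun y : ℝ => y ^ (Module.finrank ℝ (EucSp d) - 1) •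
      (Set.Iic (1 : ℝ)).indicator (fun y : ℝ => (1 - y ^ 2) ^ ((μ : ℝ) - 1 / 2)) y)
      = (Set.Iic (1 : ℝ)).indicator (fun y : ℝ => y ^ (Module.finrank ℝ (EucSp d) - 1) •
      (1 - y ^ 2) ^ ((μ : ℝ) - 1 / 2)) := by
    ext y
    by_cases hy : y ≤ 1 <;> simp [Set.indicator, hy]
  rw [h3]
  rw [IntegrableOn, integrable_indicator_iff measurableSet_Iic, IntegrableOn,
    Measure.restrict_restrict measurableSet_Iic, Set.inter_comm, Set.Ioi_inter_Iic]
  exact h2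

instance (d : ℕ) [NeZero d] (μ : ℝ≥0) : IsFiniteMeasure (ballMeasure d μ) :=
  isFiniteMeasure_withDensity_ofReal (integrableOn_ballWeight d μ).2

theorem ballMeasure_ae_mem (d : ℕ) (μ : ℝ≥0) :
    ∀ᵐ x ∂(ballMeasure d μ), x ∈ Metric.closedBall (0 : EucSp d) 1 :=
  (withDensity_absolutelyContinuous _ _).ae_le
    (ae_restrict_mem Metric.isClosed_closedBall.measurableSet)

/-- Classes of a.e. equal measurable functions on the ball. -/
abbrev BallFun (d : ℕ) (μ : ℝ≥0) : Type := EucSp d →ₘ[ballMeasure d μ] ℝ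

/-- The Hilbert space `L_{2,μ}`, with inner product `∫ f g W_μ`. -/
abbrev BallL2 (d : ℕ) (μ : ℝ≥0) : Type := Lp ℝ 2 (ballMeasure d μ)

section SobolevSpace

variable (d : ℕ) [NeZero d] (μ : ℝ≥0)

theorem memLp_polynomial (p : MvPolynomial (Fin d) ℝ) :
    MemLp (fun x : EucSp d => MvPolynomial.eval (fun i => x i) p) 2 (ballMeasure d μ) := by
  have hc : Continuous (fun x : EucSp d => MvPolynomial.eval (fun i => x i) p) :=
    (MvPolynomial.continuous_eval p).comp (by fun_prop)
  obtain ⟨C, hC⟩ := (isCompact_closedBall (0 : EucSp d) 1).exists_bound_of_continuousOn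
    hc.continuousOn
  exact MemLp.of_bound hc.aestronglyMeasurable C ((ballMeasure_ae_mem d μ).mono hC)

/-- A polynomial in `d` variables as an element of `L_{2,μ}`. -/
def polyToL2 : MvPolynomial (Fin d) ℝ →ₗ[ℝ] BallL2 d μ where
  toFun p := (memLp_polynomial d μ p).toLp _
  map_add' p q := by
    rw [← MemLp.toLp_add]
    congr 1
    ext x
    simp
  map_smul' c p := by
    rw [RingHom.id_apply, ← MemLp.toLp_const_smul]
    congr 1
    ext x
    simp

/-- `Π_n^d`: the polynomials of total degree at most `n`, as a subspace of `L_{2,μ}`. -/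
def polySpace (n : ℕ) : Submodule ℝ (BallL2 d μ) :=
  (MvPolynomial.restrictTotalDegree (Fin d) ℝ n).map (polyToL2 d μ)

instance (n : ℕ) : FiniteDimensional ℝ (polySpace d μ n) := by
  unfold polySpace
  infer_instance

/-- `V_n^d`: the polynomials of degree at most `n` orthogonal in `L_{2,μ}` to all polynomials
of degree less than `n`. -/
def orthoPolySpace (n : ℕ) : Submodule ℝ (BallL2 d μ) :=
  polySpace d μ n ⊓ ⨅ k : Fin n, (polySpace d μ k)ᗮ

instance (n : ℕ) : FiniteDimensional ℝ (orthoPolySpace d μ n) := by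
  unfold orthoPolySpace
  infer_instance

/-- `Proj_n`: the orthogonal projector of `L_{2,μ}` onto `V_n^d`. -/
def projV (n : ℕ) : BallL2 d μ →L[ℝ] BallL2 d μ := (orthoPolySpace d μ n).starProjection

/-- `λ_n = n (n + 2μ + d - 1)`. -/
def eigenval (n : ℕ) : ℝ := n * (n + 2 * (μ : ℝ) + d - 1)

theorem eigenval_pos {n : ℕ} (hn : 1 ≤ n) : 0 < eigenval d μ n := by
  have h1 : (1 : ℝ) ≤ n := by exact_mod_cast hn
  have h2 : (1 : ℝ) ≤ d := by exact_mod_cast NeZero.one_le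
  have h3 := μ.coe_nonneg
  unfold eigenval
  apply mul_pos <;> linarith

theorem eigenval_rpow_pos (r : ℝ) (n : ℕ) : 0 < eigenval d μ (n + 1) ^ r :=
  Real.rpow_pos_of_pos (eigenval_pos d μ (Nat.le_add_left 1 n)) r

variable (r : ℝ)

theorem summable_sobolev_inner {f g : BallL2 d μ}
    (hf : Summable fun n : ℕ => eigenval d μ (n + 1) ^ r * ‖projV d μ (n + 1) f‖ ^ 2)
    (hg : Summable fun n : ℕ => eigenval d μ (n + 1) ^ r * ‖projV d μ (n + 1) g‖ ^ 2) :
    Summable fun n : ℕ => eigenval d μ (n + 1) ^ r *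
      ⟪projV d μ (n + 1) f, projV d μ (n + 1) g⟫ := by
  refine Summable.of_norm_bounded (hf.add hg) fun n => ?_
  have h0 := (eigenval_rpow_pos d μ r n).le
  rw [norm_mul, Real.norm_of_nonneg h0, ← mul_add]
  refine mul_le_mul_of_nonneg_left ?_ h0
  have h1 := norm_inner_le_norm (𝕜 := ℝ) (projV d μ (n + 1) f) (projV d μ (n + 1) g)
  nlinarith [sq_nonneg (‖projV d μ (n + 1) f‖ - ‖projV d μ (n + 1) g‖),
    sq_nonneg (‖projV d μ (n + 1) f‖), sq_nonneg (‖projV d μ (n + 1) g‖)]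

/-- The underlying set of `W^r_{2,μ}`: the `f ∈ L_{2,μ}` with `f = ∑_{n ≥ 1} Proj_n f`,
`∫ f W_μ = 0` and `∑_{n ≥ 1} λ_n^r ‖Proj_n f‖² < ∞`. -/
def sobolevSubmodule : Submodule ℝ (BallL2 d μ) where
  carrier := {f | HasSum (fun n : ℕ => projV d μ (n + 1) f) f ∧
    ∫ x, f x ∂(ballMeasure d μ) = 0 ∧
    Summable fun n : ℕ => eigenval d μ (n + 1) ^ r * ‖projV d μ (n + 1) f‖ ^ 2}
  zero_mem' := by
    refine ⟨by simp [hasSum_zero], ?_, by simp [summable_zero]⟩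
    rw [integral_congr_ae (Lp.coeFn_zero ℝ 2 (ballMeasure d μ))]
    simp
  add_mem' := by
    rintro f g ⟨hf1, hf2, hf3⟩ ⟨hg1, hg2, hg3⟩
    refine ⟨by simpa using hf1.add hg1, ?_, ?_⟩
    · rw [integral_congr_ae (Lp.coeFn_add f g)]
      have h1 := (Lp.memLp f).integrable (by norm_num)
      have h2 := (Lp.memLp g).integrable (by norm_num)
      simp only [Pi.add_apply]
      rw [integral_add h1 h2, hf2, hg2, add_zero]
    · refine ((hf3.add hg3).add ((summable_sobolev_inner d μ r hf3 hg3).mul_left 2)).congr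
        fun n => ?_
      rw [map_add, norm_add_sq_real]
      ring
  smul_mem' := by
    rintro c f ⟨hf1, hf2, hf3⟩
    refine ⟨by simpa using hf1.const_smul c, ?_, ?_⟩
    · rw [integral_congr_ae (Lp.coeFn_smul c f)]
      simp only [Pi.smul_apply]
      rw [integral_smul, hf2, smul_zero]
    · refine (hf3.mul_left (c ^ 2)).congr fun n => ?_
      rw [map_smul, norm_smul, mul_pow, Real.norm_eq_abs, sq_abs]
      ring

/-- The weighted Sobolev space `W^r_{2,μ}`. It does not carry the topology of `L_{2,μ}`; its
inner product is the one defined below. -/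
def SobolevSpace : Type := ↥(sobolevSubmodule d μ r)

namespace SobolevSpace

instance : AddCommGroup (SobolevSpace d μ r) :=
  inferInstanceAs (AddCommGroup ↥(sobolevSubmodule d μ r))

instance : Module ℝ (SobolevSpace d μ r) :=
  inferInstanceAs (Module ℝ ↥(sobolevSubmodule d μ r))

/-- The inclusion of `W^r_{2,μ}` into `L_{2,μ}`. -/
def toL2 : SobolevSpace d μ r →ₗ[ℝ] BallL2 d μ := (sobolevSubmodule d μ r).subtype

/-- The inner product
`⟨f, g⟩_r = ⟨f^(r), g^(r)⟩ = ∑_{n ≥ 1} λ_n^r ⟨Proj_n f, Proj_n g⟩`. -/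
abbrev core : InnerProductSpace.Core ℝ (SobolevSpace d μ r) where
  inner f g := ∑' n : ℕ, eigenval d μ (n + 1) ^ r *
    ⟪projV d μ (n + 1) (toL2 d μ r f), projV d μ (n + 1) (toL2 d μ r g)⟫
  conj_inner_symm f g := by
    simp only [conj_trivial]
    exact tsum_congr fun n => by rw [real_inner_comm]
  re_inner_nonneg f := by
    refine tsum_nonneg fun n => mul_nonneg (eigenval_rpow_pos d μ r n).le ?_
    exact real_inner_self_nonneg
  add_left f g h := by
    refine Eq.trans ?_ ((summable_sobolev_inner d μ r f.2.2.2 h.2.2.2).tsum_add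
      (summable_sobolev_inner d μ r g.2.2.2 h.2.2.2))
    refine tsum_congr fun n => ?_
    rw [map_add, map_add, inner_add_left, mul_add]
    rfl
  smul_left f g c := by
    simp only [conj_trivial]
    rw [← tsum_mul_left]
    refine tsum_congr fun n => ?_
    rw [map_smul, map_smul, real_inner_smul_left]
    ring
  definite f hf := by
    have hs := summable_sobolev_inner d μ r f.2.2.2 f.2.2.2
    have h0 : ∀ n : ℕ, 0 ≤ eigenval d μ (n + 1) ^ r *
        ⟪projV d μ (n + 1) (toL2 d μ r f), projV d μ (n + 1) (toL2 d μ r f)⟫ := fun n =>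
      mul_nonneg (eigenval_rpow_pos d μ r n).le real_inner_self_nonneg
    have h1 := (hasSum_zero_iff_of_nonneg h0).1 (by rw [← hf]; exact hs.hasSum)
    have h2 : ∀ n : ℕ, projV d μ (n + 1) (toL2 d μ r f) = 0 := fun n => by
      have := congrFun h1 n
      simpa [(eigenval_rpow_pos d μ r n).ne'] using this
    have h3 : HasSum (fun n : ℕ => projV d μ (n + 1) (toL2 d μ r f)) (toL2 d μ r f) := f.2.1
    simp only [h2] at h3
    exact Subtype.ext (h3.unique hasSum_zero)

instance : NormedAddCommGroup (SobolevSpace d μ r) :=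
  @InnerProductSpace.Core.toNormedAddCommGroup ℝ _ _ _ _ (core d μ r)

instance : InnerProductSpace ℝ (SobolevSpace d μ r) :=
  InnerProductSpace.ofCore (core d μ r).toCore

instance : MeasurableSpace (SobolevSpace d μ r) := borel _

instance : BorelSpace (SobolevSpace d μ r) := ⟨rfl⟩

theorem inner_def (f g : SobolevSpace d μ r) :
    ⟪f, g⟫ = ∑' n : ℕ, eigenval d μ (n + 1) ^ r *
      ⟪projV d μ (n + 1) (toL2 d μ r f), projV d μ (n + 1) (toL2 d μ r g)⟫ := rfl

end SobolevSpace

/-- `ν` is the Gaussian measure on `W^r_{2,μ}` with mean zero whose correlation operator `C_ν`,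
given by `⟨C_ν f, g⟩_r = ∫ ⟨f, h⟩_r ⟨g, h⟩_r ν(dh)`, satisfies
`C_ν φ = λ_l^{-s/2} φ` for `φ ∈ V_l^d`, `l ≥ 1`. -/
structure IsSobolevGaussian (s : ℝ) (ν : Measure (SobolevSpace d μ r)) : Prop where
  isGaussian : IsGaussian ν
  mean_zero : ∀ f : SobolevSpace d μ r, ∫ h, ⟪f, h⟫ ∂ν = 0
  correlation : ∀ l : ℕ, 1 ≤ l → ∀ φ : SobolevSpace d μ r,
    SobolevSpace.toL2 d μ r φ ∈ orthoPolySpace d μ l →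
    ∀ g : SobolevSpace d μ r,
      ∫ h, ⟪φ, h⟫ * ⟪g, h⟫ ∂ν = ⟪(eigenval d μ l ^ (-s / 2)) • φ, g⟫

end SobolevSpace

/-- The space `L_{q,μ}` (norm: `eLpNorm · q (ballMeasure d μ)`). For `q = ∞` it is the space of
continuous functions on the closed ball; the essential supremum of such a function is its uniform
norm, since `W_μ > 0` on the open ball. -/
def weightedLq (d : ℕ) (μ : ℝ≥0) (q : ℝ≥0∞) : Submodule ℝ (BallFun d μ) where
  carrier := {f | eLpNorm f q (ballMeasure d μ) < ∞ ∧
    (q = ∞ → ∃ g : EucSp d → ℝ, ContinuousOn g (Metric.closedBall 0 1) ∧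
      f =ᵐ[ballMeasure d μ] g)}
  zero_mem' := by
    refine ⟨(Lp.LpSubmodule ℝ ℝ q (ballMeasure d μ)).zero_mem, fun _ =>
      ⟨0, continuousOn_const, AEEqFun.coeFn_zero⟩⟩
  add_mem' := by
    rintro f g ⟨hf1, hf2⟩ ⟨hg1, hg2⟩
    refine ⟨(Lp.LpSubmodule ℝ ℝ q (ballMeasure d μ)).add_mem hf1 hg1, fun hq => ?_⟩
    obtain ⟨u, hu1, hu2⟩ := hf2 hq
    obtain ⟨v, hv1, hv2⟩ := hg2 hq
    exact ⟨u + v, hu1.add hv1, (AEEqFun.coeFn_add f g).trans (hu2.add hv2)⟩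
  smul_mem' := by
    rintro c f ⟨hf1, hf2⟩
    refine ⟨(Lp.LpSubmodule ℝ ℝ q (ballMeasure d μ)).smul_mem c hf1, fun hq => ?_⟩
    obtain ⟨u, hu1, hu2⟩ := hf2 hq
    exact ⟨c • u, hu1.const_smul c, (AEEqFun.coeFn_smul c f).trans (hu2.const_smul c)⟩

/-- The linear width `λ_n(K, L_{q,μ}) = inf_T sup_{f ∈ K} ‖f - T f‖_{q,μ}`, with `T` running over
the linear operators from `L_{q,μ}` to `L_{q,μ}` of rank at most `n`. The error of an `f ∈ K`
outside `L_{q,μ}` (there is none if `K ⊆ L_{q,μ}`) counts as `∞`. -/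
def linearWidth (d : ℕ) (μ : ℝ≥0) (q : ℝ≥0∞) (n : ℕ) (K : Set (BallFun d μ)) : ℝ≥0∞ :=
  ⨅ (T : weightedLq d μ q →ₗ[ℝ] weightedLq d μ q) (_ : T.rank ≤ n),
    ⨆ f ∈ K, ⨅ hf : f ∈ weightedLq d μ q,
      eLpNorm (f - (T ⟨f, hf⟩ : BallFun d μ) : BallFun d μ) q (ballMeasure d μ)

/-- The probabilistic linear width
`λ_{n,δ}(W^r_{2,μ}, ν, L_{q,μ}) = inf_G λ_n(W^r_{2,μ} \ G, L_{q,μ})`, with `G` running over the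
measurable subsets of `W^r_{2,μ}` of measure `ν(G) ≤ δ`. -/
def probLinearWidth (d : ℕ) [NeZero d] (μ : ℝ≥0) (r : ℝ) (q : ℝ≥0∞)
    (ν : Measure (SobolevSpace d μ r)) (n : ℕ) (δ : ℝ) : ℝ≥0∞ :=
  ⨅ (G : Set (SobolevSpace d μ r)) (_ : MeasurableSet G) (_ : ν G ≤ ENNReal.ofReal δ),
    linearWidth d μ q n
      ((fun f => (SobolevSpace.toL2 d μ r f : BallFun d μ)) '' Gᶜ)

/-- The standard Gaussian measure `γ_m` on `ℝ^m`. -/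
def gammaStd (m : ℕ) : Measure (Fin m → ℝ) := Measure.pi fun _ => gaussianReal 0 1

/-- The probabilistic linear width `λ_{n,δ}(T : ℝ^m → ℓ_q^m, γ_m)`, with `G` running over the
Borel sets with `γ_m(G) ≤ δ` and `S` over the linear operators of rank at most `n`. -/
def matrixProbLinearWidth (m : ℕ) (q : ℝ≥0∞) (T : (Fin m → ℝ) →ₗ[ℝ] (Fin m → ℝ))
    (n : ℕ) (δ : ℝ) : ℝ≥0∞ :=
  ⨅ (G : Set (Fin m → ℝ)) (_ : MeasurableSet G) (_ : gammaStd m G ≤ ENNReal.ofReal δ)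
    (S : (Fin m → ℝ) →ₗ[ℝ] (Fin m → ℝ)) (_ : S.rank ≤ n),
    ⨆ x ∈ Gᶜ, ENNReal.ofReal ‖WithLp.toLp q (T x - S x)‖

end

noncomputable section

/-! The Gaussian measure ν contains, as an independent summand, a scaled standard Gaussian vector
carried by N bumps with disjoint supports. On such bumps, approximation in `L_{q,μ}` is at least as
hard as approximation of the identity in `ℓ_q^N`, up to a known factor.

Take 2N disjoint balls of radius 1/R inside the ball, with R^d comparable to N, and combine the
bumps on them in pairs into functions F_j of mean zero and norm one in `L_{2,μ}`
(`exists_bump_system`). Put Ψa = ∑ a_j F_j. The covariance of σΨξ, with ξ standard Gaussian, is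
dominated by that of ν as soon as σ² ∑ λ_n^ρ ‖Proj_n Ψa‖² ≤ |a|². This is a Bernstein inequality for
bumps. The differential operator `ballOp` is symmetric in `L_{2,μ}` and acts as -λ_n on V_n^d, hence
Proj_n commutes with it up to -λ_n (`projV_ballOp`); each application costs R² on a bump, and
interpolation between the orders 0 and 2k (`summable_rpow_mul_projV`) gives ∑ λ_n^ρ ‖Proj_n Ψa‖² ≤
(1 + C) R^{2ρ} |a|². So σ of order R^{-ρ} is allowed. Then ν is the convolution of some ν' with the
law of σΨξ (`exists_conv_stdGaussian`), and by averaging over ν' every exceptional set G has a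
translate g with γ_N{x : g + σΨx ∈ G} ≤ ν(G) (`exists_sobolev_shift`).

Let T have rank at most n and error at most t off G. The coefficient map A f = (∫ f F_j W_μ)_j is a
left inverse of Ψ, and Hölder on the disjoint supports bounds its norm from `L_{q,μ}` to ℓ_q^N by
some κ of order R^{d/2 - d(1-1/q)} (`ofReal_norm_coeffMap_le`). With S = ATΨ this gives ‖σ(x - Sx) -
b‖ ≤ κt off a set of γ_N-measure at most δ, where the vector b comes from the unknown g. Anderson's
inequality (`gammaStd_shift_le`) says that dropping b only enlarges the Gaussian measure of this
event, so the width of the identity is at most κt/σ (`mul_matrixProbLinearWidth_le`). Finally σ/κ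
has order R^{d(-ρ/d + 1/2 - 1/q)}, and R^d is comparable to n.

Anderson's inequality is obtained from a midpoint Prékopa–Leindler inequality, which holds on the
line by Brunn–Minkowski and passes to densities and products. -/

/-! ### Brunn–Minkowski, Prékopa–Leindler and Anderson's inequality. -/

theorem Real.volume_add_volume_le_of_isCompact {A B C : Set ℝ} (hA : IsCompact A) (hB : IsCompact B)
    (hA0 : A.Nonempty) (hB0 : B.Nonempty)
    (h : ∀ x ∈ A, ∀ y ∈ B, (x + y) / 2 ∈ C) : volume A + volume B ≤ 2 * volume C := by
  -- With a = max A and b = min B, the translates b + A and a + B both lie in 2C and meet at most in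
  -- a + b, so their lengths add up.
  obtain ⟨a, ha, ha'⟩ := hA.exists_isMaxOn hA0 continuousOn_id
  obtain ⟨b, hb, hb'⟩ := hB.exists_isMinOn hB0 continuousOn_id
  have e1 : volume A = volume ((fun x => b + x) '' A) := by simp
  have e2 : volume B = volume ((fun x => a + x) '' B) := by simp
  have hsub : ((fun x => b + x) '' A) ∪ ((fun x => a + x) '' B) ⊆ (fun x => (2 : ℝ) * x) '' C := by
    rintro _ (⟨x, hx, rfl⟩ | ⟨x, hx, rfl⟩)
    · exact ⟨_, h x hx b hb, by ring⟩
    · exact ⟨_, h a ha x hx, by ring⟩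
  have hinter : ((fun x => b + x) '' A) ∩ ((fun x => a + x) '' B) ⊆ {a + b} := by
    rintro _ ⟨⟨x, hx, rfl⟩, ⟨y, hy, hxy⟩⟩
    have h1 : x ≤ a := ha' hx
    have h2 : b ≤ y := hb' hy
    simp only at hxy
    simp only [Set.mem_singleton_iff]
    linarith
  have hm : MeasurableSet ((fun x => a + x) '' B) :=
    (hB.image (by fun_prop)).measurableSet
  have h3 := measure_union_add_inter (μ := volume) ((fun x => b + x) '' A) hm
  have h4 : volume (((fun x => b + x) '' A) ∩ ((fun x => a + x) '' B)) = 0 :=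
    measure_mono_null hinter (by simp)
  rw [h4, add_zero] at h3
  rw [e1, e2, ← h3]
  refine (measure_mono hsub).trans ?_
  have := Measure.addHaar_image_homothety (volume : Measure ℝ) 0 2 C
  have h5 : (fun x : ℝ => 2 * x) = AffineMap.homothety (0 : ℝ) (2 : ℝ) := by
    ext x; simp [AffineMap.homothety_apply]
  rw [h5, this]
  simp

/-- The midpoint form of the Brunn–Minkowski inequality on the line. -/
theorem Real.volume_add_volume_le {A B C : Set ℝ} (hA : MeasurableSet A) (hB : MeasurableSet B)
    (hA0 : A.Nonempty) (hB0 : B.Nonempty)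
    (h : ∀ x ∈ A, ∀ y ∈ B, (x + y) / 2 ∈ C) : volume A + volume B ≤ 2 * volume C := by
  obtain ⟨a, ha⟩ := hA0
  obtain ⟨b, hb⟩ := hB0
  have hcomp : ∀ S : Set ℝ, (⨆ K, ⨆ _ : K ⊆ S, ⨆ _ : IsCompact K, volume K)
      = ⨆ K, ⨆ _ : K ⊆ S ∧ IsCompact K, volume K := fun S => by simp only [iSup_and]
  rw [hA.measure_eq_iSup_isCompact, hB.measure_eq_iSup_isCompact, hcomp, hcomp]
  refine ENNReal.biSup_add_biSup_le' ⟨∅, by simp⟩ ⟨∅, by simp⟩ ?_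
  rintro K ⟨hK, hKc⟩ L ⟨hL, hLc⟩
  -- The inner compact sets may be empty; adjoining a and b makes them nonempty without leaving A
  -- and B.
  refine le_trans (add_le_add (measure_mono (Set.subset_insert a K))
    (measure_mono (Set.subset_insert b L))) ?_
  refine volume_add_volume_le_of_isCompact (hKc.insert a) (hLc.insert b)
    (Set.insert_nonempty _ _) (Set.insert_nonempty _ _) fun x hx y hy => h x ?_ y ?_
  · exact Set.insert_subset ha hK hx
  · exact Set.insert_subset hb hL hy

/-- Layer-cake argument: the hypothesis puts the midpoints of {F > t} and {G > t} into {H > t}, so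
Brunn–Minkowski applies at each level. Both suprema are normalised to 1 so that these two level sets
are nonempty for exactly the same t. -/
theorem Real.lintegral_add_lintegral_le {F G H : ℝ → ℝ} (hF : Measurable F) (hG : Measurable G)
    (hH : Measurable H) (hF0 : ∀ x, 0 ≤ F x) (hG0 : ∀ x, 0 ≤ G x) (hH0 : ∀ x, 0 ≤ H x)
    (hF1 : ∀ x, F x ≤ 1) (hG1 : ∀ x, G x ≤ 1) (hFs : ∀ t < 1, ∃ x, t < F x)
    (hGs : ∀ t < 1, ∃ x, t < G x) (h : ∀ x y, F x * G y ≤ H ((x + y) / 2) ^ 2) :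
    (∫⁻ x, ENNReal.ofReal (F x)) + ∫⁻ x, ENNReal.ofReal (G x)
      ≤ 2 * ∫⁻ x, ENNReal.ofReal (H x) := by
  rw [lintegral_eq_lintegral_meas_lt _ (.of_forall hF0) hF.aemeasurable,
    lintegral_eq_lintegral_meas_lt _ (.of_forall hG0) hG.aemeasurable,
    lintegral_eq_lintegral_meas_lt _ (.of_forall hH0) hH.aemeasurable,
    ← lintegral_const_mul' _ _ (by simp)]
  have hmeas : ∀ u : ℝ → ℝ, Measurable fun t : ℝ => volume {a | t < u a} := fun u =>
    Antitone.measurable fun s t hst => measure_mono fun a (ha : t < u a) => lt_of_le_of_lt hst ha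
  rw [← lintegral_add_left (hmeas F)]
  refine setLIntegral_mono' measurableSet_Ioi fun t (ht : 0 < t) => ?_
  rcases lt_or_ge t 1 with h1 | h1
  · refine Real.volume_add_volume_le (measurableSet_lt measurable_const hF)
      (measurableSet_lt measurable_const hG) (hFs t h1) (hGs t h1) fun x hx y hy => ?_
    simp only [Set.mem_ofPred_eq] at hx hy ⊢
    refine lt_of_pow_lt_pow_left₀ 2 (hH0 _) (lt_of_lt_of_le ?_ (h x y))
    nlinarith
  · have e1 : {a | t < F a} = ∅ := by
      ext a; simpa using (hF1 a).trans h1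
    have e2 : {a | t < G a} = ∅ := by
      ext a; simpa using (hG1 a).trans h1
    simp [e1, e2]

/-- The midpoint Prékopa–Leindler inequality for a measure. -/
def MidpointPrekopaLeindler {α : Type*} [AddCommGroup α] [Module ℝ α] [MeasurableSpace α]
    (m : Measure α) : Prop :=
  ∀ f g h : α → ℝ≥0∞, Measurable f → Measurable g → Measurable h →
    (∀ x y, f x * g y ≤ h ((2⁻¹ : ℝ) • (x + y)) ^ 2) →
      (∫⁻ x, f x ∂m) * ∫⁻ x, g x ∂m ≤ (∫⁻ x, h x ∂m) ^ 2

theorem ENNReal.four_mul_mul_le_sq_add (a b : ℝ≥0∞) : 4 * (a * b) ≤ (a + b) ^ 2 := by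
  induction a with
  | top =>
    simp
  | coe a =>
    induction b with
    | top => simp
    | coe b =>
      have : 4 * (a * b) ≤ (a + b) ^ 2 := by
        rw [← NNReal.coe_le_coe]
        push_cast
        nlinarith [sq_nonneg ((a : ℝ) - b)]
      exact_mod_cast this

/-- Divide f and g by their suprema a and b, and h by √(ab). The additive inequality then holds for
the quotients, and the inequality between arithmetic and geometric means turns it into the
multiplicative one. -/
theorem midpointPrekopaLeindler_bounded {f g h : ℝ → ℝ≥0∞} (hf : Measurable f)
    (hg : Measurable g) (hh : Measurable h) {c : ℝ≥0} (hfc : ∀ x, f x ≤ c) (hgc : ∀ x, g x ≤ c)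
    (hfg : ∀ x y, f x * g y ≤ h ((2⁻¹ : ℝ) • (x + y)) ^ 2) :
    (∫⁻ x, f x) * ∫⁻ x, g x ≤ (∫⁻ x, h x) ^ 2 := by
  set a := ⨆ x, f x
  set b := ⨆ x, g x
  have ha : a ≠ ∞ := ne_top_of_le_ne_top ENNReal.coe_ne_top (iSup_le hfc)
  have hb : b ≠ ∞ := ne_top_of_le_ne_top ENNReal.coe_ne_top (iSup_le hgc)
  by_cases ha0 : a = 0
  · have : ∀ x, f x = 0 := by simpa [a] using ha0
    simp [this]
  by_cases hb0 : b = 0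
  · have : ∀ x, g x = 0 := by simpa [b] using hb0
    simp [this]
  have hfa : ∀ x, f x ≤ a := le_iSup f
  have hgb : ∀ x, g x ≤ b := le_iSup g
  set a' := a.toReal
  set b' := b.toReal
  have ha' : 0 < a' := ENNReal.toReal_pos ha0 ha
  have hb' : 0 < b' := ENNReal.toReal_pos hb0 hb
  set c' := Real.sqrt (a' * b')
  have hc' : 0 < c' := Real.sqrt_pos.2 (by positivity)
  have hcc : c' ^ 2 = a' * b' := Real.sq_sqrt (by positivity)
  -- Capping h at √(ab) makes it finite, so it can be read as a real function; the hypothesis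
  -- survives because f x * g y ≤ ab.
  set h' : ℝ → ℝ≥0∞ := fun x => min (h x) (ENNReal.ofReal c')
  have hh't : ∀ x, h' x ≠ ∞ := fun x => ne_top_of_le_ne_top ENNReal.ofReal_ne_top (min_le_right _ _)
  have hft : ∀ x, f x ≠ ∞ := fun x => ne_top_of_le_ne_top ha (hfa x)
  have hgt : ∀ x, g x ≠ ∞ := fun x => ne_top_of_le_ne_top hb (hgb x)
  have hfa' : ∀ x, (f x).toReal ≤ a' := fun x => ENNReal.toReal_mono ha (hfa x)
  have hgb' : ∀ x, (g x).toReal ≤ b' := fun x => ENNReal.toReal_mono hb (hgb x)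
  have hsup : ∀ (u : ℝ → ℝ≥0∞), (⨆ x, u x) ≠ ∞ → 0 < (⨆ x, u x).toReal → ∀ t < (1 : ℝ),
      ∃ x, t < (u x).toReal / (⨆ x, u x).toReal := by
    intro u hu hu0 t ht
    have : ENNReal.ofReal (t * (⨆ x, u x).toReal) < ⨆ x, u x := by
      refine lt_of_lt_of_eq ((ENNReal.ofReal_lt_ofReal_iff hu0).2 ?_) (ENNReal.ofReal_toReal hu)
      nlinarith
    obtain ⟨x, hx⟩ := lt_iSup_iff.1 this
    refine ⟨x, ?_⟩
    rw [lt_div_iff₀ hu0]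
    have hux : u x ≠ ∞ := ne_top_of_le_ne_top hu (le_iSup u x)
    by_contra! hcon
    have := ENNReal.ofReal_le_ofReal hcon
    rw [ENNReal.ofReal_toReal hux] at this
    exact absurd hx (not_lt.2 this)
  have key := Real.lintegral_add_lintegral_le (F := fun x => (f x).toReal / a')
    (G := fun x => (g x).toReal / b') (H := fun x => (h' x).toReal / c')
    (by fun_prop) (by fun_prop) (by fun_prop) (fun x => by positivity) (fun x => by positivity)
    (fun x => by positivity) (fun x => div_le_one_of_le₀ (hfa' x) ha'.le)
    (fun x => div_le_one_of_le₀ (hgb' x) hb'.le) (hsup f ha ha') (hsup g hb hb') ?_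
  · have conv : ∀ (u : ℝ → ℝ≥0∞) (k : ℝ), 0 < k → (∀ x, u x ≠ ∞) →
        ∫⁻ x, ENNReal.ofReal ((u x).toReal / k) = ENNReal.ofReal k⁻¹ * ∫⁻ x, u x := by
      intro u k hk hu
      rw [← lintegral_const_mul' _ _ ENNReal.ofReal_ne_top]
      refine lintegral_congr fun x => ?_
      rw [div_eq_inv_mul, ENNReal.ofReal_mul (by positivity), ENNReal.ofReal_toReal (hu x)]
    rw [conv f a' ha' hft, conv g b' hb' hgt, conv h' c' hc' hh't] at key
    have h2 := pow_le_pow_left₀ (zero_le) key 2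
    have h3 := (ENNReal.four_mul_mul_le_sq_add _ _).trans h2
    have h4 : ENNReal.ofReal (4 * (a' * b')⁻¹) * ((∫⁻ x, f x) * ∫⁻ x, g x)
        ≤ ENNReal.ofReal (4 * (a' * b')⁻¹) * (∫⁻ x, h' x) ^ 2 := by
      have e1 : ENNReal.ofReal (4 * (a' * b')⁻¹) = 4 * (ENNReal.ofReal a'⁻¹ * ENNReal.ofReal b'⁻¹) := by
        rw [ENNReal.ofReal_mul (by norm_num), mul_inv, ENNReal.ofReal_mul (by positivity)]
        simp
      have e2 : ENNReal.ofReal (4 * (a' * b')⁻¹) = 2 ^ 2 * (ENNReal.ofReal c'⁻¹) ^ 2 := by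
        rw [ENNReal.ofReal_mul (by norm_num), ← hcc, ← inv_pow, ENNReal.ofReal_pow (by positivity)]
        norm_num
      calc _ = _ := by rw [e1, mul_assoc]
        _ = 4 * ((ENNReal.ofReal a'⁻¹ * ∫⁻ (x : ℝ), f x) *
              (ENNReal.ofReal b'⁻¹ * ∫⁻ (x : ℝ), g x)) := by rw [mul_mul_mul_comm]
        _ ≤ _ := h3
        _ = _ := by rw [e2]; simp only [mul_pow, mul_assoc]
    have h5 : ENNReal.ofReal (4 * (a' * b')⁻¹) ≠ 0 := by
      simp only [ne_eq, ENNReal.ofReal_eq_zero, not_le]; positivity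
    refine ((ENNReal.mul_le_mul_iff_right h5 ENNReal.ofReal_ne_top).1 h4).trans ?_
    exact pow_le_pow_left₀ (zero_le) (lintegral_mono fun x => min_le_left _ _) 2
  · intro x y
    have e : (x + y) / 2 = (2⁻¹ : ℝ) • (x + y) := by rw [smul_eq_mul]; ring
    have h1 : f x * g y ≤ h' ((2⁻¹ : ℝ) • (x + y)) ^ 2 := by
      simp only [h']
      rcases min_choice (h ((2⁻¹ : ℝ) • (x + y))) (ENNReal.ofReal c') with h0 | h0
      · rw [h0]; exact hfg x y
      · rw [h0, ← ENNReal.ofReal_pow hc'.le, hcc, ENNReal.ofReal_mul ha'.le,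
          ENNReal.ofReal_toReal ha, ENNReal.ofReal_toReal hb]
        exact mul_le_mul' (hfa x) (hgb y)
    have h2 := ENNReal.toReal_mono (ENNReal.pow_ne_top (hh't _)) h1
    rw [ENNReal.toReal_mul, ENNReal.toReal_pow] at h2
    rw [e, div_mul_div_comm, div_pow, hcc]
    gcongr

theorem midpointPrekopaLeindler_volume : MidpointPrekopaLeindler (volume : Measure ℝ) := by
  intro f g h hf hg hh hfg
  have key : ∀ n : ℕ, (∫⁻ x, min (f x) n) * ∫⁻ x, min (g x) n ≤ (∫⁻ x, h x) ^ 2 := fun n =>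
    midpointPrekopaLeindler_bounded (c := n) (by fun_prop) (by fun_prop) hh
      (fun x => by simp) (fun x => by simp)
      fun x y => (mul_le_mul' (min_le_left _ _) (min_le_left _ _)).trans (hfg x y)
  have lim : ∀ u : ℝ → ℝ≥0∞, Measurable u → 
      ∫⁻ x, u x = ⨆ n : ℕ, ∫⁻ x, min (u x) n := by
    intro u hu
    rw [← lintegral_iSup (f := fun (n : ℕ) x => min (u x) n) (fun n => hu.min measurable_const)
      (fun i j hij x => min_le_min_left _ (by exact_mod_cast hij))]
    refine lintegral_congr fun x => ?_
    rw [← inf_iSup_eq, ENNReal.iSup_natCast, inf_top_eq]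
  rw [lim f hf, lim g hg]
  simp only [ENNReal.iSup_mul, ENNReal.mul_iSup, iSup_le_iff]
  intro i j
  refine le_trans (mul_le_mul' ?_ ?_) (key (max i j))
  · exact lintegral_mono fun x => min_le_min_left _ (by exact_mod_cast le_max_right i j)
  · exact lintegral_mono fun x => min_le_min_left _ (by exact_mod_cast le_max_left i j)

/-- A midpoint log-concave density can be absorbed into the three functions. -/
theorem MidpointPrekopaLeindler.withDensity {α : Type*} [AddCommGroup α] [Module ℝ α]
    [MeasurableSpace α] {m : Measure α} (hm : MidpointPrekopaLeindler m) {w : α → ℝ≥0∞}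
    (hw : Measurable w) (hlog : ∀ x y, w x * w y ≤ w ((2⁻¹ : ℝ) • (x + y)) ^ 2) :
    MidpointPrekopaLeindler (m.withDensity w) := by
  intro f g h hf hg hh hfg
  rw [lintegral_withDensity_eq_lintegral_mul _ hw hf, lintegral_withDensity_eq_lintegral_mul _ hw hg,
    lintegral_withDensity_eq_lintegral_mul _ hw hh]
  refine hm _ _ _ (hw.mul hf) (hw.mul hg) (hw.mul hh) fun x y => ?_
  simp only [Pi.mul_apply]
  rw [mul_mul_mul_comm, mul_pow]
  exact mul_le_mul' (hlog x y) (hfg x y)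

theorem midpointPrekopaLeindler_gaussianReal :
    MidpointPrekopaLeindler (gaussianReal 0 1) := by
  rw [gaussianReal_of_var_ne_zero 0 one_ne_zero]
  refine midpointPrekopaLeindler_volume.withDensity (measurable_gaussianPDF 0 1) fun x y => ?_
  simp only [gaussianPDF]
  rw [← ENNReal.ofReal_mul (gaussianPDFReal_nonneg 0 1 x),
    ← ENNReal.ofReal_pow (gaussianPDFReal_nonneg 0 1 _)]
  apply ENNReal.ofReal_le_ofReal
  simp only [gaussianPDFReal, smul_eq_mul]
  rw [mul_mul_mul_comm, mul_pow, ← sq, ← Real.exp_add, ← Real.exp_nat_mul]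
  refine mul_le_mul_of_nonneg_left ?_ (sq_nonneg _)
  rw [Real.exp_le_exp]
  push_cast
  nlinarith [sq_nonneg (x - y)]

/-- Tensorisation: the inequality in the second variable says that the three partial integrals
satisfy the hypothesis in the first. -/
theorem MidpointPrekopaLeindler.prod {α β : Type*} [AddCommGroup α] [Module ℝ α]
    [MeasurableSpace α] [AddCommGroup β] [Module ℝ β] [MeasurableSpace β] {m : Measure α}
    {m' : Measure β} [SFinite m] [SFinite m'] (hm : MidpointPrekopaLeindler m)
    (hm' : MidpointPrekopaLeindler m') : MidpointPrekopaLeindler (m.prod m') := by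
  intro f g h hf hg hh hfg
  rw [lintegral_prod _ hf.aemeasurable, lintegral_prod _ hg.aemeasurable,
    lintegral_prod _ hh.aemeasurable]
  refine hm _ _ _ hf.lintegral_prod_right' hg.lintegral_prod_right' hh.lintegral_prod_right'
    fun x y => ?_
  exact hm' _ _ _ (by fun_prop) (by fun_prop) (by fun_prop) fun u v => hfg (x, u) (y, v)

theorem MidpointPrekopaLeindler.map {α β : Type*} [AddCommGroup α] [Module ℝ α]
    [MeasurableSpace α] [AddCommGroup β] [Module ℝ β] [MeasurableSpace β] {m : Measure α}
    (hm : MidpointPrekopaLeindler m) (e : α →ₗ[ℝ] β) (he : Measurable e) :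
    MidpointPrekopaLeindler (m.map e) := by
  intro f g h hf hg hh hfg
  rw [lintegral_map hf he, lintegral_map hg he, lintegral_map hh he]
  refine hm _ _ _ (hf.comp he) (hg.comp he) (hh.comp he) fun x y => ?_
  simpa using hfg (e x) (e y)

instance (N : ℕ) : IsProbabilityMeasure (gammaStd N) := by
  unfold gammaStd
  infer_instance

theorem midpointPrekopaLeindler_gammaStd (N : ℕ) : MidpointPrekopaLeindler (gammaStd N) := by
  induction N with
  | zero =>
    intro f g h hf hg hh hfg
    have e : gammaStd 0 Set.univ = 1 := by simp [gammaStd]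
    rw [lintegral_unique, lintegral_unique, lintegral_unique, e, mul_one, mul_one, mul_one]
    convert hfg 0 0 using 3
  | succ N ih =>
    let e : (ℝ × (Fin N → ℝ)) →ₗ[ℝ] (Fin (N + 1) → ℝ) :=
      { toFun := fun p => Matrix.vecCons p.1 p.2
        map_add' := fun p p' => by
          ext i; refine Fin.cases ?_ (fun i => ?_) i <;> simp
        map_smul' := fun c p => by
          ext i; refine Fin.cases ?_ (fun i => ?_) i <;> simp }
    have h1 := (midpointPrekopaLeindler_gaussianReal.prod ih).map e ?_
    · have h2 := (measurePreserving_piFinSuccAbove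
        (fun _ : Fin (N + 1) => gaussianReal 0 1) 0).symm.map_eq
      have h3 : ⇑e = (MeasurableEquiv.piFinSuccAbove (fun _ : Fin (N + 1) => ℝ) 0).symm := by
        ext p i
        simp [e, Matrix.vecCons]
      rw [h3] at h1
      unfold gammaStd at h1 ⊢
      rwa [h2] at h1
    · refine measurable_pi_lambda _ fun i => ?_
      refine Fin.cases ?_ (fun i => ?_) i
      · exact measurable_fst
      · exact (measurable_pi_apply i).comp measurable_snd

theorem map_neg_gammaStd (N : ℕ) : (gammaStd N).map (fun x => -x) = gammaStd N := by
  unfold gammaStd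
  have h := Measure.pi_map_pi (μ := fun _ : Fin N => gaussianReal 0 1) (f := fun _ x => -x)
    (hμ := fun i => by rw [gaussianReal_map_neg]; infer_instance) (fun i => by fun_prop)
  simp only [gaussianReal_map_neg, neg_zero] at h
  exact h

/-- **Anderson's inequality** for the standard Gaussian measure and the balls of a (semi)norm. -/
theorem gammaStd_shift_le {N : ℕ} (p : (Fin N → ℝ) → ℝ) (hp : Measurable p)
    (hadd : ∀ x y, p (x + y) ≤ p x + p y) (hsmul : ∀ (c : ℝ) x, p (c • x) = |c| * p x)
    (L : (Fin N → ℝ) →ₗ[ℝ] (Fin N → ℝ)) (b : Fin N → ℝ) (t : ℝ) :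
    gammaStd N {x | p (L x - b) ≤ t} ≤ gammaStd N {x | p (L x) ≤ t} := by
  have hL : Measurable L := (LinearMap.continuous_of_finiteDimensional L).measurable
  have hneg : ∀ x, p (-x) = p x := fun x => by simpa using hsmul (-1) x
  have hm : ∀ c, MeasurableSet {x | p (L x - c) ≤ t} := fun c =>
    measurableSet_le (hp.comp (hL.sub_const c)) measurable_const
  have hm0 : MeasurableSet {x | p (L x) ≤ t} := measurableSet_le (hp.comp hL) measurable_const
  -- The sets for b and -b are reflections of each other and have equal measure, while by convexity
  -- of p their midpoints lie in the centred set. Prékopa–Leindler for the indicators then compares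
  -- the squares of the two measures.
  have e : gammaStd N {x | p (L x - b) ≤ t} = gammaStd N {x | p (L x - (-b)) ≤ t} := by
    conv_lhs => rw [← map_neg_gammaStd N, Measure.map_apply measurable_neg (hm b)]
    congr 1
    ext x
    simp only [Set.preimage_ofPred_eq, Set.mem_ofPred_eq, map_neg]
    rw [← hneg]
    congr! 2
    abel
  have key := midpointPrekopaLeindler_gammaStd N ({x | p (L x - b) ≤ t}.indicator 1)
    ({x | p (L x - (-b)) ≤ t}.indicator 1) ({x | p (L x) ≤ t}.indicator 1)
    (measurable_one.indicator (hm b)) (measurable_one.indicator (hm _))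
    (measurable_one.indicator hm0) ?_
  · rw [lintegral_indicator_one (hm _), lintegral_indicator_one (hm _),
      lintegral_indicator_one hm0, ← e, ← sq] at key
    exact (ENNReal.pow_le_pow_left_iff two_ne_zero).1 key
  · intro x y
    by_cases hx : p (L x - b) ≤ t
    · by_cases hy : p (L y - (-b)) ≤ t
      · have : p (L ((2⁻¹ : ℝ) • (x + y))) ≤ t := by
          have e2 : L ((2⁻¹ : ℝ) • (x + y)) = (2⁻¹ : ℝ) • ((L x - b) + (L y - (-b))) := by
            rw [map_smul, map_add]; congr 1; abel
          rw [e2, hsmul]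
          have := hadd (L x - b) (L y - (-b))
          rw [abs_of_pos (by norm_num)]
          linarith
        rw [Set.indicator_of_mem (show (2⁻¹ : ℝ) • (x + y) ∈ {x | p (L x) ≤ t} from this),
          Set.indicator_of_mem (show x ∈ {x | p (L x - b) ≤ t} from hx),
          Set.indicator_of_mem (show y ∈ {x | p (L x - (-b)) ≤ t} from hy)]
        simp
      · rw [Set.indicator_of_notMem (s := {x | p (L x - (-b)) ≤ t}) hy, mul_zero]
        exact zero_le
    · rw [Set.indicator_of_notMem (s := {x | p (L x - b) ≤ t}) hx, zero_mul]
      exact zero_le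

/-! ### The differential operator of the weighted ball and its symmetry. -/

section BallOperator

variable {d : ℕ}

/-- The partial derivative in the `i`-th coordinate. -/
def partialD (i : Fin d) (f : EucSp d → ℝ) (x : EucSp d) : ℝ :=
  fderiv ℝ f x (EuclideanSpace.single i 1)

/-- The Euler operator `x · ∇`. -/
def eulerD (f : EucSp d → ℝ) (x : EucSp d) : ℝ := fderiv ℝ f x x

/-- The second-order operator `Δ - (x·∇)² - (2μ+d-1) x·∇` of the weighted ball. -/
def ballOp (μ : ℝ≥0) (f : EucSp d → ℝ) (x : EucSp d) : ℝ :=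
  ∑ i, partialD i (partialD i f) x - eulerD (eulerD f) x - (2 * (μ : ℝ) + d - 1) * eulerD f x

theorem eulerD_eq_sum (f : EucSp d → ℝ) (x : EucSp d) :
    eulerD f x = ∑ i, x i * partialD i f x := by
  have hx : x = ∑ i, x i • (EuclideanSpace.single i (1 : ℝ) : EucSp d) := by
    have := (EuclideanSpace.basisFun (Fin d) ℝ).sum_repr x
    simpa using this.symm
  have h := congrArg (fderiv ℝ f x) hx
  rw [map_sum] at h
  simpa [eulerD, partialD] using h

theorem contDiff_partialD {f : EucSp d → ℝ} {n m : WithTop ℕ∞} (hf : ContDiff ℝ n f)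
    (hmn : m + 1 ≤ n) (i : Fin d) : ContDiff ℝ m (partialD i f) :=
  (hf.fderiv_right hmn).clm_apply contDiff_const

theorem contDiff_eulerD {f : EucSp d → ℝ} {n m : WithTop ℕ∞} (hf : ContDiff ℝ n f)
    (hmn : m + 1 ≤ n) : ContDiff ℝ m (eulerD f) :=
  (hf.fderiv_right hmn).clm_apply contDiff_id

theorem continuous_ballOp (μ : ℝ≥0) {f : EucSp d → ℝ} (hf : ContDiff ℝ 2 f) :
    Continuous (ballOp μ f) := by
  have h1 : ∀ i, Continuous (partialD i (partialD i f)) := fun i =>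
    (contDiff_partialD (m := 0) (contDiff_partialD (m := 1) hf (by norm_num) i) (by norm_num)
      i).continuous
  have h2 : Continuous (eulerD f) := (contDiff_eulerD (m := 1) hf (by norm_num)).continuous
  have h3 : Continuous (eulerD (eulerD f)) :=
    (contDiff_eulerD (m := 0) (contDiff_eulerD (m := 1) hf (by norm_num)) (by norm_num)).continuous
  unfold ballOp
  fun_prop

theorem contDiff_ballOp (μ : ℝ≥0) {f : EucSp d → ℝ} (hf : ContDiff ℝ (⊤ : ℕ∞) f) :
    ContDiff ℝ (⊤ : ℕ∞) (ballOp μ f) := by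
  have htop : ((⊤ : ℕ∞) : WithTop ℕ∞) + 1 ≤ ((⊤ : ℕ∞) : WithTop ℕ∞) := le_of_eq rfl
  have h1 : ∀ i, ContDiff ℝ (⊤ : ℕ∞) (partialD i (partialD i f)) := fun i =>
    contDiff_partialD (contDiff_partialD hf htop i) htop i
  have h2 : ContDiff ℝ (⊤ : ℕ∞) (eulerD f) := contDiff_eulerD hf htop
  have h3 : ContDiff ℝ (⊤ : ℕ∞) (eulerD (eulerD f)) := contDiff_eulerD h2 htop
  exact ((ContDiff.sum fun i _ => h1 i).sub h3).sub (contDiff_const.mul h2)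

/-- The carré du champ `∇f · ∇g - (x·∇f)(x·∇g)` of the operator `ballOp`. -/
def ballGamma (f g : EucSp d → ℝ) (x : EucSp d) : ℝ :=
  ∑ i, partialD i f x * partialD i g x - eulerD f x * eulerD g x

theorem ballGamma_comm (f g : EucSp d → ℝ) : ballGamma f g = ballGamma g f := by
  ext x
  simp [ballGamma, mul_comm]

theorem continuous_ballGamma {f g : EucSp d → ℝ} (hf : ContDiff ℝ 1 f) (hg : ContDiff ℝ 1 g) :
    Continuous (ballGamma f g) := by
  have h1 := fun i => (contDiff_partialD (m := 0) hf (by norm_num) i).continuous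
  have h2 := fun i => (contDiff_partialD (m := 0) hg (by norm_num) i).continuous
  have h3 := (contDiff_eulerD (m := 0) hf (by norm_num)).continuous
  have h4 := (contDiff_eulerD (m := 0) hg (by norm_num)).continuous
  unfold ballGamma
  fun_prop

theorem integral_ballMeasure (μ : ℝ≥0) (F : EucSp d → ℝ) :
    ∫ x, F x ∂(ballMeasure d μ) =
      ∫ x in Metric.closedBall 0 1, (1 - ‖x‖ ^ 2) ^ ((μ : ℝ) - 1 / 2) * F x := by
  unfold ballMeasure
  rw [integral_withDensity_eq_integral_toReal_smul (by fun_prop) (by simp)]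
  refine setIntegral_congr_fun Metric.isClosed_closedBall.measurableSet fun x hx => ?_
  have hx' : ‖x‖ ≤ 1 := by simpa using hx
  simp only [smul_eq_mul]
  rw [ENNReal.toReal_ofReal]
  apply Real.rpow_nonneg
  nlinarith [norm_nonneg x]

theorem integrable_ballMeasure [NeZero d] (μ : ℝ≥0) {F : EucSp d → ℝ} (hF : Continuous F) :
    Integrable F (ballMeasure d μ) := by
  obtain ⟨C, hC⟩ := (isCompact_closedBall (0 : EucSp d) 1).exists_bound_of_continuousOn
    hF.continuousOn
  exact Integrable.of_bound hF.aestronglyMeasurable C ((ballMeasure_ae_mem d μ).mono hC)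

theorem ballMeasure_ae_mem_ball (d : ℕ) [NeZero d] (μ : ℝ≥0) :
    ∀ᵐ x ∂(ballMeasure d μ), x ∈ Metric.ball (0 : EucSp d) 1 := by
  have h1 : ∀ᵐ x ∂(ballMeasure d μ), x ∉ Metric.sphere (0 : EucSp d) 1 := by
    refine ((withDensity_absolutelyContinuous _ _).trans Measure.restrict_le_self.absolutelyContinuous).ae_le ?_
    exact measure_eq_zero_iff_ae_notMem.1 (Measure.addHaar_sphere volume 0 1)
  filter_upwards [h1, ballMeasure_ae_mem d μ] with x hx hx'
  simp only [Metric.mem_sphere, Metric.mem_closedBall, Metric.mem_ball] at *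
  exact lt_of_le_of_ne hx' hx

/-- In divergence form W_μ · `ballOp` f = div(W_μ v) with v = ∇f - x (x·∇f), and the integrand times
W_μ is div(W_μ g v). The support condition keeps W_μ g of class C¹ with compact support, although
W_μ may be singular on the sphere. -/
theorem integral_ballGamma_add_of_tsupport (μ : ℝ≥0) {f g : EucSp d → ℝ} (hf : ContDiff ℝ 2 f)
    (hg : ContDiff ℝ 1 g) (hsupp : tsupport g ⊆ Metric.ball 0 1) :
    ∫ x, (ballGamma g f x + g x * ballOp μ f x) ∂(ballMeasure d μ) = 0 := by
  set a : ℝ := (μ : ℝ) - 1 / 2 with ha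
  set W : EucSp d → ℝ := fun x => (1 - ‖x‖ ^ 2) ^ a with hW
  set u : EucSp d → ℝ := fun x => W x * g x with hu
  have hpos : ∀ x ∈ Metric.ball (0 : EucSp d) 1, 0 < 1 - ‖x‖ ^ 2 := fun x hx => by
    have : ‖x‖ < 1 := by simpa using hx
    nlinarith [norm_nonneg x]
  have htu : tsupport u ⊆ tsupport g := closure_mono (Function.support_mul_subset_right _ _)
  have hWd : ∀ x ∈ Metric.ball (0 : EucSp d) 1, ContDiffAt ℝ 1 W x := fun x hx =>
    ContDiffAt.rpow_const_of_ne (contDiff_const.sub (contDiff_norm_sq ℝ)).contDiffAt (hpos x hx).ne'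
  have huC : ContDiff ℝ 1 u := contDiff_iff_contDiffAt.2 fun x => by
    by_cases hx : x ∈ tsupport u
    · exact (hWd x (hsupp (htu hx))).mul hg.contDiffAt
    · exact contDiffAt_const.congr_of_eventuallyEq (notMem_tsupport_iff_eventuallyEq.1 hx)
  have huc : HasCompactSupport u := by
    refine HasCompactSupport.of_support_subset_isCompact (isCompact_closedBall (0 : EucSp d) 1) ?_
    exact ((subset_tsupport u).trans htu).trans (hsupp.trans Metric.ball_subset_closedBall)
  set v : Fin d → EucSp d → ℝ := fun i x => partialD i f x - x i * eulerD f x with hv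
  have hE : ContDiff ℝ 1 (eulerD f) := contDiff_eulerD hf (by norm_num)
  have hP : ∀ i, ContDiff ℝ 1 (partialD i f) := fun i => contDiff_partialD hf (by norm_num) i
  have hvC : ∀ i, ContDiff ℝ 1 (v i) := fun i => by
    have : ContDiff ℝ 1 (fun x : EucSp d => x i) := by fun_prop
    exact (hP i).sub (this.mul hE)
  have hpu : ∀ i, Continuous (partialD i u) := fun i =>
    (contDiff_partialD (m := 0) huC (by norm_num) i).continuous
  have hpv : ∀ i, Continuous (partialD i (v i)) := fun i =>
    (contDiff_partialD (m := 0) (hvC i) (by norm_num) i).continuous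
  have hpuc : ∀ i, HasCompactSupport (partialD i u) := fun i =>
    (huc.fderiv_apply ℝ (EuclideanSpace.single i 1))
  have hi1 : ∀ i, Integrable (fun x => partialD i u x * v i x) := fun i =>
    ((hpu i).mul (hvC i).continuous).integrable_of_hasCompactSupport ((hpuc i).mul_right)
  have hi2 : ∀ i, Integrable (fun x => u x * partialD i (v i) x) := fun i =>
    (huC.continuous.mul (hpv i)).integrable_of_hasCompactSupport (huc.mul_right)
  have hibp : ∀ i, ∫ x, (u x * partialD i (v i) x + partialD i u x * v i x) = 0 := fun i => by
    rw [integral_add (hi2 i) (hi1 i)]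
    have := integral_mul_fderiv_eq_neg_fderiv_mul_of_integrable (μ := volume) (f := u) (g := v i)
      (v := EuclideanSpace.single i 1) (hi1 i) (hi2 i)
      ((huC.continuous.mul (hvC i).continuous).integrable_of_hasCompactSupport (huc.mul_right))
      (fun x _ => huC.differentiable one_ne_zero x)
      (fun x _ => (hvC i).differentiable one_ne_zero x)
    unfold partialD
    rw [this]
    simp
  have hsum : ∫ x, ∑ i, (u x * partialD i (v i) x + partialD i u x * v i x) = 0 := by
    rw [integral_finsetSum (f := fun i x => u x * partialD i (v i) x + partialD i u x * v i x) _
      fun i _ => (hi2 i).add (hi1 i)]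
    exact Finset.sum_eq_zero fun i _ => hibp i
  have hdv : ∀ i x, partialD i (v i) x =
      partialD i (partialD i f) x - (eulerD f x + x i * partialD i (eulerD f) x) := by
    intro i x
    have e1 : HasFDerivAt (fun x : EucSp d => x i) (EuclideanSpace.proj i : EucSp d →L[ℝ] ℝ) x :=
      (EuclideanSpace.proj i : EucSp d →L[ℝ] ℝ).hasFDerivAt
    have e2 := ((hP i).differentiable one_ne_zero x).hasFDerivAt.sub
      (e1.mul (hE.differentiable one_ne_zero x).hasFDerivAt)
    have e3 := e2.fderiv
    have e4 : ∀ h : EucSp d → ℝ,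
        partialD i h x = fderiv ℝ h x (EuclideanSpace.single i 1) := fun _ => rfl
    rw [e4 (v i), e4 (partialD i f), e4 (eulerD f)]
    change fderiv ℝ (partialD i f - (fun x : EucSp d => x i) * eulerD f) x _ = _
    rw [e3]
    simp
    ring
  have hdu : ∀ i, ∀ x ∈ Metric.ball (0 : EucSp d) 1, partialD i u x =
      W x * partialD i g x - 2 * a * x i * (1 - ‖x‖ ^ 2)⁻¹ * W x * g x := by
    intro i x hx
    have e1 : HasFDerivAt (fun x : EucSp d => 1 - ‖x‖ ^ 2) (-(2 • innerSL ℝ x)) x :=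
      (hasStrictFDerivAt_norm_sq x).hasFDerivAt.const_sub 1
    have e2 := e1.rpow_const (p := a) (Or.inl (hpos x hx).ne')
    have e3 := (e2.mul (hg.differentiable one_ne_zero x).hasFDerivAt).fderiv
    unfold partialD
    change fderiv ℝ ((fun x => (1 - ‖x‖ ^ 2) ^ a) * g) x _ = _
    rw [e3, Real.rpow_sub_one (hpos x hx).ne']
    simp [hW, EuclideanSpace.inner_single_right]
    ring
  -- Differentiating W_μ produces (1 - ‖x‖²)⁻¹, which is cancelled by x·v = (1 - ‖x‖²)(x·∇f). The
  -- exponent 2μ - 1 from the weight and the d from div x together give the coefficient 2μ + d - 1.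
  have hpt : ∀ x, ∑ i, (u x * partialD i (v i) x + partialD i u x * v i x) =
      (Metric.closedBall (0 : EucSp d) 1).indicator
        (fun x => W x * (ballGamma g f x + g x * ballOp μ f x)) x := by
    intro x
    by_cases hx : x ∈ Metric.ball (0 : EucSp d) 1
    · rw [Set.indicator_of_mem (Metric.ball_subset_closedBall hx)]
      have hx0 := (hpos x hx).ne'
      have hn : ‖x‖ ^ 2 = ∑ i, x i * x i := by
        rw [EuclideanSpace.real_norm_sq_eq]; simp [sq]
      simp only [hdv, hdu _ x hx]
      have e0 : ∀ i, u x * (partialD i (partialD i f) x - (eulerD f x + x i * partialD i (eulerD f) x))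
          + (W x * partialD i g x - 2 * a * x i * (1 - ‖x‖ ^ 2)⁻¹ * W x * g x) * v i x
          = W x * g x * partialD i (partialD i f) x - W x * g x * eulerD f x
            - W x * g x * (x i * partialD i (eulerD f) x)
            + W x * (partialD i g x * partialD i f x)
            - W x * eulerD f x * (x i * partialD i g x)
            - 2 * a * (1 - ‖x‖ ^ 2)⁻¹ * W x * g x * (x i * partialD i f x)
            + 2 * a * (1 - ‖x‖ ^ 2)⁻¹ * W x * g x * eulerD f x * (x i * x i) := by
        intro i
        simp only [hu, hv]
        ring
      simp only [e0, Finset.sum_add_distrib, Finset.sum_sub_distrib, ← Finset.mul_sum,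
        ← eulerD_eq_sum, ← hn, Finset.sum_const, Finset.card_univ, Fintype.card_fin, nsmul_eq_mul]
      unfold ballGamma ballOp
      have e1 : 2 * (μ : ℝ) = 2 * a + 1 := by rw [ha]; ring
      rw [e1]
      field_simp
      ring
    · have h0 : x ∉ tsupport g := fun h => hx (hsupp h)
      have h1 : g x = 0 := image_eq_zero_of_notMem_tsupport h0
      have h2 : fderiv ℝ g x = 0 := fderiv_of_notMem_tsupport ℝ h0
      have h3 : fderiv ℝ u x = 0 := fderiv_of_notMem_tsupport ℝ fun h => h0 (htu h)
      have h4 : W x * (ballGamma g f x + g x * ballOp μ f x) = 0 := by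
        simp [ballGamma, partialD, eulerD, h1, h2]
      classical rw [Set.indicator_apply, h4, ite_self]
      have h5 : u x = 0 := by simp [hu, h1]
      have h6 : ∀ i, partialD i u x = 0 := fun i => by simp [partialD, h3]
      simp [h5, h6]
  rw [integral_ballMeasure, ← integral_indicator Metric.isClosed_closedBall.measurableSet, ← hsum]
  exact integral_congr_ae (.of_forall fun x => (hpt x).symm)

/-- A smooth function vanishing on `(-∞, 1]` and equal to one on `[2, ∞)`. -/
def cutoffFun (t : ℝ) : ℝ := Real.smoothTransition (t - 1)

theorem contDiff_cutoffFun : ContDiff ℝ 1 cutoffFun :=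
  Real.smoothTransition.contDiff.comp (contDiff_id.sub contDiff_const)

theorem cutoffFun_of_le {t : ℝ} (ht : t ≤ 1) : cutoffFun t = 0 :=
  Real.smoothTransition.zero_of_nonpos (by linarith)

theorem cutoffFun_of_ge {t : ℝ} (ht : 2 ≤ t) : cutoffFun t = 1 :=
  Real.smoothTransition.one_of_one_le (by linarith)

theorem abs_cutoffFun_le (t : ℝ) : |cutoffFun t| ≤ 1 := by
  rw [cutoffFun, abs_of_nonneg (Real.smoothTransition.nonneg _)]
  exact Real.smoothTransition.le_one _

theorem deriv_cutoffFun_of_gt {t : ℝ} (ht : 2 < t) : deriv cutoffFun t = 0 := by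
  have : cutoffFun =ᶠ[nhds t] fun _ => 1 := by
    filter_upwards [lt_mem_nhds ht] with s hs using cutoffFun_of_ge hs.le
  rw [this.deriv_eq, deriv_const]

theorem deriv_cutoffFun_of_lt {t : ℝ} (ht : t < 1) : deriv cutoffFun t = 0 := by
  have : cutoffFun =ᶠ[nhds t] fun _ => 0 := by
    filter_upwards [gt_mem_nhds ht] with s hs using cutoffFun_of_le hs.le
  rw [this.deriv_eq, deriv_const]

/-- The derivative vanishes outside [1, 2]. This bound dominates the boundary layer when the cutoff
is removed. -/
theorem exists_bound_mul_deriv_cutoffFun : ∃ C : ℝ, ∀ t, |t * deriv cutoffFun t| ≤ C := by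
  have hc : Continuous fun t => t * deriv cutoffFun t :=
    continuous_id.mul (contDiff_cutoffFun.continuous_deriv le_rfl)
  obtain ⟨C, hC⟩ := (isCompact_Icc (a := (1 : ℝ)) (b := 2)).exists_bound_of_continuousOn
    hc.continuousOn
  refine ⟨max C 0, fun t => ?_⟩
  by_cases ht : t ∈ Set.Icc (1 : ℝ) 2
  · exact (hC t ht).trans (le_max_left _ _)
  · rw [Set.mem_Icc, not_and_or, not_le, not_le] at ht
    have : deriv cutoffFun t = 0 := ht.elim deriv_cutoffFun_of_lt deriv_cutoffFun_of_gt
    simp [this]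

/-- Cut g off near the sphere and pass to the limit. No boundary term survives for any μ ≥ 0,
because the field ∇f - x (x·∇f) has normal component (1 - ‖x‖²)(x·∇f), which vanishes on the sphere.
-/
theorem integral_ballGamma_add [NeZero d] (μ : ℝ≥0) {f g : EucSp d → ℝ} (hf : ContDiff ℝ 2 f)
    (hg : ContDiff ℝ 1 g) :
    ∫ x, (ballGamma g f x + g x * ballOp μ f x) ∂(ballMeasure d μ) = 0 := by
  set τ : ℕ → EucSp d → ℝ := fun k x => ((k : ℝ) + 1) * (1 - ‖x‖ ^ 2) with hτ
  set G : ℕ → EucSp d → ℝ := fun k x => cutoffFun (τ k x) * g x with hG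
  set J : EucSp d → ℝ := fun x => ballGamma g f x + g x * ballOp μ f x with hJ
  have hτC : ∀ k, ContDiff ℝ 1 (τ k) := fun k =>
    contDiff_const.mul (contDiff_const.sub (contDiff_norm_sq ℝ))
  have hχC : ∀ k, ContDiff ℝ 1 fun x => cutoffFun (τ k x) := fun k =>
    contDiff_cutoffFun.comp (hτC k)
  have hGC : ∀ k, ContDiff ℝ 1 (G k) := fun k => (hχC k).mul hg
  have hGs : ∀ k, tsupport (G k) ⊆ Metric.ball 0 1 := by
    intro k
    have hcl : IsClosed {x : EucSp d | 1 ≤ τ k x} := isClosed_le continuous_const (hτC k).continuous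
    have h1 : tsupport (G k) ⊆ {x : EucSp d | 1 ≤ τ k x} := by
      refine closure_minimal (fun x hx => ?_) hcl
      by_contra hcon
      simp only [Set.mem_ofPred_eq, not_le] at hcon
      exact hx (by simp [hG, cutoffFun_of_le hcon.le])
    refine h1.trans fun x hx => ?_
    simp only [Set.mem_ofPred_eq, hτ] at hx
    rw [mem_ball_zero_iff]
    by_contra! hcon
    have h2 : 1 - ‖x‖ ^ 2 ≤ 0 := by nlinarith
    have h3 : (0 : ℝ) ≤ (k : ℝ) + 1 := by positivity
    nlinarith [mul_nonneg h3 (neg_nonneg.2 h2)]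
  have hGd : ∀ k x v, fderiv ℝ (G k) x v = cutoffFun (τ k x) * fderiv ℝ g x v
      - 2 * ((k : ℝ) + 1) * deriv cutoffFun (τ k x) * g x * ⟪x, v⟫ := by
    intro k x v
    have e1 : HasFDerivAt (τ k) (((k : ℝ) + 1) • (-(2 • innerSL ℝ x) : EucSp d →L[ℝ] ℝ)) x :=
      ((hasStrictFDerivAt_norm_sq x).hasFDerivAt.const_sub 1).const_mul _
    have e2 := ((contDiff_cutoffFun.differentiable one_ne_zero (τ k x)).hasDerivAt).comp_hasFDerivAt
      x e1
    have e3 := (e2.mul (hg.differentiable one_ne_zero x).hasFDerivAt).fderiv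
    change fderiv ℝ ((cutoffFun ∘ τ k) * g) x v = _
    rw [e3]
    simp
    ring
  -- The gradient of the cutoff is radial of size k + 1, and the carré du champ supplies the factor
  -- 1 - ‖x‖². Their product is again τ, so the error is τ χ'(τ) times a fixed function, bounded
  -- uniformly in k.
  have hI : ∀ k x, ballGamma (G k) f x + G k x * ballOp μ f x = cutoffFun (τ k x) * J x
      - 2 * (τ k x * deriv cutoffFun (τ k x)) * (g x * eulerD f x) := by
    intro k x
    have e1 : ∀ i, partialD i (G k) x * partialD i f x
        = cutoffFun (τ k x) * (partialD i g x * partialD i f x)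
          - 2 * ((k : ℝ) + 1) * deriv cutoffFun (τ k x) * g x * (x i * partialD i f x) := by
      intro i
      have := hGd k x (EuclideanSpace.single i 1)
      simp only [EuclideanSpace.inner_single_right] at this
      unfold partialD
      rw [this]
      simp
      ring
    have e2 : eulerD (G k) x = cutoffFun (τ k x) * eulerD g x
      - 2 * ((k : ℝ) + 1) * deriv cutoffFun (τ k x) * g x * ‖x‖ ^ 2 := by
      have := hGd k x x
      rw [real_inner_self_eq_norm_sq] at this
      exact this
    simp only [ballGamma, e1, e2, Finset.sum_sub_distrib, ← Finset.mul_sum, ← eulerD_eq_sum, hJ]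
    simp only [hG, hτ]
    ring
  have hzero : ∀ k, ∫ x, (cutoffFun (τ k x) * J x
      - 2 * (τ k x * deriv cutoffFun (τ k x)) * (g x * eulerD f x)) ∂(ballMeasure d μ) = 0 := by
    intro k
    simp only [← hI]
    exact integral_ballGamma_add_of_tsupport μ hf (hGC k) (hGs k)
  have hJc : Continuous J :=
    (continuous_ballGamma hg (hf.of_le (by norm_num))).add (hg.continuous.mul (continuous_ballOp μ hf))
  have hEc : Continuous fun x => g x * eulerD f x :=
    hg.continuous.mul (contDiff_eulerD (m := 0) (hf.of_le (m := 1) (by norm_num))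
      (by norm_num)).continuous
  obtain ⟨C, hC⟩ := exists_bound_mul_deriv_cutoffFun
  have hdc : Continuous (deriv cutoffFun) := contDiff_cutoffFun.continuous_deriv le_rfl
  have key := tendsto_integral_of_dominated_convergence (μ := ballMeasure d μ)
    (F := fun k x => cutoffFun (τ k x) * J x
      - 2 * (τ k x * deriv cutoffFun (τ k x)) * (g x * eulerD f x)) (f := J)
    (fun x => |J x| + 2 * C * |g x * eulerD f x|) (fun k => ?_) ?_ (fun k => ?_) ?_
  · simp only [hzero] at key
    exact tendsto_nhds_unique key tendsto_const_nhds |>.symm ▸ rfl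
  · have h1 : Continuous fun x => cutoffFun (τ k x) := (hχC k).continuous
    have h2 : Continuous (τ k) := (hτC k).continuous
    exact Continuous.aestronglyMeasurable (by fun_prop)
  · exact integrable_ballMeasure μ (by fun_prop)
  · refine .of_forall fun x => ?_
    refine (norm_sub_le _ _).trans (add_le_add ?_ ?_)
    · rw [norm_mul, Real.norm_eq_abs, Real.norm_eq_abs]
      exact mul_le_of_le_one_left (abs_nonneg _) (abs_cutoffFun_le _)
    · rw [norm_mul, norm_mul, Real.norm_eq_abs, Real.norm_eq_abs, Real.norm_eq_abs, abs_two]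
      gcongr
      exact hC _
  · filter_upwards [ballMeasure_ae_mem_ball d μ] with x hx
    have hx1 : 0 < 1 - ‖x‖ ^ 2 := by
      have : ‖x‖ < 1 := by simpa using hx
      nlinarith [norm_nonneg x]
    -- At a fixed interior point τ exceeds 2 for all large k, and the integrand is then equal to its
    -- limit.
    refine tendsto_const_nhds.congr' ?_
    obtain ⟨k0, hk0⟩ := exists_nat_gt (2 / (1 - ‖x‖ ^ 2))
    filter_upwards [Filter.eventually_ge_atTop k0] with k hk
    have h2 : 2 < τ k x := by
      rw [div_lt_iff₀ hx1] at hk0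
      have : (k0 : ℝ) ≤ k := by exact_mod_cast hk
      simp only [hτ]
      nlinarith
    rw [cutoffFun_of_ge h2.le, deriv_cutoffFun_of_gt h2]
    ring

/-- The operator `ballOp` is symmetric in `L_{2,μ}`. -/
theorem integral_mul_ballOp_comm [NeZero d] (μ : ℝ≥0) {f g : EucSp d → ℝ} (hf : ContDiff ℝ 2 f)
    (hg : ContDiff ℝ 2 g) :
    ∫ x, g x * ballOp μ f x ∂(ballMeasure d μ) = ∫ x, ballOp μ g x * f x ∂(ballMeasure d μ) := by
  have hf1 : ContDiff ℝ 1 f := hf.of_le (by norm_num)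
  have hg1 : ContDiff ℝ 1 g := hg.of_le (by norm_num)
  have h1 := integral_ballGamma_add μ hf hg1
  have h2 := integral_ballGamma_add μ hg hf1
  rw [integral_add (g := fun x => g x * ballOp μ f x)
    (integrable_ballMeasure μ (continuous_ballGamma hg1 hf1))
    (integrable_ballMeasure μ (hg.continuous.mul (continuous_ballOp μ hf)))] at h1
  rw [integral_add (g := fun x => f x * ballOp μ g x)
    (integrable_ballMeasure μ (continuous_ballGamma hf1 hg1))
    (integrable_ballMeasure μ (hf.continuous.mul (continuous_ballOp μ hg))), ballGamma_comm] at h2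
  simp only [mul_comm (ballOp μ g _)]
  linarith

end BallOperator

/-! ### The operator on polynomials. -/

section PolynomialEigenfunctions

variable {d : ℕ}

/-- A polynomial as a function on `ℝ^d`. -/
def polyFun (P : MvPolynomial (Fin d) ℝ) (x : EucSp d) : ℝ := MvPolynomial.eval (fun i => x i) P

theorem contDiff_polyFun (P : MvPolynomial (Fin d) ℝ) {n : WithTop ℕ∞} :
    ContDiff ℝ n (polyFun P) := by
  induction P using MvPolynomial.induction_on with
  | C a => 
    have : polyFun (d := d) (MvPolynomial.C a) = fun _ => a := by ext; simp [polyFun]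
    rw [this]; exact contDiff_const
  | add p q hp hq =>
    have : polyFun (p + q) = fun x => polyFun p x + polyFun q x := by ext; simp [polyFun]
    rw [this]; exact hp.add hq
  | mul_X p i hp =>
    have : polyFun (p * MvPolynomial.X i) = fun x => polyFun p x * x i := by ext; simp [polyFun]
    rw [this]; exact hp.mul (by fun_prop)

theorem partialD_polyFun (P : MvPolynomial (Fin d) ℝ) (i : Fin d) :
    partialD i (polyFun P) = polyFun (MvPolynomial.pderiv i P) := by
  ext x
  have hd : ∀ P : MvPolynomial (Fin d) ℝ, DifferentiableAt ℝ (polyFun P) x := fun P =>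
    (contDiff_polyFun (n := 1) P).differentiable one_ne_zero x
  induction P using MvPolynomial.induction_on with
  | C a => 
    have : polyFun (d := d) (MvPolynomial.C a) = fun _ => a := by ext; simp [polyFun]
    rw [this]; simp [partialD, polyFun]
  | add p q hp hq =>
    have : polyFun (p + q) = polyFun p + polyFun q := by ext; simp [polyFun]
    rw [partialD, this, fderiv_add (hd p) (hd q), add_apply]
    rw [partialD] at hp hq
    rw [hp, hq, map_add]
    simp [polyFun]
  | mul_X p j hp =>
    have : polyFun (p * MvPolynomial.X j) = polyFun p * fun x : EucSp d => x j := by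
      ext; simp [polyFun]
    have e1 : HasFDerivAt (fun x : EucSp d => x j) (EuclideanSpace.proj j : EucSp d →L[ℝ] ℝ) x :=
      (EuclideanSpace.proj j : EucSp d →L[ℝ] ℝ).hasFDerivAt
    rw [partialD] at hp
    rw [partialD, this, ((hd p).hasFDerivAt.mul e1).fderiv]
    simp only [add_apply, smul_apply, hp]
    rw [MvPolynomial.pderiv_mul, MvPolynomial.pderiv_X]
    rcases eq_or_ne j i with rfl | hji
    · simp [polyFun]
      ring
    · simp [polyFun, hji]
      ring

/-- The Euler operator on polynomials. -/
def polyEuler (P : MvPolynomial (Fin d) ℝ) : MvPolynomial (Fin d) ℝ :=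
  ∑ i, MvPolynomial.X i * MvPolynomial.pderiv i P

theorem eulerD_polyFun (P : MvPolynomial (Fin d) ℝ) :
    eulerD (polyFun P) = polyFun (polyEuler P) := by
  ext x
  rw [eulerD_eq_sum]
  simp only [partialD_polyFun]
  simp [polyFun, polyEuler]

/-- The Laplacian on polynomials. -/
def polyLaplace (P : MvPolynomial (Fin d) ℝ) : MvPolynomial (Fin d) ℝ :=
  ∑ i, MvPolynomial.pderiv i (MvPolynomial.pderiv i P)

/-- The operator `ballOp` on polynomials. -/
def polyBallOp (μ : ℝ≥0) (P : MvPolynomial (Fin d) ℝ) : MvPolynomial (Fin d) ℝ :=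
  polyLaplace P - polyEuler (polyEuler P) - (2 * (μ : ℝ) + d - 1) • polyEuler P

theorem ballOp_polyFun (μ : ℝ≥0) (P : MvPolynomial (Fin d) ℝ) :
    ballOp μ (polyFun P) = polyFun (polyBallOp μ P) := by
  ext x
  simp only [ballOp, partialD_polyFun, eulerD_polyFun]
  simp [polyFun, polyBallOp, polyLaplace]

theorem polyEuler_monomial (v : Fin d →₀ ℕ) (c : ℝ) :
    polyEuler (MvPolynomial.monomial v c) = (v.degree : ℝ) • MvPolynomial.monomial v c := by
  have := (MvPolynomial.isHomogeneous_monomial (d := v) c rfl).sum_X_mul_pderiv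
  rw [polyEuler, this, Nat.cast_smul_eq_nsmul]

theorem polyEuler_smul (c : ℝ) (P : MvPolynomial (Fin d) ℝ) :
    polyEuler (c • P) = c • polyEuler P := by
  simp [polyEuler, Finset.smul_sum, (MvPolynomial.pderiv _).map_smul]

theorem polyEuler_sum {ι : Type*} (s : Finset ι) (f : ι → MvPolynomial (Fin d) ℝ) :
    polyEuler (∑ j ∈ s, f j) = ∑ j ∈ s, polyEuler (f j) := by
  simp only [polyEuler, map_sum, Finset.mul_sum]
  exact Finset.sum_comm

theorem polyBallOp_sum (μ : ℝ≥0) {ι : Type*} (s : Finset ι) (f : ι → MvPolynomial (Fin d) ℝ) :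
    polyBallOp μ (∑ j ∈ s, f j) = ∑ j ∈ s, polyBallOp μ (f j) := by
  simp only [polyBallOp, polyEuler_sum, polyLaplace, map_sum, Finset.smul_sum,
    Finset.sum_sub_distrib]
  congr 2
  exact Finset.sum_comm

theorem polyBallOp_monomial [NeZero d] (μ : ℝ≥0) (v : Fin d →₀ ℕ) (c : ℝ) :
    polyBallOp μ (MvPolynomial.monomial v c) = polyLaplace (MvPolynomial.monomial v c)
      - eigenval d μ v.degree • MvPolynomial.monomial v c := by
  rw [polyBallOp, polyEuler_monomial, polyEuler_smul, polyEuler_monomial, sub_sub, smul_smul,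
    smul_smul, ← add_smul, eigenval]
  congr 2
  ring

theorem totalDegree_polyLaplace_monomial (v : Fin d →₀ ℕ) (c : ℝ) :
    (polyLaplace (MvPolynomial.monomial v c)).totalDegree ≤ v.degree - 1 := by
  refine MvPolynomial.totalDegree_finsetSum_le fun i _ => ?_
  have := ((MvPolynomial.isHomogeneous_monomial (d := v) c rfl).pderiv (i := i)).pderiv (i := i)
  exact this.totalDegree_le.trans (by omega)

/-- On a monomial of degree m the Euler part acts as -λ_m and the Laplacian lowers the degree, so
adding λ_n cancels the top-degree part. -/
theorem polyBallOp_add_mem [NeZero d] (μ : ℝ≥0) {n : ℕ} {P : MvPolynomial (Fin d) ℝ}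
    (hP : P ∈ MvPolynomial.restrictTotalDegree (Fin d) ℝ n) :
    polyBallOp μ P + eigenval d μ n • P ∈ MvPolynomial.restrictTotalDegree (Fin d) ℝ (n - 1) := by
  rw [MvPolynomial.mem_restrictTotalDegree] at hP
  rw [P.as_sum, polyBallOp_sum, Finset.smul_sum, ← Finset.sum_add_distrib]
  refine Submodule.sum_mem _ fun v hv => ?_
  have hvn : v.degree ≤ n := (MvPolynomial.le_totalDegree hv).trans hP
  rw [polyBallOp_monomial, sub_add, ← sub_smul]
  refine Submodule.sub_mem _ ?_ ?_
  · rw [MvPolynomial.mem_restrictTotalDegree]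
    exact (totalDegree_polyLaplace_monomial _ _).trans (by omega)
  · rcases hvn.eq_or_lt with h | h
    · rw [h, sub_self, zero_smul]
      exact Submodule.zero_mem _
    · refine Submodule.smul_mem _ _ ?_
      rw [MvPolynomial.mem_restrictTotalDegree]
      exact (MvPolynomial.totalDegree_monomial_le _ _).trans (by
        change v.degree ≤ n - 1
        omega)

theorem polyBallOp_mem [NeZero d] (μ : ℝ≥0) {n : ℕ} {P : MvPolynomial (Fin d) ℝ}
    (hP : P ∈ MvPolynomial.restrictTotalDegree (Fin d) ℝ n) :
    polyBallOp μ P ∈ MvPolynomial.restrictTotalDegree (Fin d) ℝ n := by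
  have h1 := polyBallOp_add_mem μ hP
  have h2 : polyBallOp μ P + eigenval d μ n • P ∈ MvPolynomial.restrictTotalDegree (Fin d) ℝ n := by
    rw [MvPolynomial.mem_restrictTotalDegree] at h1 ⊢
    omega
  simpa using Submodule.sub_mem _ h2 (Submodule.smul_mem _ (eigenval d μ n) hP)

end PolynomialEigenfunctions

/-! ### Spectral action of the operator: V_n^d is an eigenspace, and the projections intertwine. -/

section ContinuousFunctions

variable (d : ℕ) [NeZero d] (μ : ℝ≥0)

theorem memLp_ballMeasure (F : C(EucSp d, ℝ)) : MemLp F 2 (ballMeasure d μ) := by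
  obtain ⟨C, hC⟩ := (isCompact_closedBall (0 : EucSp d) 1).exists_bound_of_continuousOn
    F.continuous.continuousOn
  exact MemLp.of_bound F.continuous.aestronglyMeasurable C ((ballMeasure_ae_mem d μ).mono hC)

/-- A continuous function as an element of `L_{2,μ}`. -/
def contToL2 : C(EucSp d, ℝ) →ₗ[ℝ] BallL2 d μ where
  toFun F := (memLp_ballMeasure d μ F).toLp _
  map_add' F G := by
    rw [← MemLp.toLp_add]
    rfl
  map_smul' c F := by
    rw [RingHom.id_apply, ← MemLp.toLp_const_smul]
    rfl

theorem inner_contToL2 (F G : C(EucSp d, ℝ)) :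
    ⟪contToL2 d μ F, contToL2 d μ G⟫ = ∫ x, F x * G x ∂(ballMeasure d μ) := by
  rw [L2.inner_def]
  refine integral_congr_ae ?_
  filter_upwards [(memLp_ballMeasure d μ F).coeFn_toLp, (memLp_ballMeasure d μ G).coeFn_toLp]
    with x h1 h2
  change ⟪(memLp_ballMeasure d μ F).toLp F x, (memLp_ballMeasure d μ G).toLp G x⟫ = _
  rw [h1, h2]
  simp [mul_comm]

variable {d}

/-- A polynomial as a continuous function. -/
def polyCont (P : MvPolynomial (Fin d) ℝ) : C(EucSp d, ℝ) :=
  ⟨polyFun P, (contDiff_polyFun (n := 0) P).continuous⟩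

theorem contToL2_polyCont (P : MvPolynomial (Fin d) ℝ) :
    contToL2 d μ (polyCont P) = polyToL2 d μ P := rfl

theorem inner_ballOp_contToL2 {f g : C(EucSp d, ℝ)} {f' g' : C(EucSp d, ℝ)} (hf : ContDiff ℝ 2 f)
    (hg : ContDiff ℝ 2 g) (hf' : ⇑f' = ballOp μ f) (hg' : ⇑g' = ballOp μ g) :
    ⟪contToL2 d μ f', contToL2 d μ g⟫ = ⟪contToL2 d μ f, contToL2 d μ g'⟫ := by
  rw [inner_contToL2, inner_contToL2, hf', hg']
  exact (integral_mul_ballOp_comm μ hg hf).symm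

theorem mem_orthoPolySpace_iff {n : ℕ} {p : BallL2 d μ} :
    p ∈ orthoPolySpace d μ n ↔ p ∈ polySpace d μ n ∧
      ∀ k < n, ∀ q ∈ polySpace d μ k, ⟪q, p⟫ = 0 := by
  simp only [orthoPolySpace, Submodule.mem_inf, Submodule.mem_iInf, Submodule.mem_orthogonal]
  exact and_congr_right fun _ => ⟨fun h k hk => h ⟨k, hk⟩, fun h k => h k k.2⟩

/-- Elements of `V_n^d` are eigenfunctions of `ballOp`. -/
theorem polyBallOp_of_mem {n : ℕ} (hn : 1 ≤ n) {P : MvPolynomial (Fin d) ℝ}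
    (hPn : P ∈ MvPolynomial.restrictTotalDegree (Fin d) ℝ n)
    (hP : polyToL2 d μ P ∈ orthoPolySpace d μ n) :
    polyToL2 d μ (polyBallOp μ P) = -(eigenval d μ n) • polyToL2 d μ P := by
  rw [mem_orthoPolySpace_iff] at hP
  set Q := polyBallOp μ P + eigenval d μ n • P with hQ
  have hQn : Q ∈ MvPolynomial.restrictTotalDegree (Fin d) ℝ (n - 1) := polyBallOp_add_mem μ hPn
  have hlt : n - 1 < n := by omega
  have h0 : ∀ R ∈ MvPolynomial.restrictTotalDegree (Fin d) ℝ (n - 1),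
      ⟪polyToL2 d μ R, polyToL2 d μ P⟫ = 0 := fun R hR =>
    hP.2 (n - 1) hlt _ (Submodule.mem_map_of_mem hR)
  -- Q has degree below n, and so has its image under the operator. Moving the operator onto Q by
  -- symmetry gives an inner product with P that vanishes; hence Q is orthogonal to itself.
  have h1 : ⟪polyToL2 d μ Q, polyToL2 d μ (polyBallOp μ P)⟫ = 0 := by
    rw [← contToL2_polyCont, ← contToL2_polyCont, ← inner_ballOp_contToL2 μ
      (f := polyCont Q) (g := polyCont P) (f' := polyCont (polyBallOp μ Q))
      (contDiff_polyFun _) (contDiff_polyFun _) (ballOp_polyFun μ Q).symm (ballOp_polyFun μ P).symm]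
    exact h0 _ (polyBallOp_mem μ hQn)
  have h2 : ⟪polyToL2 d μ Q, polyToL2 d μ Q⟫ = 0 := by
    conv_lhs => rw [hQ, map_add, map_smul, inner_add_right, inner_smul_right, ← map_smul, ← map_add, ← hQ]
    rw [h1, h0 Q hQn, mul_zero, add_zero]
  have h3 := inner_self_eq_zero.1 h2
  rw [hQ, map_add, map_smul] at h3
  rw [neg_smul]
  exact eq_neg_of_add_eq_zero_left h3

/-- Tested against V_n^d, this is the symmetry of the operator combined with the eigenvalue equation
there. It turns bounds on derivatives of f into weighted bounds on its projections. -/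
theorem projV_ballOp {n : ℕ} (hn : 1 ≤ n) {f f' : C(EucSp d, ℝ)} (hf : ContDiff ℝ 2 f)
    (hf' : ⇑f' = ballOp μ f) :
    projV d μ n (contToL2 d μ f') = -(eigenval d μ n) • projV d μ n (contToL2 d μ f) := by
  unfold projV
  refine Submodule.eq_starProjection_of_mem_of_inner_eq_zero (𝕜 := ℝ)
    (Submodule.smul_mem _ _ ((orthoPolySpace d μ n).starProjection_apply_mem _)) fun w hw => ?_
  obtain ⟨P, hP, rfl⟩ := ((mem_orthoPolySpace_iff μ).1 hw).1
  have h1 : ⟪contToL2 d μ f', polyToL2 d μ P⟫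
      = -(eigenval d μ n) * ⟪contToL2 d μ f, polyToL2 d μ P⟫ := by
    rw [← contToL2_polyCont, inner_ballOp_contToL2 μ (f := f) (g := polyCont P) (f' := f')
      (g' := polyCont (polyBallOp μ P)) hf (contDiff_polyFun _) hf' (ballOp_polyFun μ P).symm,
      contToL2_polyCont, contToL2_polyCont, polyBallOp_of_mem μ hn hP hw, inner_smul_right]
  have h2 := Submodule.starProjection_inner_eq_zero (𝕜 := ℝ) (K := orthoPolySpace d μ n)
    (contToL2 d μ f) _ hw
  rw [inner_sub_left] at h2
  rw [inner_sub_left, inner_smul_left, h1]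
  simp only [conj_trivial]
  linear_combination -(eigenval d μ n) * h2

end ContinuousFunctions

/-! ### Orthogonal expansions and completeness of the polynomials. -/

section OrthogonalExpansion

variable (d : ℕ) [NeZero d] (μ : ℝ≥0)

theorem projV_mem (n : ℕ) (f : BallL2 d μ) : projV d μ n f ∈ orthoPolySpace d μ n :=
  (orthoPolySpace d μ n).starProjection_apply_mem f

theorem projV_of_mem {n : ℕ} {f : BallL2 d μ} (hf : f ∈ orthoPolySpace d μ n) :
    projV d μ n f = f :=
  Submodule.starProjection_eq_self_iff.2 hf

theorem inner_projV_of_mem {n : ℕ} (f : BallL2 d μ) {w : BallL2 d μ}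
    (hw : w ∈ orthoPolySpace d μ n) : ⟪projV d μ n f, w⟫ = ⟪f, w⟫ := by
  have h := Submodule.starProjection_inner_eq_zero (𝕜 := ℝ) (K := orthoPolySpace d μ n) f w hw
  rw [inner_sub_left] at h
  unfold projV
  linarith

theorem inner_eq_zero_of_mem_orthoPolySpace {m n : ℕ} (hmn : m ≠ n) {u v : BallL2 d μ}
    (hu : u ∈ orthoPolySpace d μ m) (hv : v ∈ orthoPolySpace d μ n) : ⟪u, v⟫ = 0 := by
  rw [mem_orthoPolySpace_iff] at hu hv
  rcases lt_or_gt_of_ne hmn with h | h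
  · exact hv.2 m h u hu.1
  · rw [real_inner_comm]
    exact hu.2 n h v hv.1

theorem orthogonalFamily_orthoPolySpace :
    OrthogonalFamily ℝ (fun n => orthoPolySpace d μ n)
      (fun n => (orthoPolySpace d μ n).subtypeₗᵢ) :=
  fun _ _ hmn u v => inner_eq_zero_of_mem_orthoPolySpace d μ hmn u.2 v.2

theorem sum_norm_sq_projV_le (s : Finset ℕ) (f : BallL2 d μ) :
    ∑ n ∈ s, ‖projV d μ n f‖ ^ 2 ≤ ‖f‖ ^ 2 := by
  set g := ∑ n ∈ s, projV d μ n f with hg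
  have h1 : ‖g‖ ^ 2 = ∑ n ∈ s, ‖projV d μ n f‖ ^ 2 :=
    (orthogonalFamily_orthoPolySpace d μ).norm_sum (fun n => ⟨projV d μ n f, projV_mem d μ n f⟩) s
  have h2 : ⟪f, g⟫ = ∑ n ∈ s, ‖projV d μ n f‖ ^ 2 := by
    rw [hg, inner_sum]
    refine Finset.sum_congr rfl fun n _ => ?_
    rw [← inner_projV_of_mem d μ f (projV_mem d μ n f), real_inner_self_eq_norm_sq]
  have h3 := real_inner_le_norm f g
  rw [h2, ← h1] at h3
  rw [← h1]
  have h4 : ‖g‖ ≤ ‖f‖ := by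
    by_contra! hcon
    nlinarith [norm_nonneg f, norm_nonneg g]
  gcongr

theorem summable_norm_sq_projV (f : BallL2 d μ) : Summable fun n => ‖projV d μ n f‖ ^ 2 :=
  summable_of_sum_le (fun _ => sq_nonneg _) fun s => sum_norm_sq_projV_le d μ s f

theorem tsum_norm_sq_projV_succ_le (f : BallL2 d μ) :
    ∑' n : ℕ, ‖projV d μ (n + 1) f‖ ^ 2 ≤ ‖f‖ ^ 2 := by
  have h := summable_norm_sq_projV d μ f
  have h1 : ∑' n : ℕ, ‖projV d μ n f‖ ^ 2 ≤ ‖f‖ ^ 2 :=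
    h.tsum_le_of_sum_le fun s => sum_norm_sq_projV_le d μ s f
  rw [h.tsum_eq_zero_add] at h1
  nlinarith [sq_nonneg ‖projV d μ 0 f‖]

theorem polySpace_mono {m n : ℕ} (hmn : m ≤ n) : polySpace d μ m ≤ polySpace d μ n := by
  refine Submodule.map_mono fun P hP => ?_
  rw [MvPolynomial.mem_restrictTotalDegree] at hP ⊢
  exact hP.trans hmn

/-- Induction on the degree, one Gram–Schmidt step at a time: q minus its projection onto degree at
most n lies in V_{n+1}^d. -/
theorem inner_eq_zero_of_mem_polySpace {f : BallL2 d μ} (hf : ∀ n, projV d μ n f = 0) (n : ℕ) :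
    ∀ q ∈ polySpace d μ n, ⟪f, q⟫ = 0 := by
  have h0 : ∀ n, ∀ w ∈ orthoPolySpace d μ n, ⟪f, w⟫ = 0 := fun n w hw => by
    rw [← inner_projV_of_mem d μ f hw, hf, inner_zero_left]
  induction n with
  | zero =>
    refine fun q hq => h0 0 q ((mem_orthoPolySpace_iff μ).2 ⟨hq, fun k hk => ?_⟩)
    exact absurd hk (Nat.not_lt_zero k)
  | succ n ih =>
    intro q hq
    set p := (polySpace d μ n).starProjection q with hp
    have hp' : p ∈ polySpace d μ n := (polySpace d μ n).starProjection_apply_mem q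
    have h1 : q - p ∈ orthoPolySpace d μ (n + 1) := by
      refine (mem_orthoPolySpace_iff μ).2
        ⟨Submodule.sub_mem _ hq (polySpace_mono d μ n.le_succ hp'), fun k hk w hw => ?_⟩
      rw [real_inner_comm]
      exact Submodule.starProjection_inner_eq_zero (𝕜 := ℝ) (K := polySpace d μ n) q w
        (polySpace_mono d μ (Nat.lt_succ_iff.1 hk) hw)
    have h2 := h0 _ _ h1
    rw [inner_sub_right, ih p hp', sub_zero] at h2
    exact h2

theorem summable_projV (f : BallL2 d μ) : Summable fun n => projV d μ n f :=
  ((orthogonalFamily_orthoPolySpace d μ).summable_iff_norm_sq_summable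
    (fun n => ⟨projV d μ n f, projV_mem d μ n f⟩)).2 (summable_norm_sq_projV d μ f)

theorem projV_of_hasSum {w : ℕ → BallL2 d μ} (hw : ∀ n, w n ∈ orthoPolySpace d μ n)
    {u : BallL2 d μ} (hu : HasSum w u) (n : ℕ) : projV d μ n u = w n := by
  have h1 := hu.mapL (projV d μ n)
  refine h1.unique ?_
  convert hasSum_single n ?_ using 1
  · exact (projV_of_mem d μ (hw n)).symm
  · intro m hm
    have : ∀ v ∈ orthoPolySpace d μ n, ⟪projV d μ n (w m), v⟫ = 0 := fun v hv => by
      rw [inner_projV_of_mem d μ _ hv]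
      exact inner_eq_zero_of_mem_orthoPolySpace d μ hm (hw m) hv
    exact inner_self_eq_zero.1 (this _ (projV_mem d μ n _))

/-- By Bessel the series converges to some u. The difference f - u has no projections, so it is
orthogonal to all polynomials, and it also lies in their closure; hence it is zero. -/
theorem hasSum_projV_of_mem_closure {f : BallL2 d μ}
    (hf : f ∈ (⨆ n, polySpace d μ n).topologicalClosure) : HasSum (fun n => projV d μ n f) f := by
  obtain ⟨u, hu⟩ := summable_projV d μ f
  have h1 : ∀ n, projV d μ n (f - u) = 0 := fun n => by
    rw [map_sub, projV_of_hasSum d μ (projV_mem d μ · f) hu n, sub_self]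
  have h2 : f - u ∈ (⨆ n, polySpace d μ n)ᗮ := by
    rw [← Submodule.iInf_orthogonal, Submodule.mem_iInf]
    intro n
    rw [Submodule.mem_orthogonal']
    exact inner_eq_zero_of_mem_polySpace d μ h1 n
  have h3 : u ∈ (⨆ n, polySpace d μ n).topologicalClosure := by
    refine (Submodule.isClosed_topologicalClosure _).mem_of_tendsto hu (.of_forall fun s => ?_)
    refine Submodule.sum_mem _ fun n _ => Submodule.le_topologicalClosure _ ?_
    exact Submodule.mem_iSup_of_mem n ((mem_orthoPolySpace_iff μ).1 (projV_mem d μ n f)).1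
  rw [← Submodule.orthogonal_closure] at h2
  have h4 := (Submodule.mem_orthogonal _ _).1 h2 (f - u) (Submodule.sub_mem _ hf h3)
  rw [sub_eq_zero.1 (inner_self_eq_zero.1 h4)]
  rwa [← sub_eq_zero.1 (inner_self_eq_zero.1 h4)] at hu ⊢

variable {d}

theorem norm_contToL2_le {F : C(EucSp d, ℝ)} {ε : ℝ} (hε : 0 ≤ ε)
    (hF : ∀ x ∈ Metric.closedBall (0 : EucSp d) 1, |F x| ≤ ε) :
    ‖contToL2 d μ F‖ ≤ Real.sqrt ((ballMeasure d μ).real Set.univ) * ε := by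
  have h : ‖contToL2 d μ F‖ ^ 2 ≤ (ballMeasure d μ).real Set.univ * ε ^ 2 := by
    rw [← real_inner_self_eq_norm_sq, inner_contToL2]
    have : ∫ x, ε ^ 2 ∂(ballMeasure d μ) = (ballMeasure d μ).real Set.univ * ε ^ 2 := by simp
    rw [← this]
    refine integral_mono_ae (integrable_ballMeasure μ (F.continuous.mul F.continuous))
      (integrable_const _) ?_
    filter_upwards [ballMeasure_ae_mem d μ] with x hx
    rw [← sq, ← sq_abs]
    have := hF x hx
    gcongr
  refine abs_le_of_sq_le_sq' ?_ (by positivity) |>.2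
  rw [mul_pow, Real.sq_sqrt measureReal_nonneg]
  exact h

omit [NeZero d] in
-- Stone–Weierstrass on the compact ball; the coordinates separate points.
theorem exists_polynomial_near (F : C(EucSp d, ℝ)) {ε : ℝ} (hε : 0 < ε) :
    ∃ P : MvPolynomial (Fin d) ℝ, ∀ x ∈ Metric.closedBall (0 : EucSp d) 1,
      |F x - polyFun P x| ≤ ε := by
  let X := Metric.closedBall (0 : EucSp d) 1
  have : CompactSpace X := isCompact_iff_compactSpace.1 (isCompact_closedBall _ _)
  let coord : Fin d → C(X, ℝ) := fun i => ⟨fun x => (x : EucSp d) i, by fun_prop⟩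
  let A : Subalgebra ℝ C(X, ℝ) := (MvPolynomial.aeval (R := ℝ) coord).range
  have hval : ∀ (P : MvPolynomial (Fin d) ℝ) (x : X),
      MvPolynomial.aeval (R := ℝ) coord P x = polyFun P x := by
    intro P x
    induction P using MvPolynomial.induction_on with
    | C a => simp [polyFun]
    | add p q hp hq =>
      rw [map_add, ContinuousMap.add_apply, hp, hq]
      simp [polyFun]
    | mul_X p i hp =>
      rw [map_mul, ContinuousMap.mul_apply, hp]
      simp [polyFun, coord]
  have hsep : A.SeparatesPoints := by
    intro x y hxy
    have : ∃ i, (x : EucSp d) i ≠ (y : EucSp d) i := by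
      by_contra! hcon
      exact hxy (Subtype.ext (PiLp.ext hcon))
    obtain ⟨i, hi⟩ := this
    refine ⟨coord i, ⟨coord i, ⟨MvPolynomial.X i, by simp⟩, rfl⟩, hi⟩
  obtain ⟨⟨g, P, rfl⟩, hP⟩ := ContinuousMap.exists_mem_subalgebra_near_continuous_of_separatesPoints
    A hsep (fun x : X => F x) (F.continuous.comp continuous_subtype_val) ε hε
  refine ⟨P, fun x hx => ?_⟩
  have h1 := hP ⟨x, hx⟩
  have h2 := hval P ⟨x, hx⟩
  rw [abs_sub_comm, ← Real.norm_eq_abs]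
  exact (h2 ▸ h1).le

theorem contToL2_mem_closure (F : C(EucSp d, ℝ)) :
    contToL2 d μ F ∈ (⨆ n, polySpace d μ n).topologicalClosure := by
  rw [← SetLike.mem_coe, Submodule.topologicalClosure_coe, Metric.mem_closure_iff]
  intro ε hε
  set c := Real.sqrt ((ballMeasure d μ).real Set.univ) with hc
  have hc0 : 0 ≤ c := Real.sqrt_nonneg _
  obtain ⟨P, hP⟩ := exists_polynomial_near F (ε := ε / (c + 1)) (by positivity)
  refine ⟨polyToL2 d μ P, Submodule.mem_iSup_of_mem P.totalDegree
    (Submodule.mem_map_of_mem ((MvPolynomial.mem_restrictTotalDegree _ _ _).2 le_rfl)), ?_⟩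
  rw [dist_eq_norm, ← contToL2_polyCont, ← map_sub]
  refine (norm_contToL2_le μ (ε := ε / (c + 1)) (by positivity) hP).trans_lt ?_
  rw [← hc, mul_div_assoc', div_lt_iff₀ (by positivity)]
  nlinarith

/-- V_0^d consists of constants, so mean zero removes the term n = 0 and the expansion may start at
n = 1, as `sobolevSubmodule` requires. -/
theorem projV_zero_eq_zero {F : C(EucSp d, ℝ)} (hF : ∫ x, F x ∂(ballMeasure d μ) = 0) :
    projV d μ 0 (contToL2 d μ F) = 0 := by
  have : ∀ w ∈ orthoPolySpace d μ 0, ⟪contToL2 d μ F, w⟫ = 0 := by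
    intro w hw
    obtain ⟨P, hP, rfl⟩ := ((mem_orthoPolySpace_iff μ).1 hw).1
    have hP0 : P.totalDegree = 0 :=
      Nat.le_zero.1 ((MvPolynomial.mem_restrictTotalDegree _ _ _).1 hP)
    rw [MvPolynomial.totalDegree_eq_zero_iff_eq_C] at hP0
    rw [← contToL2_polyCont, inner_contToL2]
    have h1 : ∀ x, polyCont P x = P.coeff 0 := fun x => by
      change polyFun P x = _
      rw [hP0]
      simp [polyFun]
    simp only [h1]
    rw [integral_mul_const, hF, zero_mul]
  have h2 := this _ (projV_mem d μ 0 (contToL2 d μ F))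
  rw [← inner_projV_of_mem d μ _ (projV_mem d μ 0 _)] at h2
  exact inner_self_eq_zero.1 h2

theorem hasSum_projV_succ {F : C(EucSp d, ℝ)} (hF : ∫ x, F x ∂(ballMeasure d μ) = 0) :
    HasSum (fun n : ℕ => projV d μ (n + 1) (contToL2 d μ F)) (contToL2 d μ F) := by
  have h := hasSum_projV_of_mem_closure d μ (contToL2_mem_closure μ F)
  rw [← hasSum_nat_add_iff' 1] at h
  simpa [projV_zero_eq_zero μ hF] using h

end OrthogonalExpansion

/-! ### Splitting a finite-dimensional Gaussian component off a Gaussian measure. -/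

section GaussianDecomposition

variable {H : Type*} [NormedAddCommGroup H] [InnerProductSpace ℝ H] [CompleteSpace H]
  [SecondCountableTopology H] [MeasurableSpace H] [BorelSpace H]

theorem charFun_of_centered {ν : Measure H} [IsGaussian ν]
    (hmean : ∀ f : H, ∫ z, ⟪f, z⟫ ∂ν = 0) (t : H) :
    charFun ν t = Complex.exp (-((⟪covarianceOperator ν t, t⟫ / 2 : ℝ) : ℂ)) := by
  rw [IsGaussian.charFun_eq]
  have h1 : (∫ x, ((⟪t, x⟫ : ℝ) : ℂ) ∂ν) = 0 := by
    rw [integral_complex_ofReal, hmean, Complex.ofReal_zero]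
  have h2 : Var[fun x => ⟪t, x⟫; ν] = ⟪covarianceOperator ν t, t⟫ := by
    rw [variance_of_integral_eq_zero (by fun_prop) (hmean t),
      covarianceOperator_inner IsGaussian.memLp_two_id]
    simp [sq]
  rw [h1, h2]
  congr 1
  push_cast
  ring

/-- A centered Gaussian measure `ν` splits off the law of `σ Ψ ξ`, with `ξ` standard Gaussian, as
soon as the covariance of `σ Ψ ξ` is dominated by that of `ν` on the range of `Ψ`. -/
theorem exists_conv_stdGaussian {ν : Measure H} [IsGaussian ν]
    (hmean : ∀ f : H, ∫ z, ⟪f, z⟫ ∂ν = 0) {N : ℕ} (Ψ h : EuclideanSpace ℝ (Fin N) →L[ℝ] H)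
    (hcov : ∀ a, covarianceOperator ν (h a) = Ψ a) {σ : ℝ}
    (hle : ∀ a, σ ^ 2 * ⟪Ψ a, h a⟫ ≤ ‖a‖ ^ 2) :
    ∃ ν' : Measure H, IsProbabilityMeasure ν' ∧
      ν = Measure.conv ν' ((stdGaussian (EuclideanSpace ℝ (Fin N))).map (σ • Ψ)) := by
  set E := EuclideanSpace ℝ (Fin N)
  set C := covarianceOperator ν
  have hCs : ∀ x y, ⟪C x, y⟫ = ⟪C y, x⟫ := fun x y => by
    rw [covarianceOperator_inner IsGaussian.memLp_two_id,
      covarianceOperator_inner IsGaussian.memLp_two_id]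
    simp only [mul_comm]
  have hC0 : ∀ x, 0 ≤ ⟪C x, x⟫ := fun x => by
    rw [covarianceOperator_inner IsGaussian.memLp_two_id]
    exact integral_nonneg fun z => mul_self_nonneg _
  -- With C the covariance operator and C h = Ψ, the operator T = Ψ* h is the compression of C to
  -- the range of h. It is symmetric, and its eigenbasis decouples the coordinates.
  set T : E →ₗ[ℝ] E := ((ContinuousLinearMap.adjoint Ψ).comp h).toLinearMap with hT
  have hTi : ∀ a b, ⟪T a, b⟫ = ⟪Ψ b, h a⟫ := fun a b => by
    rw [hT]
    simp only [ContinuousLinearMap.coe_coe, ContinuousLinearMap.comp_apply]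
    rw [ContinuousLinearMap.adjoint_inner_left, real_inner_comm]
  have hTs : T.IsSymmetric := fun a b => by
    rw [hTi, ← real_inner_comm a (T b), hTi, ← hcov, ← hcov, hCs]
  have hN : Module.finrank ℝ E = N := by simp [E]
  set e := hTs.eigenvectorBasis hN
  set m := hTs.eigenvalues hN
  have hme : ∀ i j, ⟪Ψ (e i), h (e j)⟫ = if i = j then m i else 0 := fun i j => by
    rw [← hTi, hTs.apply_eigenvectorBasis hN j]
    rw [RCLike.ofReal_real_eq_id, id, real_inner_smul_left, real_inner_comm,
      orthonormal_iff_ite.1 e.orthonormal i j]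
    split_ifs with hij
    · rw [hij, mul_one]
    · rw [mul_zero]
  have hm : ∀ i, ⟪Ψ (e i), h (e i)⟫ = m i := fun i => by rw [hme, if_pos rfl]
  have hm0 : ∀ i, 0 ≤ m i := fun i => by
    rw [← hm, ← hcov]
    exact hC0 _
  have hm1 : ∀ i, 0 ≤ 1 - σ ^ 2 * m i := fun i => by
    have := hle (e i)
    rw [hm, e.orthonormal.1 i] at this
    linarith
  -- The smaller root of m ε² - 2ε + σ² = 0, written with the square root in the denominator so that
  -- m = 0 needs no separate case. The domination hypothesis makes the discriminant nonnegative.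
  set ε : Fin N → ℝ := fun i => σ ^ 2 / (1 + Real.sqrt (1 - σ ^ 2 * m i)) with hε
  have hεm : ∀ i, m i * ε i ^ 2 - 2 * ε i + σ ^ 2 = 0 := fun i => by
    have h1 := Real.sq_sqrt (hm1 i)
    have h2 := Real.sqrt_nonneg (1 - σ ^ 2 * m i)
    simp only [hε]
    set s := Real.sqrt (1 - σ ^ 2 * m i)
    have h3 : 1 + s ≠ 0 := by positivity
    field_simp
    linear_combination σ ^ 2 * h1
  -- The remaining measure is the image of ν under this finite-rank perturbation of the identity, so
  -- no Gaussian measure has to be constructed from a covariance. The adjoint of R sends t to t - k.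
  set R : H →L[ℝ] H := ContinuousLinearMap.id ℝ H -
    ∑ i, ε i • (innerSL ℝ (h (e i))).smulRight (Ψ (e i)) with hR
  refine ⟨ν.map R, Measure.isProbabilityMeasure_map (by fun_prop), ?_⟩
  have : IsProbabilityMeasure (ν.map R) := Measure.isProbabilityMeasure_map (by fun_prop)
  have : IsProbabilityMeasure ((stdGaussian E).map (σ • Ψ)) :=
    Measure.isProbabilityMeasure_map (by fun_prop)
  refine Measure.ext_of_charFun (funext fun t => ?_)
  rw [charFun_conv]
  set p : Fin N → ℝ := fun i => ⟪Ψ (e i), t⟫ with hp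
  set k : H := ∑ i, (ε i * p i) • h (e i) with hk
  have hRt : ∀ x, ⟪R x, t⟫ = ⟪x, t - k⟫ := fun x => by
    simp only [hR, hk, sub_apply, inner_sub_left,
      inner_sub_right, ContinuousLinearMap.coe_id', id, sum_apply, sum_inner, inner_sum,
      smul_apply, real_inner_smul_left, real_inner_smul_right,
      ContinuousLinearMap.smulRight_apply, innerSL_apply_apply, hp]
    congr 1
    refine Finset.sum_congr rfl fun i _ => ?_
    rw [real_inner_comm x (h (e i))]
    ring
  have e1 : charFun (ν.map R) t = charFun ν (t - k) := by
    rw [charFun_apply, charFun_apply, integral_map (by fun_prop) (by fun_prop)]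
    simp only [hRt]
  have e2 : charFun ((stdGaussian E).map (σ • Ψ)) t
      = charFun (stdGaussian E) (σ • ContinuousLinearMap.adjoint Ψ t) := by
    rw [charFun_apply, charFun_apply, integral_map (by fun_prop) (by fun_prop)]
    congr 1
    ext x
    rw [smul_apply, real_inner_smul_left, real_inner_smul_right,
      ContinuousLinearMap.adjoint_inner_right]
  have e3 : ‖ContinuousLinearMap.adjoint Ψ t‖ ^ 2 = ∑ i, p i ^ 2 := by
    rw [← e.sum_sq_norm_inner_right]
    refine Finset.sum_congr rfl fun i _ => ?_
    rw [ContinuousLinearMap.adjoint_inner_right, Real.norm_eq_abs, sq_abs]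
  have hCk : C k = ∑ i, (ε i * p i) • Ψ (e i) := by
    simp only [hk, map_sum, map_smul, C, hcov]
  have e4 : ⟪C k, t⟫ = ∑ i, ε i * p i ^ 2 := by
    rw [hCk, sum_inner]
    refine Finset.sum_congr rfl fun i _ => ?_
    rw [real_inner_smul_left]
    simp only [hp]
    ring
  have e5 : ⟪C k, k⟫ = ∑ i, m i * ε i ^ 2 * p i ^ 2 := by
    rw [hCk, sum_inner]
    refine Finset.sum_congr rfl fun i _ => ?_
    rw [real_inner_smul_left, hk, inner_sum]
    simp only [real_inner_smul_right, hme, mul_ite, mul_zero, Finset.sum_ite_eq, Finset.mem_univ,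
      if_true]
    ring
  -- The variances in direction t add up: for each i the coefficient of p_i² is the quadratic
  -- equation satisfied by ε_i. Equality of the characteristic functions follows.
  have e6 : ⟪C (t - k), t - k⟫ + σ ^ 2 * ∑ i, p i ^ 2 = ⟪C t, t⟫ := by
    rw [map_sub, inner_sub_left, inner_sub_right, inner_sub_right, hCs t k, e4, e5]
    have : ∑ i, (m i * ε i ^ 2 - 2 * ε i + σ ^ 2) * p i ^ 2 = 0 :=
      Finset.sum_eq_zero fun i _ => by rw [hεm, zero_mul]
    simp only [add_mul, sub_mul, Finset.sum_add_distrib, Finset.sum_sub_distrib, mul_assoc,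
      ← Finset.mul_sum] at this ⊢
    linarith
  rw [e1, e2, charFun_of_centered hmean, charFun_of_centered hmean, charFun_stdGaussian,
    ← Complex.exp_add, ← e6, norm_smul, ← Complex.ofReal_pow, mul_pow, e3, Real.norm_eq_abs,
    sq_abs]
  congr 1
  push_cast
  ring

end GaussianDecomposition

/-! ### The Sobolev space as a Hilbert sum, and its covariance operator. -/

section SobolevIsometry

variable (d : ℕ) [NeZero d] (μ : ℝ≥0) (r : ℝ)

namespace SobolevSpace

variable {d μ r}

theorem summable (f : SobolevSpace d μ r) :
    Summable fun n : ℕ => eigenval d μ (n + 1) ^ r * ‖projV d μ (n + 1) (toL2 d μ r f)‖ ^ 2 :=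
  f.2.2.2

theorem hasSum (f : SobolevSpace d μ r) :
    HasSum (fun n : ℕ => projV d μ (n + 1) (toL2 d μ r f)) (toL2 d μ r f) :=
  f.2.1

theorem ext_toL2 {f g : SobolevSpace d μ r} (h : toL2 d μ r f = toL2 d μ r g) : f = g :=
  Subtype.ext h

/-- The element of `W^r_{2,μ}` given by a class in `L_{2,μ}`. -/
def mk {f : BallL2 d μ} (hf : f ∈ sobolevSubmodule d μ r) : SobolevSpace d μ r := ⟨f, hf⟩

theorem toL2_mk {f : BallL2 d μ} (hf : f ∈ sobolevSubmodule d μ r) : toL2 d μ r (mk hf) = f := rfl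

end SobolevSpace

/-- The Hilbert sum of the spaces `V_n^d`, `n ≥ 1`. -/
abbrev OrthoSum : Type := lp (fun n : ℕ => orthoPolySpace d μ (n + 1)) 2

theorem one_le_eigenval (n : ℕ) : 1 ≤ eigenval d μ (n + 1) := by
  have h2 : (1 : ℝ) ≤ d := by exact_mod_cast NeZero.one_le
  have h3 := μ.coe_nonneg
  have h4 : (0 : ℝ) ≤ n := n.cast_nonneg
  unfold eigenval
  push_cast
  nlinarith

theorem rpow_half_sq (t : ℝ) (n : ℕ) :
    (eigenval d μ (n + 1) ^ (t / 2)) ^ 2 = eigenval d μ (n + 1) ^ t := by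
  rw [← Real.rpow_natCast, ← Real.rpow_mul (zero_le_one.trans (one_le_eigenval d μ n))]
  congr 1
  push_cast
  ring

/-- The coefficient sequence `(λ_n^{t/2} Proj_n f)_{n ≥ 1}`. -/
def orthoCoeff (t : ℝ) (f : BallL2 d μ)
    (hf : Summable fun n : ℕ => eigenval d μ (n + 1) ^ t * ‖projV d μ (n + 1) f‖ ^ 2) :
    OrthoSum d μ :=
  ⟨fun n => eigenval d μ (n + 1) ^ (t / 2) • ⟨projV d μ (n + 1) f, projV_mem d μ (n + 1) f⟩, by
    refine memℓp_gen ?_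
    refine hf.congr fun n => ?_
    rw [← rpow_half_sq, ENNReal.toReal_ofNat, Real.rpow_two, norm_smul, mul_pow, Real.norm_eq_abs,
      sq_abs]
    rfl⟩

/-- The `n`-th coordinate in the Hilbert sum, as an element of `L_{2,μ}`. -/
def orthoCoord (w : OrthoSum d μ) (n : ℕ) : BallL2 d μ :=
  ((w : (n : ℕ) → orthoPolySpace d μ (n + 1)) n : BallL2 d μ)

theorem orthoCoord_mem (w : OrthoSum d μ) (n : ℕ) :
    orthoCoord d μ w n ∈ orthoPolySpace d μ (n + 1) :=
  ((w : (n : ℕ) → orthoPolySpace d μ (n + 1)) n).2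

variable {d μ} in
theorem orthoSum_ext {v w : OrthoSum d μ} (h : ∀ n, orthoCoord d μ v n = orthoCoord d μ w n) :
    v = w :=
  lp.ext (funext fun n => Subtype.ext (h n))

theorem orthoCoord_add (v w : OrthoSum d μ) (n : ℕ) :
    orthoCoord d μ (v + w) n = orthoCoord d μ v n + orthoCoord d μ w n := rfl

theorem orthoCoord_smul (c : ℝ) (w : OrthoSum d μ) (n : ℕ) :
    orthoCoord d μ (c • w) n = c • orthoCoord d μ w n := rfl

theorem inner_orthoSum (v w : OrthoSum d μ) :
    ⟪v, w⟫ = ∑' n, ⟪orthoCoord d μ v n, orthoCoord d μ w n⟫ := lp.inner_eq_tsum v w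

theorem summable_norm_sq_orthoCoord (w : OrthoSum d μ) :
    Summable fun n => ‖orthoCoord d μ w n‖ ^ 2 := by
  have := (lp.memℓp w).summable (by norm_num)
  simpa [orthoCoord] using this

theorem orthoCoord_orthoCoeff (t : ℝ) (f : BallL2 d μ)
    (hf : Summable fun n : ℕ => eigenval d μ (n + 1) ^ t * ‖projV d μ (n + 1) f‖ ^ 2) (n : ℕ) :
    orthoCoord d μ (orthoCoeff d μ t f hf) n
      = eigenval d μ (n + 1) ^ (t / 2) • projV d μ (n + 1) f := rfl

/-- The isometry of `W^r_{2,μ}` into the Hilbert sum of the `V_n^d`. -/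
def sobolevToSum : SobolevSpace d μ r →ₗᵢ[ℝ] OrthoSum d μ where
  toFun f := orthoCoeff d μ r (SobolevSpace.toL2 d μ r f) f.summable
  map_add' f g := orthoSum_ext fun n => by
    simp only [orthoCoord_add, orthoCoord_orthoCoeff, map_add, smul_add]
  map_smul' c f := orthoSum_ext fun n => by
    simp only [orthoCoord_smul, orthoCoord_orthoCoeff, map_smul, RingHom.id_apply]
    rw [smul_comm]
  norm_map' f := by
    have h1 : ‖orthoCoeff d μ r (SobolevSpace.toL2 d μ r f) f.summable‖ ^ 2 = ‖f‖ ^ 2 := by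
      rw [← real_inner_self_eq_norm_sq, ← real_inner_self_eq_norm_sq, inner_orthoSum,
        SobolevSpace.inner_def]
      refine tsum_congr fun n => ?_
      rw [orthoCoord_orthoCoeff, real_inner_smul_left, real_inner_smul_right,
        ← rpow_half_sq d μ r n]
      ring
    exact (pow_left_inj₀ (norm_nonneg _) (norm_nonneg _) two_ne_zero).1 h1

theorem orthoCoord_sobolevToSum (f : SobolevSpace d μ r) (n : ℕ) :
    orthoCoord d μ (sobolevToSum d μ r f) n
      = eigenval d μ (n + 1) ^ (r / 2) • projV d μ (n + 1) (SobolevSpace.toL2 d μ r f) := rfl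

theorem one_mem_orthoPolySpace :
    polyToL2 d μ 1 ∈ orthoPolySpace d μ 0 := by
  refine (mem_orthoPolySpace_iff μ).2 ⟨Submodule.mem_map_of_mem ?_, fun k hk => absurd hk (Nat.not_lt_zero k)⟩
  rw [MvPolynomial.mem_restrictTotalDegree]
  simp

theorem integral_eq_inner_one (f : BallL2 d μ) :
    ∫ x, f x ∂(ballMeasure d μ) = ⟪polyToL2 d μ 1, f⟫ := by
  rw [L2.inner_def]
  refine integral_congr_ae ?_
  filter_upwards [(memLp_polynomial d μ 1).coeFn_toLp] with x hx
  change _ = ⟪(memLp_polynomial d μ 1).toLp _ x, _⟫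
  rw [hx]
  simp

variable {r}

/-- Since r > 0 and all eigenvalues are at least 1, the weights λ_n^{-r/2} are at most 1, so the
candidate preimage converges in `L_{2,μ}`. -/
theorem sobolevToSum_surjective (hr : 0 < r) : Function.Surjective (sobolevToSum d μ r) := by
  intro w
  have hw := summable_norm_sq_orthoCoord d μ w
  set v : (n : ℕ) → orthoPolySpace d μ (n + 1) := fun n =>
    eigenval d μ (n + 1) ^ (-(r / 2)) • ⟨orthoCoord d μ w n, orthoCoord_mem d μ w n⟩
  have horth : OrthogonalFamily ℝ (fun n => orthoPolySpace d μ (n + 1))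
      (fun n => (orthoPolySpace d μ (n + 1)).subtypeₗᵢ) :=
    (orthogonalFamily_orthoPolySpace d μ).comp (Nat.succ_injective)
  have hv2 : ∀ n, ‖v n‖ ^ 2 ≤ ‖orthoCoord d μ w n‖ ^ 2 := fun n => by
    have h1 : |eigenval d μ (n + 1) ^ (-(r / 2))| ≤ 1 := by
      rw [abs_of_nonneg (Real.rpow_nonneg (zero_le_one.trans (one_le_eigenval d μ n)) _)]
      exact Real.rpow_le_one_of_one_le_of_nonpos (one_le_eigenval d μ n) (by linarith)
    have h2 : ‖v n‖ ≤ ‖orthoCoord d μ w n‖ := by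
      simp only [v]
      rw [norm_smul, Real.norm_eq_abs]
      exact mul_le_of_le_one_left (norm_nonneg _) h1
    gcongr
  have hvs : Summable fun n => ‖v n‖ ^ 2 := hw.of_nonneg_of_le (fun n => sq_nonneg _) hv2
  obtain ⟨f, hf⟩ := (horth.summable_iff_norm_sq_summable v).2 hvs
  have hf' : HasSum (fun n => (v n : BallL2 d μ)) f := hf
  have hproj : ∀ n, projV d μ (n + 1) f = v n := by
    intro n
    refine (hf'.mapL (projV d μ (n + 1))).unique ?_
    convert hasSum_single n ?_ using 1
    · exact (projV_of_mem d μ (v n).2).symm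
    · intro m hm
      have h1 : ∀ u ∈ orthoPolySpace d μ (n + 1), ⟪projV d μ (n + 1) (v m), u⟫ = 0 := fun u hu => by
        rw [inner_projV_of_mem d μ _ hu]
        exact inner_eq_zero_of_mem_orthoPolySpace d μ (by omega) (v m).2 hu
      exact inner_self_eq_zero.1 (h1 _ (projV_mem d μ _ _))
  have hlam : ∀ n, eigenval d μ (n + 1) ^ (r / 2) * eigenval d μ (n + 1) ^ (-(r / 2)) = 1 := fun n => by
    rw [← Real.rpow_add (zero_lt_one.trans_le (one_le_eigenval d μ n)), add_neg_cancel, Real.rpow_zero]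
  have hW : f ∈ sobolevSubmodule d μ r := by
    refine ⟨by simpa only [hproj] using hf', ?_, ?_⟩
    · rw [integral_eq_inner_one]
      have h1 := hf'.mapL (innerSL ℝ (polyToL2 d μ 1))
      refine h1.unique ?_
      convert hasSum_zero with n
      exact inner_eq_zero_of_mem_orthoPolySpace d μ (Nat.succ_ne_zero n).symm
        (one_mem_orthoPolySpace d μ) (v n).2
    · refine hw.congr fun n => ?_
      rw [hproj]
      simp only [v]
      rw [Submodule.coe_smul, norm_smul, mul_pow, Real.norm_eq_abs, sq_abs, ← mul_assoc,
        ← rpow_half_sq, ← mul_pow, hlam, one_pow, one_mul]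
  refine ⟨SobolevSpace.mk hW, orthoSum_ext fun n => ?_⟩
  rw [orthoCoord_sobolevToSum, SobolevSpace.toL2_mk, hproj]
  simp only [v]
  rw [Submodule.coe_smul, smul_smul, hlam, one_smul]

/-- `W^r_{2,μ}` as a Hilbert sum. -/
def sobolevEquivSum (hr : 0 < r) : SobolevSpace d μ r ≃ₗᵢ[ℝ] OrthoSum d μ :=
  LinearIsometryEquiv.ofSurjective (sobolevToSum d μ r) (sobolevToSum_surjective d μ hr)

/-- Completeness, together with second countability below, is what the Gaussian splitting asks of
the space. -/
theorem completeSpace_sobolevSpace (hr : 0 < r) : CompleteSpace (SobolevSpace d μ r) := by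
  have h := (sobolevEquivSum d μ hr).isometry.isUniformInducing
  exact (completeSpace_iff_isComplete_range h).2 (by
    rw [(sobolevEquivSum d μ hr).surjective.range_eq]
    exact completeSpace_iff_isComplete_univ.1 inferInstance)

theorem separableSpace_orthoSum : TopologicalSpace.SeparableSpace (OrthoSum d μ) := by
  have h1 : TopologicalSpace.IsSeparable
      (⋃ n, Set.range (lp.single (E := fun n : ℕ => orthoPolySpace d μ (n + 1)) 2 n)) := by
    refine TopologicalSpace.IsSeparable.iUnion fun n => TopologicalSpace.isSeparable_range ?_
    exact (lp.isometry_single n).continuous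
  refine TopologicalSpace.isSeparable_univ_iff.1 ((h1.span (R := ℝ)).closure.mono fun w _ => ?_)
  refine mem_closure_of_tendsto (lp.hasSum_single (by norm_num) w) (.of_forall fun s => ?_)
  exact Submodule.sum_mem _ fun n _ => Submodule.subset_span (Set.mem_iUnion.2 ⟨n, _, rfl⟩)

theorem secondCountable_sobolevSpace (hr : 0 < r) :
    SecondCountableTopology (SobolevSpace d μ r) := by
  have := separableSpace_orthoSum d μ
  have : SecondCountableTopology (OrthoSum d μ) := UniformSpace.secondCountable_of_separable _
  exact (sobolevEquivSum d μ hr).toHomeomorph.secondCountableTopology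

variable {s : ℝ} {ν : Measure (SobolevSpace d μ r)}

/-- The component of `f ∈ W^r_{2,μ}` in `V_{n+1}^d`. -/
def sobolevComponent (hr : 0 < r) (f : SobolevSpace d μ r) (n : ℕ) : SobolevSpace d μ r :=
  (sobolevEquivSum d μ hr).symm
    (lp.single (E := fun n : ℕ => orthoPolySpace d μ (n + 1)) 2 n
      ((sobolevEquivSum d μ hr f : (n : ℕ) → orthoPolySpace d μ (n + 1)) n))

theorem hasSum_sobolevComponent (hr : 0 < r) (f : SobolevSpace d μ r) :
    HasSum (sobolevComponent d μ hr f) f := by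
  have h := (lp.hasSum_single (by norm_num) (sobolevEquivSum d μ hr f)).mapL
    ((sobolevEquivSum d μ hr).symm.toContinuousLinearEquiv : OrthoSum d μ →L[ℝ] SobolevSpace d μ r)
  have e : ((sobolevEquivSum d μ hr).symm.toContinuousLinearEquiv :
      OrthoSum d μ →L[ℝ] SobolevSpace d μ r) (sobolevEquivSum d μ hr f) = f :=
    (sobolevEquivSum d μ hr).symm_apply_apply f
  rw [e] at h
  exact h

theorem toL2_sobolevComponent (hr : 0 < r) (f : SobolevSpace d μ r) (n : ℕ) :
    SobolevSpace.toL2 d μ r (sobolevComponent d μ hr f n)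
      = projV d μ (n + 1) (SobolevSpace.toL2 d μ r f) := by
  set g := sobolevComponent d μ hr f n with hg
  have h1 : sobolevToSum d μ r g = lp.single (E := fun n : ℕ => orthoPolySpace d μ (n + 1)) 2 n
      ((sobolevEquivSum d μ hr f : (n : ℕ) → orthoPolySpace d μ (n + 1)) n) :=
    (sobolevEquivSum d μ hr).apply_symm_apply _
  have hne : ∀ m, eigenval d μ (m + 1) ^ (r / 2) ≠ 0 := fun m =>
    (eigenval_rpow_pos d μ (r / 2) m).ne'
  have h2 : ∀ m, projV d μ (m + 1) (SobolevSpace.toL2 d μ r g)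
      = if m = n then projV d μ (n + 1) (SobolevSpace.toL2 d μ r f) else 0 := by
    intro m
    have h3 := congrArg (fun w => orthoCoord d μ w m) h1
    simp only [orthoCoord_sobolevToSum] at h3
    refine smul_right_injective _ (hne m) ?_
    simp only
    rw [h3]
    unfold orthoCoord
    split_ifs with hmn
    · subst hmn
      rw [lp.single_apply_self]
      rfl
    · rw [lp.single_apply_ne _ _ _ hmn]
      simp
  have h4 : HasSum (fun m : ℕ => projV d μ (m + 1) (SobolevSpace.toL2 d μ r g))
    (SobolevSpace.toL2 d μ r g) := g.hasSum
  simp only [h2] at h4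
  refine h4.unique ?_
  convert hasSum_ite_eq n _ using 1

/-- The covariance acts as λ_n^{-s/2} on each component, and it is continuous, so it may be applied
term by term to the expansion of h. This provides the preimages under the covariance that the
splitting needs. -/
theorem covarianceOperator_eq (hr : 0 < r) (hν : IsSobolevGaussian d μ r s ν)
    [CompleteSpace (SobolevSpace d μ r)] [SecondCountableTopology (SobolevSpace d μ r)]
    {f h : SobolevSpace d μ r}
    (hh : ∀ n, projV d μ (n + 1) (SobolevSpace.toL2 d μ r h)
      = eigenval d μ (n + 1) ^ (s / 2) • projV d μ (n + 1) (SobolevSpace.toL2 d μ r f)) :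
    covarianceOperator ν h = f := by
  have := hν.isGaussian
  have h1 := (hasSum_sobolevComponent d μ hr h).mapL (covarianceOperator ν)
  refine h1.unique ?_
  convert hasSum_sobolevComponent d μ hr f using 1
  ext n
  refine ext_inner_right ℝ fun g => ?_
  rw [covarianceOperator_inner IsGaussian.memLp_two_id]
  have hmem : SobolevSpace.toL2 d μ r (sobolevComponent d μ hr h n) ∈ orthoPolySpace d μ (n + 1) := by
    rw [toL2_sobolevComponent]
    exact projV_mem d μ _ _
  rw [hν.correlation (n + 1) (by omega) _ hmem g]
  congr 1
  apply SobolevSpace.ext_toL2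
  rw [map_smul, toL2_sobolevComponent, toL2_sobolevComponent, hh, smul_smul,
    ← Real.rpow_add (zero_lt_one.trans_le (one_le_eigenval d μ n)), neg_div, neg_add_cancel,
    Real.rpow_zero, one_smul]

end SobolevIsometry

/-! ### Weighted sums of projections of smooth functions, and the resulting Gaussian component. -/

section Bernstein

variable {d : ℕ} [NeZero d] (μ : ℝ≥0)

omit [NeZero d] in
theorem contDiff_ballOp_iterate {f : EucSp d → ℝ} (hf : ContDiff ℝ (⊤ : ℕ∞) f) (k : ℕ) :
    ContDiff ℝ (⊤ : ℕ∞) ((ballOp μ)^[k] f) := by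
  induction k with
  | zero => exact hf
  | succ k ih =>
    rw [Function.iterate_succ_apply']
    exact contDiff_ballOp μ ih

/-- The `k`-th iterate of `ballOp` on a smooth function, as a continuous function. -/
def ballOpIter (k : ℕ) (f : C(EucSp d, ℝ)) (hf : ContDiff ℝ (⊤ : ℕ∞) f) : C(EucSp d, ℝ) :=
  ⟨(ballOp μ)^[k] f, (contDiff_ballOp_iterate μ hf k).continuous⟩

theorem projV_ballOpIter {n : ℕ} (hn : 1 ≤ n) (k : ℕ) (f : C(EucSp d, ℝ))
    (hf : ContDiff ℝ (⊤ : ℕ∞) f) :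
    projV d μ n (contToL2 d μ (ballOpIter μ k f hf))
      = (-(eigenval d μ n)) ^ k • projV d μ n (contToL2 d μ f) := by
  induction k with
  | zero =>
    rw [pow_zero, one_smul]
    rfl
  | succ k ih =>
    rw [projV_ballOp μ hn (f := ballOpIter μ k f hf)
      ((contDiff_ballOp_iterate μ hf k).of_le (WithTop.coe_le_coe.2 (le_top (a := (2 : ℕ∞)))))
      (Function.iterate_succ_apply' (ballOp μ) k f), ih, smul_smul, pow_succ']

/-- Compare x with L: below L the constant term suffices, above it the power 2k dominates the power
ρ. -/
theorem rpow_le_rpow_mul_one_add {x L ρ : ℝ} {k : ℕ} (hx : 0 ≤ x) (hL : 0 < L) (hρ : 0 ≤ ρ)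
    (hρk : ρ ≤ 2 * k) : x ^ ρ ≤ L ^ ρ * (1 + L⁻¹ ^ (2 * k) * x ^ (2 * k)) := by
  have h1 : x ^ ρ = L ^ ρ * (L⁻¹ * x) ^ ρ := by
    rw [← Real.mul_rpow hL.le (by positivity), mul_inv_cancel_left₀ hL.ne']
  rw [h1, ← mul_pow]
  refine mul_le_mul_of_nonneg_left ?_ (by positivity)
  set y := L⁻¹ * x
  have hy : 0 ≤ y := by positivity
  rcases le_total y 1 with h | h
  · have := Real.rpow_le_one hy h hρ
    have : 0 ≤ y ^ (2 * k) := by positivity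
    linarith
  · have h2 : y ^ ρ ≤ y ^ (2 * k) := by
      rw [← Real.rpow_natCast]
      exact Real.rpow_le_rpow_of_exponent_le h (by push_cast; exact hρk)
    linarith

/-- The real order ρ is interpolated between 0 and the integer order 2k, where λ_n^{2k} ‖Proj_n f‖²
is the squared norm of a projection of the k-th iterate; Bessel bounds both sums. The scale L is
left free, to be matched with the width of the bumps. -/
theorem summable_rpow_mul_projV (f : C(EucSp d, ℝ)) (hf : ContDiff ℝ (⊤ : ℕ∞) f) {ρ : ℝ} {k : ℕ}
    (hρ : 0 ≤ ρ) (hρk : ρ ≤ 2 * k) {L : ℝ} (hL : 0 < L) :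
    Summable (fun n : ℕ => eigenval d μ (n + 1) ^ ρ * ‖projV d μ (n + 1) (contToL2 d μ f)‖ ^ 2) ∧
    ∑' n : ℕ, eigenval d μ (n + 1) ^ ρ * ‖projV d μ (n + 1) (contToL2 d μ f)‖ ^ 2 ≤
      L ^ ρ * (‖contToL2 d μ f‖ ^ 2
        + L⁻¹ ^ (2 * k) * ‖contToL2 d μ (ballOpIter μ k f hf)‖ ^ 2) := by
  have hs : ∀ g : BallL2 d μ, Summable fun n : ℕ => ‖projV d μ (n + 1) g‖ ^ 2 := fun g =>
    (summable_nat_add_iff 1).2 (summable_norm_sq_projV d μ g)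
  have h0 : ∀ n, 0 ≤ eigenval d μ (n + 1) := fun n => (eigenval_pos d μ (by omega)).le
  have hle : ∀ n : ℕ, eigenval d μ (n + 1) ^ ρ * ‖projV d μ (n + 1) (contToL2 d μ f)‖ ^ 2 ≤
      L ^ ρ * (‖projV d μ (n + 1) (contToL2 d μ f)‖ ^ 2
        + L⁻¹ ^ (2 * k) * ‖projV d μ (n + 1) (contToL2 d μ (ballOpIter μ k f hf))‖ ^ 2) := by
    intro n
    rw [projV_ballOpIter μ (by omega), norm_smul, mul_pow, norm_pow, norm_neg,
      Real.norm_of_nonneg (h0 n), ← pow_mul, mul_comm k 2]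
    refine (mul_le_mul_of_nonneg_right (rpow_le_rpow_mul_one_add (h0 n) hL hρ hρk)
      (sq_nonneg _)).trans_eq ?_
    ring
  have hsum := ((hs (contToL2 d μ f)).add
    ((hs (contToL2 d μ (ballOpIter μ k f hf))).mul_left (L⁻¹ ^ (2 * k)))).mul_left (L ^ ρ)
  have hsm := hsum.of_nonneg_of_le
    (fun n => mul_nonneg (Real.rpow_nonneg (h0 n) _) (sq_nonneg _)) hle
  refine ⟨hsm, (hsm.tsum_le_tsum hle hsum).trans ?_⟩
  rw [tsum_mul_left, (hs _).tsum_add ((hs _).mul_left _), tsum_mul_left]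
  gcongr
  · exact tsum_norm_sq_projV_succ_le d μ _
  · exact tsum_norm_sq_projV_succ_le d μ _

theorem contToL2_mem_sobolevSubmodule {r : ℝ} (hr : 0 < r) (f : C(EucSp d, ℝ))
    (hf : ContDiff ℝ (⊤ : ℕ∞) f) (hf0 : ∫ x, f x ∂(ballMeasure d μ) = 0) :
    contToL2 d μ f ∈ sobolevSubmodule d μ r := by
  refine ⟨hasSum_projV_succ μ hf0, ?_, ?_⟩
  · rw [← hf0]
    exact integral_congr_ae (memLp_ballMeasure d μ f).coeFn_toLp
  · obtain ⟨k, hk⟩ := exists_nat_ge r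
    exact (summable_rpow_mul_projV μ f hf hr.le (k := k) (by nlinarith) one_pos).1

/-- A smooth f has finite weighted sums of every nonnegative order, here r + s, so λ^{s/2} may be
applied to it within the Sobolev space. The result is the preimage of f under the covariance
operator. -/
theorem exists_sobolev_multiplier {r s : ℝ} (hr : 0 < r) (hs : 0 ≤ s) (f : C(EucSp d, ℝ))
    (hf : ContDiff ℝ (⊤ : ℕ∞) f) :
    ∃ h : SobolevSpace d μ r, ∀ n, projV d μ (n + 1) (SobolevSpace.toL2 d μ r h)
      = eigenval d μ (n + 1) ^ (s / 2) • projV d μ (n + 1) (contToL2 d μ f) := by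
  obtain ⟨k, hk⟩ := exists_nat_ge (r + s)
  have hsum := (summable_rpow_mul_projV μ f hf (ρ := r + s) (by positivity) (k := k)
    (by nlinarith) one_pos).1
  obtain ⟨h, hh⟩ := sobolevToSum_surjective d μ hr (orthoCoeff d μ (r + s) (contToL2 d μ f) hsum)
  refine ⟨h, fun n => ?_⟩
  have h1 := congrArg (fun w => orthoCoord d μ w n) hh
  simp only [orthoCoord_sobolevToSum, orthoCoord_orthoCoeff] at h1
  refine smul_right_injective _ (eigenval_rpow_pos d μ (r / 2) n).ne' ?_
  simp only
  rw [h1, smul_smul, ← Real.rpow_add (zero_lt_one.trans_le (one_le_eigenval d μ n))]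
  congr 2
  ring

/-- The inner product ⟨Ψa, h a⟩_r, with h a the preimage of Ψa under the covariance, is the weighted
sum of order r + s/2. The hypothesis is therefore exactly the domination needed to split σΨξ off ν.
-/
theorem exists_sobolev_shift {r s : ℝ} (hr : 0 < r) (hs : 0 ≤ s)
    {ν : Measure (SobolevSpace d μ r)} (hν : IsSobolevGaussian d μ r s ν) {N : ℕ}
    (F : Fin N → C(EucSp d, ℝ)) (hF : ∀ j, ContDiff ℝ (⊤ : ℕ∞) (F j))
    (hF0 : ∀ j, ∫ x, F j x ∂(ballMeasure d μ) = 0) {σ : ℝ}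
    (hle : ∀ a : Fin N → ℝ, σ ^ 2 * ∑' n : ℕ, eigenval d μ (n + 1) ^ (r + s / 2) *
      ‖projV d μ (n + 1) (contToL2 d μ (∑ j, a j • F j))‖ ^ 2 ≤ ∑ j, a j ^ 2) :
    ∃ Ψ : (Fin N → ℝ) →ₗ[ℝ] SobolevSpace d μ r,
      (∀ a, SobolevSpace.toL2 d μ r (Ψ a) = contToL2 d μ (∑ j, a j • F j)) ∧
      ∀ G, MeasurableSet G → ∃ g, gammaStd N {x | g + σ • Ψ x ∈ G} ≤ ν G := by
  have := completeSpace_sobolevSpace d μ hr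
  have := secondCountable_sobolevSpace d μ hr
  have := hν.isGaussian
  choose h hh using fun j => exists_sobolev_multiplier μ hr hs (F j) (hF j)
  set ψ : Fin N → SobolevSpace d μ r := fun j =>
    SobolevSpace.mk (contToL2_mem_sobolevSubmodule μ hr (F j) (hF j) (hF0 j))
  set E := EuclideanSpace ℝ (Fin N)
  set A : E →L[ℝ] SobolevSpace d μ r :=
    ∑ j, (EuclideanSpace.proj j : E →L[ℝ] ℝ).smulRight (ψ j) with hA
  set B : E →L[ℝ] SobolevSpace d μ r :=
    ∑ j, (EuclideanSpace.proj j : E →L[ℝ] ℝ).smulRight (h j) with hB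
  have hAa : ∀ a, A a = ∑ j, a j • ψ j := fun a => by
    simp only [hA, sum_apply]
    rfl
  have hBa : ∀ a, B a = ∑ j, a j • h j := fun a => by
    simp only [hB, sum_apply]
    rfl
  have hA2 : ∀ a, SobolevSpace.toL2 d μ r (A a) = contToL2 d μ (∑ j, a j • F j) := fun a => by
    rw [hAa, map_sum, map_sum]
    refine Finset.sum_congr rfl fun j _ => ?_
    rw [map_smul, map_smul]
    rfl
  have hB2 : ∀ a n, projV d μ (n + 1) (SobolevSpace.toL2 d μ r (B a))
      = eigenval d μ (n + 1) ^ (s / 2) • projV d μ (n + 1) (SobolevSpace.toL2 d μ r (A a)) := by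
    intro a n
    rw [hA2, hBa, map_sum, map_sum, map_sum, map_sum, Finset.smul_sum]
    refine Finset.sum_congr rfl fun j _ => ?_
    rw [map_smul, map_smul, map_smul, map_smul, hh, smul_comm]
  have hAB : ∀ a, ⟪A a, B a⟫ = ∑' n : ℕ, eigenval d μ (n + 1) ^ (r + s / 2) *
      ‖projV d μ (n + 1) (contToL2 d μ (∑ j, a j • F j))‖ ^ 2 := fun a => by
    rw [SobolevSpace.inner_def]
    refine tsum_congr fun n => ?_
    rw [hB2, hA2, real_inner_smul_right, real_inner_self_eq_norm_sq,
      Real.rpow_add (zero_lt_one.trans_le (one_le_eigenval d μ n)), mul_assoc]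
  obtain ⟨ν', hν', hconv⟩ := exists_conv_stdGaussian hν.mean_zero A B
    (fun a => covarianceOperator_eq d μ hr hν (hB2 a)) (σ := σ) (fun a => by
      rw [hAB, EuclideanSpace.real_norm_sq_eq]
      exact hle a)
  refine ⟨A.toLinearMap ∘ₗ (WithLp.linearEquiv 2 ℝ (Fin N → ℝ)).symm.toLinearMap,
    fun a => hA2 _, fun G hG => ?_⟩
  have hmeas : ∀ y, MeasurableSet ((fun z => y + z) ⁻¹' G) := fun y =>
    measurable_const_add y hG
  have hset : MeasurableSet {p : SobolevSpace d μ r × (Fin N → ℝ) |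
      p.1 + σ • A (WithLp.toLp 2 p.2) ∈ G} :=
    (by fun_prop : Measurable fun p : SobolevSpace d μ r × (Fin N → ℝ) =>
      p.1 + σ • A (WithLp.toLp 2 p.2)) hG
  have e1 : ν G = ∫⁻ y, gammaStd N {x | y + σ • A (WithLp.toLp 2 x) ∈ G} ∂ν' := by
    conv_lhs => rw [hconv]
    rw [Measure.conv, Measure.map_apply (by fun_prop) hG, Measure.prod_apply
      ((by fun_prop : Measurable fun p : SobolevSpace d μ r × SobolevSpace d μ r =>
        p.1 + p.2) hG)]
    refine lintegral_congr fun y => ?_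
    rw [Measure.map_apply (by fun_prop) (measurable_prodMk_left
      ((by fun_prop : Measurable fun p : SobolevSpace d μ r × SobolevSpace d μ r =>
        p.1 + p.2) hG)), ← map_pi_eq_stdGaussian,
      Measure.map_apply (by fun_prop) (by
        exact (σ • A).continuous.measurable (hmeas y))]
    rfl
  -- The ν'-average over g of the Gaussian measures of the slices is ν G, so some slice does not
  -- exceed it.
  obtain ⟨g, hg⟩ := exists_le_lintegral (μ := ν')
    (f := fun y => gammaStd N {x | y + σ • A (WithLp.toLp 2 x) ∈ G})
    (measurable_measure_prodMk_left hset).aemeasurable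
  refine ⟨g, ?_⟩
  rw [e1]
  exact hg

end Bernstein

/-! ### Linearity of the operator and its iterates on finite sums. -/

section Linearity

variable {d : ℕ}

theorem partialD_sum_smul {ι : Type*} (s : Finset ι) (w : ι → ℝ) (f : ι → EucSp d → ℝ)
    (hf : ∀ i, ContDiff ℝ 1 (f i)) (j : Fin d) :
    partialD j (fun x => ∑ i ∈ s, w i * f i x) = fun x => ∑ i ∈ s, w i * partialD j (f i) x := by
  ext x
  unfold partialD
  have hd : ∀ i, DifferentiableAt ℝ (f i) x := fun i =>
    ((hf i).differentiable (by norm_num)).differentiableAt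
  rw [fderiv_fun_sum fun i _ => (hd i).const_mul (w i), sum_apply]
  refine Finset.sum_congr rfl fun i _ => ?_
  rw [fderiv_const_mul (hd i), smul_apply, smul_eq_mul]

theorem eulerD_sum_smul {ι : Type*} (s : Finset ι) (w : ι → ℝ) (f : ι → EucSp d → ℝ)
    (hf : ∀ i, ContDiff ℝ 1 (f i)) :
    eulerD (fun x => ∑ i ∈ s, w i * f i x) = fun x => ∑ i ∈ s, w i * eulerD (f i) x := by
  ext x
  simp only [eulerD_eq_sum, partialD_sum_smul s w f hf, Finset.mul_sum]
  rw [Finset.sum_comm]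
  exact Finset.sum_congr rfl fun i _ => Finset.sum_congr rfl fun j _ => by ring

theorem ballOp_sum_smul (μ : ℝ≥0) {ι : Type*} (s : Finset ι) (w : ι → ℝ) (f : ι → EucSp d → ℝ)
    (hf : ∀ i, ContDiff ℝ 2 (f i)) :
    ballOp μ (fun x => ∑ i ∈ s, w i * f i x) = fun x => ∑ i ∈ s, w i * ballOp μ (f i) x := by
  have h1 : ∀ i, ContDiff ℝ 1 (f i) := fun i => (hf i).of_le (by norm_num)
  ext x
  unfold ballOp
  simp only [partialD_sum_smul s w f h1, eulerD_sum_smul s w f h1,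
    partialD_sum_smul s w _ fun i => contDiff_partialD (m := 1) (hf i) (by norm_num) _,
    eulerD_sum_smul s w _ fun i => contDiff_eulerD (m := 1) (hf i) (by norm_num),
    mul_sub, Finset.sum_sub_distrib, Finset.mul_sum]
  rw [Finset.sum_comm]
  congr 1
  exact Finset.sum_congr rfl fun i _ => by ring

theorem ballOp_iterate_sum_smul (μ : ℝ≥0) {ι : Type*} (s : Finset ι) (w : ι → ℝ)
    (f : ι → EucSp d → ℝ) (hf : ∀ i, ContDiff ℝ (⊤ : ℕ∞) (f i)) (k : ℕ) :
    (ballOp μ)^[k] (fun x => ∑ i ∈ s, w i * f i x)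
      = fun x => ∑ i ∈ s, w i * (ballOp μ)^[k] (f i) x := by
  induction k generalizing f with
  | zero => rfl
  | succ k ih =>
    simp only [Function.iterate_succ_apply]
    rw [ballOp_sum_smul μ s w f fun i => (hf i).of_le (WithTop.coe_le_coe.2 (le_top (a := (2 : ℕ∞)))),
      ih _ fun i => contDiff_ballOp μ (hf i)]

end Linearity

/-! ### Counting powers of the scale under differentiation of bumps. -/

/-- Families of functions obtained from bumps `φ (R • (x - c))` at scale `R⁻¹` by multiplication
by coordinates and at most `e` powers of `R`. -/
inductive BumpSymbol {d : ℕ} : ℕ → (ℝ → EucSp d → EucSp d → ℝ) → Prop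
  | comp_scale {φ : EucSp d → ℝ} (hφ : ContDiff ℝ (⊤ : ℕ∞) φ)
      (hs : tsupport φ ⊆ Metric.closedBall 0 1) :
      BumpSymbol 0 (fun R c x => φ (R • (x - c)))
  | coord_mul {e : ℕ} {F : ℝ → EucSp d → EucSp d → ℝ} (i : Fin d) (hF : BumpSymbol e F) :
      BumpSymbol e (fun R c x => x i * F R c x)
  | scale {e : ℕ} {F : ℝ → EucSp d → EucSp d → ℝ} (hF : BumpSymbol e F) :
      BumpSymbol (e + 1) (fun R c x => R * F R c x)
  | mono {e : ℕ} {F : ℝ → EucSp d → EucSp d → ℝ} (hF : BumpSymbol e F) : BumpSymbol (e + 1) F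
  | add {e : ℕ} {F G : ℝ → EucSp d → EucSp d → ℝ} (hF : BumpSymbol e F) (hG : BumpSymbol e G) :
      BumpSymbol e (fun R c x => F R c x + G R c x)
  | const_mul {e : ℕ} {F : ℝ → EucSp d → EucSp d → ℝ} (a : ℝ) (hF : BumpSymbol e F) :
      BumpSymbol e (fun R c x => a * F R c x)

namespace BumpSymbol

variable {d : ℕ} {e : ℕ} {F : ℝ → EucSp d → EucSp d → ℝ}

theorem contDiff (hF : BumpSymbol e F) (R : ℝ) (c : EucSp d) : ContDiff ℝ (⊤ : ℕ∞) (F R c) := by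
  induction hF with
  | comp_scale hφ hs =>
    exact hφ.comp (g := _) (f := fun x => R • (x - c)) (by fun_prop)
  | coord_mul i hF ih => exact (EuclideanSpace.proj i : EucSp d →L[ℝ] ℝ).contDiff.mul ih
  | scale hF ih => exact contDiff_const.mul ih
  | mono hF ih => exact ih
  | add hF hG ih1 ih2 => exact ih1.add ih2
  | const_mul a hF ih => exact contDiff_const.mul ih

theorem eq_zero_of_lt (hF : BumpSymbol e F) {R : ℝ} {c x : EucSp d} (hx : 1 < ‖R • (x - c)‖) :
    F R c x = 0 := by
  induction hF with
  | comp_scale hφ hs =>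
    refine image_eq_zero_of_notMem_tsupport fun h => ?_
    have := hs h
    rw [mem_closedBall_zero_iff] at this
    linarith
  | coord_mul i hF ih => simp only [ih, mul_zero]
  | scale hF ih => simp only [ih, mul_zero]
  | mono hF ih => exact ih
  | add hF hG ih1 ih2 => simp only [ih1, ih2, add_zero]
  | const_mul a hF ih => simp only [ih, mul_zero]

/-- The constant does not depend on the centre or the scale. Coordinate factors cost nothing on the
unit ball, and R ≥ 1 allows the exponent to be raised. -/
theorem exists_bound (hF : BumpSymbol e F) :
    ∃ C : ℝ, 0 ≤ C ∧ ∀ R : ℝ, 1 ≤ R → ∀ c x : EucSp d, ‖x‖ ≤ 1 → |F R c x| ≤ C * R ^ e := by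
  induction hF with
  | @comp_scale φ hφ hs =>
    have hc : HasCompactSupport φ :=
      (isCompact_closedBall (0 : EucSp d) 1).of_isClosed_subset (isClosed_tsupport φ) hs
    obtain ⟨C, hC⟩ := hφ.continuous.bounded_above_of_compact_support hc
    refine ⟨C, (norm_nonneg _).trans (hC 0), fun R _ c x _ => ?_⟩
    simpa using hC (R • (x - c))
  | coord_mul i hF ih =>
    obtain ⟨C, hC0, hC⟩ := ih
    refine ⟨C, hC0, fun R hR c x hx => ?_⟩
    rw [abs_mul]
    have h1 : |x i| ≤ 1 := (PiLp.norm_apply_le x i).trans hx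
    calc _ ≤ 1 * (C * R ^ _) := mul_le_mul h1 (hC R hR c x hx) (abs_nonneg _) zero_le_one
      _ = _ := one_mul _
  | scale hF ih =>
    obtain ⟨C, hC0, hC⟩ := ih
    refine ⟨C, hC0, fun R hR c x hx => ?_⟩
    have hR0 : 0 ≤ R := by linarith
    rw [abs_mul, abs_of_nonneg hR0, pow_succ]
    nlinarith [mul_le_mul_of_nonneg_left (hC R hR c x hx) hR0]
  | @mono e F hF ih =>
    obtain ⟨C, hC0, hC⟩ := ih
    refine ⟨C, hC0, fun R hR c x hx => (hC R hR c x hx).trans ?_⟩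
    exact mul_le_mul_of_nonneg_left (pow_le_pow_right₀ hR (Nat.le_succ e)) hC0
  | add hF hG ih1 ih2 =>
    obtain ⟨C, hC0, hC⟩ := ih1
    obtain ⟨D, hD0, hD⟩ := ih2
    refine ⟨C + D, by positivity, fun R hR c x hx => ?_⟩
    refine (abs_add_le _ _).trans ?_
    rw [add_mul]
    exact add_le_add (hC R hR c x hx) (hD R hR c x hx)
  | const_mul a hF ih =>
    obtain ⟨C, hC0, hC⟩ := ih
    refine ⟨|a| * C, by positivity, fun R hR c x hx => ?_⟩
    rw [abs_mul, mul_assoc]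
    exact mul_le_mul_of_nonneg_left (hC R hR c x hx) (abs_nonneg a)

theorem sum {ι : Type*} (s : Finset ι) (G : ι → ℝ → EucSp d → EucSp d → ℝ)
    (hG : ∀ i, BumpSymbol e (G i)) (hF : BumpSymbol e F) :
    BumpSymbol e (fun R c x => F R c x + ∑ i ∈ s, G i R c x) := by
  classical
  induction s using Finset.induction_on with
  | empty => simpa using hF
  | insert i s his ih =>
    convert (ih.add (hG i)) using 4 with R c x
    rw [Finset.sum_insert his]
    ring

/-- The chain rule costs one factor R. Differentiating a coordinate factor leaves a term without it,
which `mono` raises to the common exponent. -/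
theorem partial_deriv (hF : BumpSymbol e F) (i : Fin d) :
    BumpSymbol (e + 1) (fun R c x => partialD i (F R c) x) := by
  induction hF with
  | @comp_scale φ hφ hs =>
    have h : BumpSymbol 0 (fun (R : ℝ) (c x : EucSp d) => partialD i φ (R • (x - c))) :=
      comp_scale (contDiff_partialD hφ (le_of_eq rfl) i)
        ((tsupport_fderiv_apply_subset ℝ _).trans hs)
    convert h.scale using 4 with R c x
    have h1 : HasFDerivAt (fun x : EucSp d => R • (x - c)) (R • ContinuousLinearMap.id ℝ _) x :=
      ((hasFDerivAt_id x).sub_const c).const_smul R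
    have h2 : HasFDerivAt φ (fderiv ℝ φ (R • (x - c))) (R • (x - c)) :=
      (hφ.differentiable (by simp)).differentiableAt.hasFDerivAt
    refine (congrArg (fun L => L (EuclideanSpace.single i 1)) (h2.comp x h1).fderiv).trans ?_
    simp [partialD]
  | coord_mul j hF ih =>
    convert (ih.coord_mul j).add (hF.mono.const_mul ((EuclideanSpace.single i (1 : ℝ) : EucSp d) j))
      using 4 with R c x
    have h1 : HasFDerivAt (fun x : EucSp d => x j) (EuclideanSpace.proj j : EucSp d →L[ℝ] ℝ) x :=
      (EuclideanSpace.proj j : EucSp d →L[ℝ] ℝ).hasFDerivAt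
    have h2 := ((hF.contDiff R c).differentiable (by simp)).differentiableAt (x := x).hasFDerivAt
    refine (congrArg (fun L => L (EuclideanSpace.single i 1)) (h1.mul h2).fderiv).trans ?_
    simp [partialD, mul_comm]
  | scale hF ih =>
    convert ih.scale using 4 with R c x
    have h2 := ((hF.contDiff R c).differentiable (by simp)).differentiableAt (x := x)
    unfold partialD
    rw [fderiv_const_mul h2, smul_apply, smul_eq_mul]
  | mono hF ih => exact ih.mono
  | add hF hG ih1 ih2 =>
    convert ih1.add ih2 using 4 with R c x
    have h1 := ((hF.contDiff R c).differentiable (by simp)).differentiableAt (x := x)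
    have h2 := ((hG.contDiff R c).differentiable (by simp)).differentiableAt (x := x)
    unfold partialD
    rw [fderiv_fun_add h1 h2, add_apply]
  | const_mul a hF ih =>
    convert ih.const_mul a using 4 with R c x
    have h2 := ((hF.contDiff R c).differentiable (by simp)).differentiableAt (x := x)
    unfold partialD
    rw [fderiv_const_mul h2, smul_apply, smul_eq_mul]

theorem euler_deriv (hF : BumpSymbol e F) :
    BumpSymbol (e + 1) (fun R c x => eulerD (F R c) x) := by
  -- The base term `0 * F` plays the role of the zero symbol, for which there is no constructor.
  convert sum Finset.univ _ (fun i => (hF.partial_deriv i).coord_mul i) (hF.mono.const_mul 0)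
    using 4 with R c x
  rw [eulerD_eq_sum, zero_mul, zero_add]

theorem ball_op (μ : ℝ≥0) (hF : BumpSymbol e F) :
    BumpSymbol (e + 2) (fun R c x => ballOp μ (F R c) x) := by
  convert sum Finset.univ _ (fun i => (hF.partial_deriv i).partial_deriv i)
    ((hF.euler_deriv.euler_deriv.const_mul (-1)).add
      (hF.euler_deriv.mono.const_mul (-(2 * (μ : ℝ) + d - 1)))) using 4 with R c x
  unfold ballOp
  ring

theorem ball_op_iterate (μ : ℝ≥0) (hF : BumpSymbol e F) (k : ℕ) :
    BumpSymbol (e + 2 * k) (fun R c x => (ballOp μ)^[k] (F R c) x) := by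
  induction k with
  | zero => exact hF
  | succ k ih =>
    simp only [Function.iterate_succ_apply']
    exact ih.ball_op μ

end BumpSymbol

/-! ### Well-separated centres. -/

section Grid

theorem EuclideanSpace.norm_le_sum_abs {d : ℕ} (x : EucSp d) : ‖x‖ ≤ ∑ i, |x i| := by
  have hx : x = ∑ i, x i • (EuclideanSpace.single i (1 : ℝ) : EucSp d) := by
    have := (EuclideanSpace.basisFun (Fin d) ℝ).sum_repr x
    simpa using this.symm
  conv_lhs => rw [hx]
  refine (norm_sum_le _ _).trans (Finset.sum_le_sum fun i _ => ?_)
  rw [norm_smul]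
  simp

theorem exists_nat_pow_between (d : ℕ) [NeZero d] {n : ℕ} (hn : 2 ≤ n) :
    ∃ M : ℕ, 1 ≤ M ∧ n ≤ M ^ d ∧ M ^ d ≤ 2 ^ d * n := by
  have hex : ∃ M : ℕ, n ≤ M ^ d := ⟨n, Nat.le_self_pow (NeZero.ne d) n⟩
  classical
  set M := Nat.find hex
  have h1 : n ≤ M ^ d := Nat.find_spec hex
  have hM : 2 ≤ M := by
    by_contra! h
    have := Nat.pow_le_pow_left (show M ≤ 1 by omega) d
    rw [one_pow] at this
    omega
  have h2 : (M - 1) ^ d < n := not_le.1 (Nat.find_min hex (by omega))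
  refine ⟨M, by omega, h1, ?_⟩
  calc M ^ d ≤ (2 * (M - 1)) ^ d := Nat.pow_le_pow_left (by omega) d
    _ = 2 ^ d * (M - 1) ^ d := mul_pow _ _ _
    _ ≤ _ := Nat.mul_le_mul_left _ h2.le

/-- The centres are taken from a cubic grid with M^d ≥ 2N nodes. Two are assigned to each index,
since a mean-zero function will be built from a pair of bumps. -/
theorem exists_separated_points (d : ℕ) [NeZero d] : ∃ C : ℝ, 0 < C ∧ ∀ N : ℕ, 1 ≤ N →
    ∃ (R : ℝ) (c : Fin N × Bool → EucSp d), 8 ≤ R ∧ (N : ℝ) ≤ R ^ d ∧ R ^ d ≤ C * N ∧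
      (∀ i, ‖c i‖ ≤ 1 / 2) ∧ ∀ i j, i ≠ j → 2 / R < dist (c i) (c j) := by
  have hd : (1 : ℝ) ≤ d := by exact_mod_cast NeZero.one_le
  refine ⟨(8 * d) ^ d * (2 ^ d * 2), by positivity, fun N hN => ?_⟩
  obtain ⟨M, hM, h1, h2⟩ := exists_nat_pow_between d (n := 2 * N) (by omega)
  have hM' : (1 : ℝ) ≤ M := by exact_mod_cast hM
  obtain ⟨ι⟩ : Nonempty (Fin N × Bool ↪ (Fin d → Fin M)) := by
    refine Function.Embedding.nonempty_of_card_le ?_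
    simp only [Fintype.card_prod, Fintype.card_fin, Fintype.card_bool, Fintype.card_fun]
    omega
  have h1' : (2 * N : ℝ) ≤ (M : ℝ) ^ d := by exact_mod_cast h1
  have h2' : (M : ℝ) ^ d ≤ 2 ^ d * (2 * N) := by exact_mod_cast h2
  have hMR : (M : ℝ) ≤ 8 * d * M := by nlinarith
  -- The mesh 1/(2dM) keeps all nodes within norm 1/2, and R = 8dM makes it 4/R, so closed balls of
  -- radius 1/R are disjoint.
  refine ⟨8 * d * M, fun p => WithLp.toLp 2 fun k => ((ι p k : ℕ) : ℝ) / (2 * d * M),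
    by nlinarith, ?_, ?_, fun p => ?_, fun p p' hp => ?_⟩
  · have := pow_le_pow_left₀ (by positivity) hMR d
    have : (0 : ℝ) ≤ N := by positivity
    linarith
  · rw [mul_pow (8 * (d : ℝ)), mul_assoc, mul_assoc]
    exact mul_le_mul_of_nonneg_left h2' (by positivity)
  · refine (EuclideanSpace.norm_le_sum_abs _).trans ?_
    calc _ ≤ ∑ _k : Fin d, 1 / (2 * (d : ℝ)) := by
          refine Finset.sum_le_sum fun k _ => ?_
          have hk : ((ι p k : ℕ) : ℝ) ≤ M := by exact_mod_cast (ι p k).2.le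
          rw [abs_of_nonneg (by positivity), div_le_div_iff₀ (by positivity) (by positivity)]
          nlinarith
      _ = 1 / 2 := by
          simp
          field_simp
  · obtain ⟨k, hk⟩ : ∃ k, ι p k ≠ ι p' k := by
      by_contra! h
      exact hp (ι.injective (funext h))
    have h3 : (1 : ℝ) ≤ |((ι p k : ℕ) : ℝ) - ((ι p' k : ℕ) : ℝ)| := by
      have : (1 : ℤ) ≤ |((ι p k : ℕ) : ℤ) - ((ι p' k : ℕ) : ℤ)| := by
        refine Int.one_le_abs (sub_ne_zero.2 fun h => hk (Fin.ext (by exact_mod_cast h)))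
      exact_mod_cast this
    have h4 := PiLp.norm_apply_le ((WithLp.toLp 2 fun k => ((ι p k : ℕ) : ℝ) / (2 * d * M) : EucSp d)
      - WithLp.toLp 2 fun k => ((ι p' k : ℕ) : ℝ) / (2 * d * M)) k
    rw [dist_eq_norm]
    refine lt_of_lt_of_le ?_ h4
    simp only [PiLp.sub_apply, Real.norm_eq_abs]
    rw [← sub_div, abs_div, abs_of_pos (show (0 : ℝ) < 2 * d * M by positivity),
      div_lt_div_iff₀ (by positivity) (by positivity)]
    have : 0 < (d : ℝ) * M := by positivity
    nlinarith

end Grid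

/-! ### Measure of small balls away from the boundary. -/

section BallMeasureBounds

variable (d : ℕ) [NeZero d] (μ : ℝ≥0)

omit [NeZero d] in
theorem exists_weight_bounds : ∃ a b : ℝ, 0 < a ∧ 0 < b ∧ ∀ x : EucSp d, ‖x‖ ≤ 5 / 8 →
    a ≤ (1 - ‖x‖ ^ 2) ^ ((μ : ℝ) - 1 / 2) ∧ (1 - ‖x‖ ^ 2) ^ ((μ : ℝ) - 1 / 2) ≤ b := by
  have hpos : ∀ x ∈ Metric.closedBall (0 : EucSp d) (5 / 8), 0 < 1 - ‖x‖ ^ 2 := fun x hx => by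
    rw [mem_closedBall_zero_iff] at hx
    nlinarith [norm_nonneg x]
  have hc : ContinuousOn (fun x : EucSp d => (1 - ‖x‖ ^ 2) ^ ((μ : ℝ) - 1 / 2))
      (Metric.closedBall 0 (5 / 8)) :=
    ContinuousOn.rpow_const (by fun_prop) fun x hx => Or.inl (hpos x hx).ne'
  have hne : (Metric.closedBall (0 : EucSp d) (5 / 8)).Nonempty := ⟨0, by simp; norm_num⟩
  obtain ⟨x, hx, hx'⟩ := (isCompact_closedBall _ _).exists_isMinOn hne hc
  obtain ⟨y, hy, hy'⟩ := (isCompact_closedBall _ _).exists_isMaxOn hne hc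
  exact ⟨_, _, Real.rpow_pos_of_pos (hpos x hx) _, Real.rpow_pos_of_pos (hpos y hy) _,
    fun z hz => ⟨hx' (mem_closedBall_zero_iff.2 hz), hy' (mem_closedBall_zero_iff.2 hz)⟩⟩

/-- These balls stay within radius 1/2 + 1/8 = 5/8, where the weight lies between two positive
constants, so their measure is comparable to Lebesgue measure. -/
theorem exists_ballMeasure_closedBall_bounds : ∃ a b : ℝ, 0 < a ∧ 0 < b ∧
    ∀ x : EucSp d, ‖x‖ ≤ 1 / 2 → ∀ t, 0 < t → t ≤ 1 / 8 →
      a * t ^ d ≤ (ballMeasure d μ).real (Metric.closedBall x t) ∧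
      (ballMeasure d μ).real (Metric.closedBall x t) ≤ b * t ^ d := by
  obtain ⟨a, b, ha, hb, hab⟩ := exists_weight_bounds d μ
  set κ := (volume : Measure (EucSp d)).real (Metric.ball 0 1)
  have hκ : 0 < κ := 
    ENNReal.toReal_pos (Metric.measure_ball_pos _ _ one_pos).ne' measure_ball_lt_top.ne
  refine ⟨a * κ, b * κ, by positivity, by positivity, fun x hx t ht ht8 => ?_⟩
  have hsub : ∀ y ∈ Metric.closedBall x t, ‖y‖ ≤ 5 / 8 := fun y hy => by
    have h1 : ‖y‖ ≤ ‖x‖ + ‖y - x‖ := by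
      have := norm_add_le x (y - x)
      rwa [add_sub_cancel] at this
    rw [mem_closedBall_iff_norm] at hy
    linarith
  have hvol : (volume : Measure (EucSp d)).real (Metric.closedBall x t) = t ^ d * κ := by
    rw [Measure.real, Measure.addHaar_closedBall _ _ ht.le, ENNReal.toReal_mul,
      ENNReal.toReal_ofReal (by positivity)]
    simp [κ, Measure.real]
  have hvt : (volume : Measure (EucSp d)) (Metric.closedBall x t) ≠ ∞ :=
    measure_closedBall_lt_top.ne
  have hm : ballMeasure d μ (Metric.closedBall x t) = ∫⁻ y in Metric.closedBall x t,
      ENNReal.ofReal ((1 - ‖y‖ ^ 2) ^ ((μ : ℝ) - 1 / 2)) := by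
    unfold ballMeasure
    rw [withDensity_apply _ Metric.isClosed_closedBall.measurableSet,
      Measure.restrict_restrict Metric.isClosed_closedBall.measurableSet,
      Set.inter_eq_self_of_subset_left]
    intro y hy
    rw [mem_closedBall_zero_iff]
    linarith [hsub y hy]
  have hmt : ballMeasure d μ (Metric.closedBall x t) ≠ ∞ := measure_ne_top _ _
  have hlow : ENNReal.ofReal a * volume (Metric.closedBall x t)
      ≤ ballMeasure d μ (Metric.closedBall x t) := by
    rw [hm, ← setLIntegral_const]
    exact setLIntegral_mono' Metric.isClosed_closedBall.measurableSet fun y hy =>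
      ENNReal.ofReal_le_ofReal (hab y (hsub y hy)).1
  have hup : ballMeasure d μ (Metric.closedBall x t)
      ≤ ENNReal.ofReal b * volume (Metric.closedBall x t) := by
    rw [hm, ← setLIntegral_const]
    exact setLIntegral_mono' Metric.isClosed_closedBall.measurableSet fun y hy =>
      ENNReal.ofReal_le_ofReal (hab y (hsub y hy)).2
  constructor
  · have := ENNReal.toReal_mono hmt hlow
    rw [ENNReal.toReal_mul, ENNReal.toReal_ofReal ha.le] at this
    calc a * κ * t ^ d = a * (volume : Measure (EucSp d)).real (Metric.closedBall x t) := by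
          rw [hvol]; ring
      _ ≤ _ := this
  · have := ENNReal.toReal_mono (ENNReal.mul_ne_top ENNReal.ofReal_ne_top hvt) hup
    rw [ENNReal.toReal_mul, ENNReal.toReal_ofReal hb.le] at this
    calc _ ≤ b * (volume : Measure (EucSp d)).real (Metric.closedBall x t) := this
      _ = _ := by rw [hvol]; ring

variable {d}

theorem integral_sq_sum_of_mul_eq_zero {ι : Type*} (s : Finset ι) (w : ι → ℝ)
    (g : ι → EucSp d → ℝ) (hg : ∀ i, Continuous (g i))
    (h0 : ∀ i j, i ≠ j → ∀ x, g i x * g j x = 0) :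
    ∫ x, (∑ i ∈ s, w i * g i x) ^ 2 ∂(ballMeasure d μ)
      = ∑ i ∈ s, w i ^ 2 * ∫ x, g i x ^ 2 ∂(ballMeasure d μ) := by
  have h1 : ∀ x, (∑ i ∈ s, w i * g i x) ^ 2 = ∑ i ∈ s, w i ^ 2 * g i x ^ 2 := fun x => by
    rw [sq, Finset.sum_mul_sum]
    refine Finset.sum_congr rfl fun i hi => ?_
    rw [Finset.sum_eq_single i]
    · ring
    · intro j _ hji
      linear_combination w i * w j * h0 i j hji.symm x
    · exact fun h => absurd hi h
  simp only [h1]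
  rw [integral_finsetSum (f := fun i x => w i ^ 2 * g i x ^ 2)]
  · exact Finset.sum_congr rfl fun i _ => integral_const_mul _ _
  · exact fun i _ => integrable_ballMeasure μ (by have := hg i; fun_prop)

end BallMeasureBounds

/-- Here u, u' stand for the integrals of two bumps and v, v' for those of their squares, all of
order 1/X. The weights (u', -u) have mean zero; after normalisation by S ≥ (a/X)³ their squares are
of order X. -/
theorem exists_mean_zero_weights {u v u' v' a b X : ℝ} (ha : 0 < a) (hX : 0 < X)
    (hu : a / X ≤ u) (hub : u ≤ b / X) (hv : a / X ≤ v) (hu' : a / X ≤ u') (hub' : u' ≤ b / X)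
    (hv' : a / X ≤ v') :
    ∃ w w' : ℝ, w * u + w' * u' = 0 ∧ w ^ 2 * v + w' ^ 2 * v' = 1 ∧
      w ^ 2 ≤ b ^ 2 / a ^ 3 * X ∧ w' ^ 2 ≤ b ^ 2 / a ^ 3 * X := by
  have haX : 0 < a / X := by positivity
  have hu0 : 0 < u := haX.trans_le hu
  have hu0' : 0 < u' := haX.trans_le hu'
  have hv0 : 0 < v := haX.trans_le hv
  have hv0' : 0 < v' := haX.trans_le hv'
  set S := u' ^ 2 * v + u ^ 2 * v' with hS
  have hSlow : (a / X) ^ 3 ≤ S := by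
    have h1 : (a / X) ^ 2 * (a / X) ≤ u' ^ 2 * v := by gcongr
    have h2 : 0 ≤ u ^ 2 * v' := by positivity
    nlinarith
  have hS0 : 0 < S := by positivity
  have hsq : (Real.sqrt S)⁻¹ ^ 2 = S⁻¹ := by rw [inv_pow, Real.sq_sqrt hS0.le]
  have hbound : ∀ z, 0 < z → z ≤ b / X → S⁻¹ * z ^ 2 ≤ b ^ 2 / a ^ 3 * X := fun z hz hzb => by
    calc S⁻¹ * z ^ 2 ≤ ((a / X) ^ 3)⁻¹ * (b / X) ^ 2 := by gcongr
      _ = _ := by field_simp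
  refine ⟨(Real.sqrt S)⁻¹ * u', -((Real.sqrt S)⁻¹ * u), by ring, ?_, ?_, ?_⟩
  · rw [neg_sq, mul_pow, mul_pow, hsq]
    field_simp
    rw [hS]
  · rw [mul_pow, hsq]
    exact hbound u' hu0' hub'
  · rw [neg_sq, mul_pow, hsq]
    exact hbound u hu0 hub

/-! ### The normalised mean-zero bump system. -/

section BumpFamily

variable (d : ℕ)

/-- A smooth bump equal to `1` on the ball of radius `1/2` and supported in the unit ball. -/
def unitBump : ContDiffBump (0 : EucSp d) := ⟨1 / 2, 1, by norm_num, by norm_num⟩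

theorem bumpSymbol_unitBump :
    BumpSymbol (d := d) 0 (fun R c x => unitBump d (R • (x - c))) := by
  refine BumpSymbol.comp_scale (φ := unitBump d) (unitBump d).contDiff ?_
  rw [(unitBump d).tsupport_eq]
  exact subset_rfl

variable {d}

/-- The bump of scale `R⁻¹` centred at `c`. -/
def scaledBump (R : ℝ) (c : EucSp d) : C(EucSp d, ℝ) :=
  ⟨fun x => unitBump d (R • (x - c)), ((bumpSymbol_unitBump d).contDiff R c).continuous⟩

theorem contDiff_scaledBump (R : ℝ) (c : EucSp d) : ContDiff ℝ (⊤ : ℕ∞) (scaledBump R c) :=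
  (bumpSymbol_unitBump d).contDiff R c

theorem ballOp_iterate_scaledBump_eq_zero (μ : ℝ≥0) (k : ℕ) {R : ℝ} (hR : 0 < R) {c x : EucSp d}
    (hx : x ∉ Metric.closedBall c (1 / R)) : (ballOp μ)^[k] (scaledBump R c) x = 0 := by
  refine ((bumpSymbol_unitBump d).ball_op_iterate μ k).eq_zero_of_lt ?_
  rw [mem_closedBall_iff_norm, not_le, div_lt_iff₀ hR] at hx
  rwa [norm_smul, Real.norm_of_nonneg hR.le, mul_comm]

theorem scaledBump_eq_zero {R : ℝ} (hR : 0 < R) {c x : EucSp d}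
    (hx : x ∉ Metric.closedBall c (1 / R)) : scaledBump R c x = 0 :=
  ballOp_iterate_scaledBump_eq_zero 0 0 hR hx

theorem scaledBump_eq_one {R : ℝ} (hR : 0 < R) {c x : EucSp d}
    (hx : x ∈ Metric.closedBall c (1 / (2 * R))) : scaledBump R c x = 1 := by
  refine (unitBump d).one_of_mem_closedBall ?_
  rw [mem_closedBall_iff_norm, le_div_iff₀ (by positivity)] at hx
  rw [mem_closedBall_zero_iff, norm_smul, Real.norm_of_nonneg hR.le]
  change _ ≤ (1 / 2 : ℝ)
  linarith

theorem scaledBump_nonneg (R : ℝ) (c x : EucSp d) : 0 ≤ scaledBump R c x := (unitBump d).nonneg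

theorem scaledBump_le_one (R : ℝ) (c x : EucSp d) : scaledBump R c x ≤ 1 := (unitBump d).le_one

theorem integral_le_mul_measureReal [NeZero d] (μ : ℝ≥0) {g : EucSp d → ℝ} (hg : Continuous g)
    {D : Set (EucSp d)} (hD : MeasurableSet D) {K : ℝ}
    (hgK : ∀ x, ‖x‖ ≤ 1 → g x ≤ K) (hgD : ∀ x, x ∉ D → g x = 0) :
    ∫ x, g x ∂(ballMeasure d μ) ≤ K * (ballMeasure d μ).real D := by
  have h1 : ∫ x, D.indicator (fun _ => K) x ∂(ballMeasure d μ) = K * (ballMeasure d μ).real D := by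
    rw [integral_indicator_const _ hD, smul_eq_mul, mul_comm]
  rw [← h1]
  refine integral_mono_ae (integrable_ballMeasure μ hg) ((integrable_const K).indicator hD) ?_
  filter_upwards [ballMeasure_ae_mem d μ] with x hx
  by_cases h : x ∈ D
  · rw [Set.indicator_of_mem h]
    exact hgK x (mem_closedBall_zero_iff.1 hx)
  · rw [Set.indicator_of_notMem h, hgD x h]

theorem measureReal_le_integral [NeZero d] (μ : ℝ≥0) {g : EucSp d → ℝ} (hg : Continuous g)
    {D : Set (EucSp d)} (hD : MeasurableSet D) (hg0 : ∀ x, 0 ≤ g x) (hgD : ∀ x ∈ D, 1 ≤ g x) :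
    (ballMeasure d μ).real D ≤ ∫ x, g x ∂(ballMeasure d μ) := by
  have h1 : ∫ x, D.indicator (fun _ => (1 : ℝ)) x ∂(ballMeasure d μ) = (ballMeasure d μ).real D := by
    rw [integral_indicator_const _ hD, smul_eq_mul, mul_one]
  rw [← h1]
  refine integral_mono ((integrable_const 1).indicator hD) (integrable_ballMeasure μ hg) fun x => ?_
  by_cases h : x ∈ D
  · simpa [Set.indicator_of_mem h] using hgD x h
  · simpa [Set.indicator_of_notMem h] using hg0 x

/-- Lower bounds come from the ball of half the radius, where the bump is 1; upper bounds come from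
the support. The condition R ≥ 8 puts the radius 1/R in the admissible range. -/
theorem exists_scaledBump_integral_bounds (d : ℕ) [NeZero d] (μ : ℝ≥0) (k : ℕ) :
    ∃ a b C : ℝ, 0 < a ∧ 0 < b ∧ 0 < C ∧ ∀ (R : ℝ) (c : EucSp d), 8 ≤ R → ‖c‖ ≤ 1 / 2 →
      (∀ m ∈ ({1, 2} : Set ℕ), a / R ^ d ≤ ∫ x, scaledBump R c x ^ m ∂(ballMeasure d μ) ∧
        ∫ x, scaledBump R c x ^ m ∂(ballMeasure d μ) ≤ b / R ^ d) ∧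
      (ballMeasure d μ).real (Metric.closedBall c (1 / R)) ≤ b / R ^ d ∧
      ∫ x, (ballOp μ)^[k] (scaledBump R c) x ^ 2 ∂(ballMeasure d μ)
        ≤ C * R ^ (4 * k) * (b / R ^ d) := by
  obtain ⟨a, b, ha, hb, hab⟩ := exists_ballMeasure_closedBall_bounds d μ
  obtain ⟨C, hC0, hC⟩ := ((bumpSymbol_unitBump d).ball_op_iterate μ k).exists_bound
  refine ⟨a / 2 ^ d, b, C ^ 2 + 1, by positivity, hb, by positivity, fun R c hR hc => ?_⟩
  have hR0 : 0 < R := by linarith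
  have h1 := hab c hc (1 / R) (by positivity) (by gcongr)
  have h2 := hab c hc (1 / (2 * R)) (by positivity) (by gcongr; linarith)
  have hup : (ballMeasure d μ).real (Metric.closedBall c (1 / R)) ≤ b / R ^ d := by
    refine h1.2.trans_eq ?_
    rw [one_div, inv_pow, div_eq_mul_inv]
  have hlow : a / 2 ^ d / R ^ d ≤ (ballMeasure d μ).real (Metric.closedBall c (1 / (2 * R))) := by
    refine le_trans (le_of_eq ?_) h2.1
    rw [one_div, inv_pow, mul_pow]
    field_simp
  have hcont := (scaledBump R c).continuous
  refine ⟨fun m hm => ?_, hup, ?_⟩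
  · have hm0 : m ≠ 0 := by rintro rfl; simp at hm
    constructor
    · refine hlow.trans (measureReal_le_integral μ (hcont.pow m)
        Metric.isClosed_closedBall.measurableSet
        (fun x => pow_nonneg (scaledBump_nonneg R c x) m) fun x hx => ?_)
      rw [Pi.pow_apply, scaledBump_eq_one hR0 hx, one_pow]
    · refine (integral_le_mul_measureReal μ (hcont.pow m)
        Metric.isClosed_closedBall.measurableSet
        (fun x _ => pow_le_one₀ (scaledBump_nonneg R c x) (scaledBump_le_one R c x))
        (D := Metric.closedBall c (1 / R)) fun x hx => ?_).trans ?_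
      · rw [Pi.pow_apply, scaledBump_eq_zero hR0 hx, zero_pow hm0]
      · rwa [one_mul]
  · refine (integral_le_mul_measureReal μ
      ((contDiff_ballOp_iterate μ (contDiff_scaledBump R c) k).continuous.pow 2)
      Metric.isClosed_closedBall.measurableSet (K := (C ^ 2 + 1) * R ^ (4 * k))
      (fun x hx => ?_) (D := Metric.closedBall c (1 / R)) fun x hx => ?_).trans ?_
    · have h3 : |(ballOp μ)^[k] (scaledBump R c) x| ≤ C * R ^ (0 + 2 * k) :=
        hC R (by linarith) c x hx
      rw [Pi.pow_apply, ← sq_abs]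
      calc _ ≤ (C * R ^ (0 + 2 * k)) ^ 2 := pow_le_pow_left₀ (abs_nonneg _) h3 2
        _ = C ^ 2 * R ^ (4 * k) := by ring
        _ ≤ _ := by
          gcongr
          linarith
    · rw [Pi.pow_apply, ballOp_iterate_scaledBump_eq_zero μ k hR0 hx]
      norm_num
    · gcongr

theorem norm_sq_contToL2 [NeZero d] (μ : ℝ≥0) (F : C(EucSp d, ℝ)) :
    ‖contToL2 d μ F‖ ^ 2 = ∫ x, F x ^ 2 ∂(ballMeasure d μ) := by
  rw [← real_inner_self_eq_norm_sq, inner_contToL2]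
  simp only [sq]

/-- Since `ballOp` is local, the iterates of different bumps still have disjoint supports. All cross
terms vanish and both L₂ norms are diagonal in a. -/
theorem exists_bump_system (d : ℕ) [NeZero d] (μ : ℝ≥0) (k : ℕ) : ∃ C : ℝ, 1 ≤ C ∧
    ∀ N : ℕ, 1 ≤ N → ∃ (R : ℝ) (F : Fin N → C(EucSp d, ℝ)) (B : Fin N → Set (EucSp d)),
      1 ≤ R ∧ (N : ℝ) ≤ R ^ d ∧ R ^ d ≤ C * N ∧ (∀ j, ContDiff ℝ (⊤ : ℕ∞) (F j)) ∧
      (∀ j, MeasurableSet (B j)) ∧ Pairwise (Function.onFun Disjoint B) ∧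
      (∀ j x, x ∉ B j → F j x = 0) ∧ (∀ j x, |F j x| ^ 2 ≤ C * R ^ d) ∧
      (∀ j, (ballMeasure d μ).real (B j) ≤ C / R ^ d) ∧
      (∀ j, ∫ x, F j x ∂(ballMeasure d μ) = 0) ∧
      (∀ j, ∫ x, F j x ^ 2 ∂(ballMeasure d μ) = 1) ∧
      ∀ (a : Fin N → ℝ) (h : ContDiff ℝ (⊤ : ℕ∞) (∑ j, a j • F j : C(EucSp d, ℝ))),
        ‖contToL2 d μ (∑ j, a j • F j)‖ ^ 2 = ∑ j, a j ^ 2 ∧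
        ‖contToL2 d μ (ballOpIter μ k (∑ j, a j • F j) h)‖ ^ 2
          ≤ C * R ^ (4 * k) * ∑ j, a j ^ 2 := by
  obtain ⟨C₁, hC₁, hgrid⟩ := exists_separated_points d
  obtain ⟨a, b, C₂, ha, hb, hC₂, hbd⟩ := exists_scaledBump_integral_bounds d μ k
  set κ := b ^ 2 / a ^ 3
  have hκ : 0 < κ := by positivity
  -- One summand per conclusion: 1 ≤ C, the size of R^d, the sup bound, the measure of two balls,
  -- and the bound for the k-th iterate.
  refine ⟨1 + C₁ + 4 * κ + 2 * b + 2 * (κ * C₂ * b), by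
    have : 0 < κ * C₂ * b := by positivity
    linarith, fun N hN => ?_⟩
  set C := 1 + C₁ + 4 * κ + 2 * b + 2 * (κ * C₂ * b) with hC
  have hC' : 0 < κ * C₂ * b := by positivity
  obtain ⟨R, c, hR, hNR, hRN, hc, hsep⟩ := hgrid N hN
  have hR0 : 0 < R := by linarith
  set X := R ^ d with hX
  have hX0 : 0 < X := by positivity
  have hB := fun p => hbd R (c p) hR (hc p)
  have hdisj : ∀ p p', p ≠ p' →
      Disjoint (Metric.closedBall (c p) (1 / R)) (Metric.closedBall (c p') (1 / R)) := by
    intro p p' hp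
    refine Metric.closedBall_disjoint_closedBall ?_
    have := hsep p p' hp
    rw [← add_div]
    norm_num
    exact this
  have hm1 : (1 : ℕ) ∈ ({1, 2} : Set ℕ) := by simp
  have hm2 : (2 : ℕ) ∈ ({1, 2} : Set ℕ) := by simp
  choose w w' hw0 hw1 hw hw' using fun j => exists_mean_zero_weights ha hX0
    (by simpa using ((hB (j, true)).1 1 hm1).1) (by simpa using ((hB (j, true)).1 1 hm1).2)
    ((hB (j, true)).1 2 hm2).1
    (by simpa using ((hB (j, false)).1 1 hm1).1) (by simpa using ((hB (j, false)).1 1 hm1).2)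
    ((hB (j, false)).1 2 hm2).1
  set β : Fin N × Bool → C(EucSp d, ℝ) := fun p => scaledBump R (c p) with hβ
  set W : Fin N × Bool → ℝ := fun p => if p.2 then w p.1 else w' p.1 with hW
  have hWκ : ∀ p, W p ^ 2 ≤ κ * X := by
    rintro ⟨j, e⟩
    cases e
    · exact hw' j
    · exact hw j
  set F : Fin N → C(EucSp d, ℝ) := fun j => w j • β (j, true) + w' j • β (j, false) with hF
  set B : Fin N → Set (EucSp d) := fun j => Metric.closedBall (c (j, true)) (1 / R) ∪
    Metric.closedBall (c (j, false)) (1 / R) with hBdef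
  have hmul : ∀ m : ℕ, ∀ p p', p ≠ p' → ∀ x,
      (ballOp μ)^[m] (β p) x * (ballOp μ)^[m] (β p') x = 0 := by
    intro m p p' hp x
    by_cases hx : x ∈ Metric.closedBall (c p) (1 / R)
    · rw [ballOp_iterate_scaledBump_eq_zero μ m hR0
        (Set.disjoint_left.1 (hdisj p p' hp) hx), mul_zero]
    · rw [ballOp_iterate_scaledBump_eq_zero μ m hR0 hx, zero_mul]
  have hsum : ∀ (z : Fin N → ℝ) x, (∑ j, z j • F j : C(EucSp d, ℝ)) x
      = ∑ p, (z p.1 * W p) * β p x := by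
    intro z x
    rw [Fintype.sum_prod_type, ContinuousMap.sum_apply]
    refine Finset.sum_congr rfl fun j _ => ?_
    simp only [hF, hW, Fintype.sum_bool, ContinuousMap.smul_apply, ContinuousMap.add_apply,
      smul_eq_mul, if_true, Bool.false_eq_true, if_false]
    ring
  have hint : ∀ p, Integrable (β p) (ballMeasure d μ) := fun p =>
    integrable_ballMeasure μ (β p).continuous
  have hsqw : ∀ (z : Fin N → ℝ), ∫ x, (∑ j, z j • F j : C(EucSp d, ℝ)) x ^ 2 ∂(ballMeasure d μ)
      = ∑ j, z j ^ 2 := by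
    intro z
    simp only [hsum]
    rw [integral_sq_sum_of_mul_eq_zero μ _ _ (fun p => β p) (fun p => (β p).continuous)
      (hmul 0), Fintype.sum_prod_type]
    refine Finset.sum_congr rfl fun j _ => ?_
    simp only [hW, Fintype.sum_bool, if_true, Bool.false_eq_true, if_false]
    linear_combination z j ^ 2 * hw1 j
  refine ⟨R, F, B, by linarith, hNR, ?_, fun j => ?_, fun j => ?_, fun i j hij => ?_,
    fun j x hx => ?_, fun j x => ?_, fun j => ?_, fun j => ?_, fun j => ?_, fun z h => ⟨?_, ?_⟩⟩
  · refine hRN.trans (mul_le_mul_of_nonneg_right ?_ (by positivity))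
    linarith
  · exact (contDiff_const.mul (contDiff_scaledBump R _)).add
      (contDiff_const.mul (contDiff_scaledBump R _))
  · exact Metric.isClosed_closedBall.measurableSet.union Metric.isClosed_closedBall.measurableSet
  · simp only [Function.onFun, hBdef, Set.disjoint_union_left, Set.disjoint_union_right]
    refine ⟨⟨?_, ?_⟩, ?_, ?_⟩ <;>
    · refine hdisj _ _ fun h => hij ?_
      simpa using congrArg Prod.fst h
  · simp only [hBdef, Set.mem_union, not_or] at hx
    simp only [hF, hβ, ContinuousMap.smul_apply, ContinuousMap.add_apply]
    rw [scaledBump_eq_zero hR0 hx.1, scaledBump_eq_zero hR0 hx.2]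
    simp
  · rw [sq_abs]
    simp only [hF, hβ, ContinuousMap.smul_apply, ContinuousMap.add_apply, smul_eq_mul]
    set y := scaledBump R (c (j, true)) x
    set y' := scaledBump R (c (j, false)) x
    have hy : y ^ 2 ≤ 1 := pow_le_one₀ (scaledBump_nonneg R _ x) (scaledBump_le_one R _ x)
    have hy' : y' ^ 2 ≤ 1 := pow_le_one₀ (scaledBump_nonneg R _ x) (scaledBump_le_one R _ x)
    have h1 : (w j * y) ^ 2 ≤ κ * X := by
      rw [mul_pow]
      exact (mul_le_of_le_one_right (sq_nonneg _) hy).trans (hw j)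
    have h2 : (w' j * y') ^ 2 ≤ κ * X := by
      rw [mul_pow]
      exact (mul_le_of_le_one_right (sq_nonneg _) hy').trans (hw' j)
    have h3 : 4 * κ * X ≤ C * X := by
      gcongr
      linarith
    nlinarith [sq_nonneg (w j * y - w' j * y')]
  · refine (measureReal_union_le _ _).trans ?_
    refine (add_le_add (hB _).2.1 (hB _).2.1).trans ?_
    rw [← add_div]
    gcongr
    linarith
  · simp only [hF, ContinuousMap.smul_apply, ContinuousMap.add_apply, smul_eq_mul]
    rw [integral_add ((hint _).const_mul _) ((hint _).const_mul _), integral_const_mul,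
      integral_const_mul]
    exact hw0 j
  · have := hsqw (Pi.single j 1)
    simpa [Pi.single_apply, Finset.sum_ite_eq] using this
  · rw [norm_sq_contToL2, hsqw]
  · have h1 : ∀ x, ballOpIter μ k (∑ j, z j • F j) h x
        = ∑ p, (z p.1 * W p) * (ballOp μ)^[k] (β p) x := fun x => by
      change (ballOp μ)^[k] (∑ j, z j • F j : C(EucSp d, ℝ)) x = _
      rw [show ⇑(∑ j, z j • F j : C(EucSp d, ℝ)) = fun x => ∑ p, (z p.1 * W p) * β p x from
        funext (hsum z), ballOp_iterate_sum_smul μ _ _ (fun p => β p)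
        fun p => contDiff_scaledBump R (c p)]
    rw [norm_sq_contToL2]
    simp only [h1]
    rw [integral_sq_sum_of_mul_eq_zero μ _ _ (fun p => (ballOp μ)^[k] (β p))
      (fun p => (contDiff_ballOp_iterate μ (contDiff_scaledBump R (c p)) k).continuous) (hmul k)]
    calc ∑ p : Fin N × Bool, (z p.1 * W p) ^ 2 *
          ∫ x, (ballOp μ)^[k] (β p) x ^ 2 ∂(ballMeasure d μ)
        ≤ ∑ p : Fin N × Bool, (z p.1 ^ 2 * (κ * X)) * (C₂ * R ^ (4 * k) * (b / X)) := by
          refine Finset.sum_le_sum fun p _ => ?_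
          rw [mul_pow]
          refine mul_le_mul (mul_le_mul_of_nonneg_left (hWκ p) (sq_nonneg _)) (hB p).2.2
            (integral_nonneg fun x => sq_nonneg _) (by positivity)
      _ = ∑ j, 2 * (κ * C₂ * b) * R ^ (4 * k) * z j ^ 2 := by
          rw [Fintype.sum_prod_type]
          refine Finset.sum_congr rfl fun j _ => ?_
          rw [Fintype.sum_bool]
          field_simp
          ring
      _ ≤ C * R ^ (4 * k) * ∑ j, z j ^ 2 := by
          rw [← Finset.mul_sum]
          gcongr
          linarith

end BumpFamily

/-! ### Coefficient and synthesis maps between `L_{q,μ}` and ℓ_q^N. -/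

section Coefficients

variable {d : ℕ} [NeZero d] {μ : ℝ≥0} {q : ℝ≥0∞} {N : ℕ}

/-- Hölder on B alone. Keeping the norm of f local to B is what allows the N estimates to be summed
without loss. -/
theorem enorm_integral_mul_le (hq : 1 ≤ q) (f : BallFun d μ) (F : C(EucSp d, ℝ))
    {B : Set (EucSp d)} (hB : MeasurableSet B) (hFB : ∀ x, x ∉ B → F x = 0) {P b : ℝ}
    (hP : 0 ≤ P) (hFP : ∀ x, |F x| ≤ P) (hb : (ballMeasure d μ).real B ≤ b) :
    ‖∫ x, f x * F x ∂(ballMeasure d μ)‖ₑ ≤ ENNReal.ofReal (P * b ^ (1 - 1 / q.toReal)) *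
      eLpNorm f q ((ballMeasure d μ).restrict B) := by
  -- For q = ∞ the conventions ∞.toReal = 0 and 1 / 0 = 0 give exponent 1, as they should.
  have hθ : 0 ≤ 1 - 1 / q.toReal := by
    rcases eq_or_ne q ∞ with rfl | hq'
    · simp
    · have : 1 ≤ q.toReal := by
        rw [← ENNReal.toReal_one]
        exact ENNReal.toReal_mono hq' hq
      rw [sub_nonneg, div_le_one (by linarith)]
      exact this
  have hb0 : 0 ≤ b := measureReal_nonneg.trans hb
  have h1 : ∫⁻ x, ‖f x * F x‖ₑ ∂(ballMeasure d μ)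
      ≤ ENNReal.ofReal P * eLpNorm f 1 ((ballMeasure d μ).restrict B) := by
    rw [eLpNorm_one_eq_lintegral_enorm, ← lintegral_const_mul' _ _ ENNReal.ofReal_ne_top,
      ← lintegral_indicator hB]
    refine lintegral_mono fun x => ?_
    by_cases hx : x ∈ B
    · rw [Set.indicator_of_mem hx, enorm_mul, mul_comm]
      gcongr
      rw [Real.enorm_eq_ofReal_abs]
      exact ENNReal.ofReal_le_ofReal (hFP x)
    · rw [hFB x hx, mul_zero, enorm_zero]
      exact bot_le
  have h2 := eLpNorm_le_eLpNorm_mul_rpow_measure_univ (μ := (ballMeasure d μ).restrict B) hq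
    (f := f) f.aestronglyMeasurable.restrict
  rw [Measure.restrict_apply_univ, ENNReal.toReal_one, div_one] at h2
  have h3 : ballMeasure d μ B ^ (1 - 1 / q.toReal) ≤ ENNReal.ofReal (b ^ (1 - 1 / q.toReal)) := by
    rw [← ENNReal.ofReal_rpow_of_nonneg hb0 hθ]
    refine ENNReal.rpow_le_rpow ?_ hθ
    rw [← ofReal_measureReal]
    exact ENNReal.ofReal_le_ofReal hb
  calc _ ≤ _ := enorm_integral_le_lintegral_enorm _
    _ ≤ _ := h1
    _ ≤ ENNReal.ofReal P * (eLpNorm f q ((ballMeasure d μ).restrict B) *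
          ENNReal.ofReal (b ^ (1 - 1 / q.toReal))) := by
        gcongr
        exact h2.trans (by gcongr)
    _ = _ := by
        rw [ENNReal.ofReal_mul hP]
        ring

theorem ofReal_norm_toLp_eq_sum (hq : 1 ≤ q) (hq' : q ≠ ∞) (x : Fin N → ℝ) :
    ENNReal.ofReal ‖WithLp.toLp q x‖ = (∑ j, ‖x j‖ₑ ^ q.toReal) ^ (1 / q.toReal) := by
  have hq0 : 0 < q.toReal := ENNReal.toReal_pos (zero_lt_one.trans_le hq).ne' hq'
  rw [PiLp.norm_eq_sum hq0, ← ENNReal.ofReal_rpow_of_nonneg (by positivity) (by positivity),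
    ENNReal.ofReal_sum_of_nonneg fun j _ => by positivity]
  congr 1
  refine Finset.sum_congr rfl fun j _ => ?_
  rw [← ENNReal.ofReal_rpow_of_nonneg (norm_nonneg _) hq0.le, ofReal_norm]

omit [NeZero d] in
-- The q-th powers of local norms over disjoint sets add up to at most the q-th power of the global
-- norm; for q = ∞ a maximum is taken instead.
theorem ofReal_norm_toLp_le_of_disjoint (hq : 1 ≤ q) (f : EucSp d → ℝ) {B : Fin N → Set (EucSp d)}
    (hB : ∀ j, MeasurableSet (B j)) (hdisj : Pairwise (Function.onFun Disjoint B))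
    (x : Fin N → ℝ) (D : ℝ≥0∞)
    (hx : ∀ j, ‖x j‖ₑ ≤ D * eLpNorm f q ((ballMeasure d μ).restrict (B j))) :
    ENNReal.ofReal ‖WithLp.toLp q x‖ ≤ D * eLpNorm f q (ballMeasure d μ) := by
  rcases eq_or_ne q ∞ with rfl | hq'
  · have h1 : ∀ j, ‖x j‖ₑ ≤ D * eLpNorm f ∞ (ballMeasure d μ) := fun j =>
      (hx j).trans (by gcongr; exact Measure.restrict_le_self)
    rw [PiLp.norm_eq_ciSup]
    rcases isEmpty_or_nonempty (Fin N) with h | h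
    · simp
    · obtain ⟨j, hj⟩ := exists_eq_ciSup_of_finite (f := fun j => ‖x j‖)
      change ENNReal.ofReal (⨆ j, ‖x j‖) ≤ _
      rw [← hj, ofReal_norm]
      exact h1 j
  · have hq0 : 0 < q.toReal := ENNReal.toReal_pos (zero_lt_one.trans_le hq).ne' hq'
    have hqne : q ≠ 0 := (zero_lt_one.trans_le hq).ne'
    rw [ofReal_norm_toLp_eq_sum hq hq', one_div, ENNReal.rpow_inv_le_iff hq0,
      ENNReal.mul_rpow_of_nonneg _ _ hq0.le]
    have hpow : ∀ m : Measure (EucSp d), eLpNorm f q m ^ q.toReal = ∫⁻ y, ‖f y‖ₑ ^ q.toReal ∂m :=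
      fun m => by
        rw [eLpNorm_eq_lintegral_rpow_enorm_toReal hqne hq', ← ENNReal.rpow_mul, one_div,
          inv_mul_cancel₀ hq0.ne', ENNReal.rpow_one]
    calc ∑ j, ‖x j‖ₑ ^ q.toReal
        ≤ ∑ j, D ^ q.toReal * ∫⁻ y in B j, ‖f y‖ₑ ^ q.toReal ∂(ballMeasure d μ) := by
          refine Finset.sum_le_sum fun j _ => ?_
          rw [← hpow, ← ENNReal.mul_rpow_of_nonneg _ _ hq0.le]
          exact ENNReal.rpow_le_rpow (hx j) hq0.le
      _ = D ^ q.toReal * ∫⁻ y in ⋃ j, B j, ‖f y‖ₑ ^ q.toReal ∂(ballMeasure d μ) := by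
          rw [← Finset.mul_sum, lintegral_iUnion hB hdisj, tsum_fintype]
      _ ≤ D ^ q.toReal * eLpNorm f q (ballMeasure d μ) ^ q.toReal := by
          rw [hpow]
          gcongr
          exact Measure.restrict_le_self

theorem integrable_weightedLq_mul (hq : 1 ≤ q) (f : weightedLq d μ q) (F : C(EucSp d, ℝ)) {P : ℝ}
    (hFP : ∀ x, |F x| ≤ P) :
    Integrable (fun x => (f : BallFun d μ) x * F x) (ballMeasure d μ) := by
  have h1 : MemLp (f : BallFun d μ) q (ballMeasure d μ) :=
    ⟨(f : BallFun d μ).aestronglyMeasurable, f.2.1⟩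
  exact (h1.integrable hq).mul_bdd (c := P) F.continuous.aestronglyMeasurable
    (Filter.Eventually.of_forall hFP)

/-- The coefficients `∫ f F_j W_μ` of `f ∈ L_{q,μ}`. -/
def coeffMap (hq : 1 ≤ q) (F : Fin N → C(EucSp d, ℝ)) {P : ℝ} (hFP : ∀ j x, |F j x| ≤ P) :
    weightedLq d μ q →ₗ[ℝ] (Fin N → ℝ) where
  toFun f j := ∫ x, (f : BallFun d μ) x * F j x ∂(ballMeasure d μ)
  map_add' f g := by
    ext j
    rw [Pi.add_apply, ← integral_add (integrable_weightedLq_mul hq f (F j) (hFP j))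
      (integrable_weightedLq_mul hq g (F j) (hFP j))]
    refine integral_congr_ae ?_
    filter_upwards [AEEqFun.coeFn_add (f : BallFun d μ) (g : BallFun d μ)] with x hx
    rw [Submodule.coe_add, hx, Pi.add_apply, add_mul]
  map_smul' c f := by
    ext j
    rw [Pi.smul_apply, RingHom.id_apply, smul_eq_mul, ← integral_const_mul]
    refine integral_congr_ae ?_
    filter_upwards [AEEqFun.coeFn_smul c (f : BallFun d μ)] with x hx
    rw [Submodule.coe_smul, hx, Pi.smul_apply, smul_eq_mul, mul_assoc]

theorem contToL2_mem_weightedLq (q : ℝ≥0∞) (F : C(EucSp d, ℝ)) :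
    (contToL2 d μ F : BallFun d μ) ∈ weightedLq d μ q := by
  have h1 := (memLp_ballMeasure d μ F).coeFn_toLp
  refine ⟨?_, fun _ => ⟨F, F.continuous.continuousOn, h1⟩⟩
  obtain ⟨C, hC⟩ := (isCompact_closedBall (0 : EucSp d) 1).exists_bound_of_continuousOn
    F.continuous.continuousOn
  have h2 : MemLp F q (ballMeasure d μ) :=
    MemLp.of_bound F.continuous.aestronglyMeasurable C ((ballMeasure_ae_mem d μ).mono hC)
  exact (eLpNorm_congr_ae h1).trans_lt h2.2

/-- The combinations of the functions `F_j`, as elements of `L_{q,μ}`. -/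
def synthesisMap (μ : ℝ≥0) (q : ℝ≥0∞) (F : Fin N → C(EucSp d, ℝ)) :
    (Fin N → ℝ) →ₗ[ℝ] weightedLq d μ q where
  toFun a := ⟨_, contToL2_mem_weightedLq q (∑ j, a j • F j)⟩
  map_add' a b := by
    refine Subtype.ext ?_
    change ((contToL2 d μ _ : BallL2 d μ) : BallFun d μ) = _
    simp only [Pi.add_apply, add_smul, Finset.sum_add_distrib, map_add]
    rfl
  map_smul' c a := by
    refine Subtype.ext ?_
    change ((contToL2 d μ _ : BallL2 d μ) : BallFun d μ) = _
    simp only [Pi.smul_apply, smul_assoc, ← Finset.smul_sum, map_smul]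
    rfl

theorem coeffMap_synthesisMap (hq : 1 ≤ q) (F : Fin N → C(EucSp d, ℝ)) {P : ℝ}
    (hFP : ∀ j x, |F j x| ≤ P) (hdisj : ∀ i j, i ≠ j → ∀ x, F i x * F j x = 0)
    (hone : ∀ j, ∫ x, F j x ^ 2 ∂(ballMeasure d μ) = 1) (a : Fin N → ℝ) :
    coeffMap hq F hFP (synthesisMap μ q F a) = a := by
  ext j
  have h1 : ∫ x, (synthesisMap μ q F a : BallFun d μ) x * F j x ∂(ballMeasure d μ)
      = ∫ x, a j * F j x ^ 2 ∂(ballMeasure d μ) := by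
    refine integral_congr_ae ?_
    filter_upwards [(memLp_ballMeasure d μ (∑ j, a j • F j)).coeFn_toLp] with x hx
    have hx' : (synthesisMap μ q F a : BallFun d μ) x = (∑ j, a j • F j : C(EucSp d, ℝ)) x := hx
    rw [hx', ContinuousMap.sum_apply, Finset.sum_mul, Finset.sum_eq_single j]
    · rw [ContinuousMap.smul_apply, smul_eq_mul]
      ring
    · intro i _ hij
      rw [ContinuousMap.smul_apply, smul_eq_mul, mul_assoc, hdisj i j hij, mul_zero]
    · simp
  refine h1.trans ?_
  rw [integral_const_mul, hone, mul_one]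

theorem ofReal_norm_coeffMap_le (hq : 1 ≤ q) (F : Fin N → C(EucSp d, ℝ)) {P b : ℝ} (hP : 0 ≤ P)
    (hFP : ∀ j x, |F j x| ≤ P) {B : Fin N → Set (EucSp d)}
    (hB : ∀ j, MeasurableSet (B j)) (hdisj : Pairwise (Function.onFun Disjoint B))
    (hFB : ∀ j x, x ∉ B j → F j x = 0) (hb : ∀ j, (ballMeasure d μ).real (B j) ≤ b)
    (f : weightedLq d μ q) :
    ENNReal.ofReal ‖WithLp.toLp q (coeffMap hq F hFP f)‖
      ≤ ENNReal.ofReal (P * b ^ (1 - 1 / q.toReal)) *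
        eLpNorm (f : BallFun d μ) q (ballMeasure d μ) := by
  refine ofReal_norm_toLp_le_of_disjoint hq (f : BallFun d μ) hB hdisj _ _ fun j => ?_
  exact enorm_integral_mul_le hq (f : BallFun d μ) (F j) (hB j) (hFB j) hP (hFP j) (hb j)

end Coefficients

/-! ### Transfer of the width to the coordinate space. -/

section Comparison

variable {d : ℕ} [NeZero d] {μ : ℝ≥0} {q : ℝ≥0∞} {N : ℕ}

theorem matrixProbLinearWidth_le {S : (Fin N → ℝ) →ₗ[ℝ] (Fin N → ℝ)} {n : ℕ} (hS : S.rank ≤ n)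
    {δ : ℝ} {b : ℝ≥0∞} {G : Set (Fin N → ℝ)} (hG : MeasurableSet G)
    (hGδ : gammaStd N G ≤ ENNReal.ofReal δ)
    (hb : ∀ x, x ∉ G → ENNReal.ofReal ‖WithLp.toLp q (x - S x)‖ ≤ b) :
    matrixProbLinearWidth N q LinearMap.id n δ ≤ b := by
  unfold matrixProbLinearWidth
  refine iInf_le_of_le G <| iInf_le_of_le hG <| iInf_le_of_le hGδ <| iInf_le_of_le S <|
    iInf_le_of_le hS ?_
  exact iSup₂_le fun x hx => hb x hx

/-- Reduction of the probabilistic linear width of a Sobolev class to that of a coordinate space,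
by means of a Gaussian component `σ • Ψ x` and a left inverse `A` of `Ψ`. -/
theorem mul_matrixProbLinearWidth_le (hq : 1 ≤ q) {r : ℝ} {ν : Measure (SobolevSpace d μ r)}
    {n : ℕ} {δ σ κ : ℝ} (hδ : δ < 1) (hσ : 0 < σ) (hκ : 0 < κ)
    (A : weightedLq d μ q →ₗ[ℝ] (Fin N → ℝ)) (Ψ : (Fin N → ℝ) →ₗ[ℝ] SobolevSpace d μ r)
    (Ψq : (Fin N → ℝ) →ₗ[ℝ] weightedLq d μ q)
    (hA : ∀ f, ENNReal.ofReal ‖WithLp.toLp q (A f)‖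
      ≤ ENNReal.ofReal κ * eLpNorm (f : BallFun d μ) q (ballMeasure d μ))
    (hΨ : ∀ x, (SobolevSpace.toL2 d μ r (Ψ x) : BallFun d μ) = Ψq x)
    (hAΨ : ∀ x, A (Ψq x) = x)
    (hshift : ∀ G, MeasurableSet G → ∃ g, gammaStd N {x | g + σ • Ψ x ∈ G} ≤ ν G) :
    ENNReal.ofReal (σ / κ) * matrixProbLinearWidth N q LinearMap.id n δ
      ≤ probLinearWidth d μ r q ν n δ := by
  have : Fact (1 ≤ q) := ⟨hq⟩
  refine le_iInf fun G => le_iInf fun hG => le_iInf fun hGδ => le_iInf fun T => le_iInf fun hT => ?_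
  set t := ⨆ f ∈ (fun f => (SobolevSpace.toL2 d μ r f : BallFun d μ)) '' Gᶜ,
    ⨅ hf : f ∈ weightedLq d μ q,
      eLpNorm (f - (T ⟨f, hf⟩ : BallFun d μ) : BallFun d μ) q (ballMeasure d μ) with ht
  -- When t is finite, every function outside the exceptional set belongs to `L_{q,μ}`, because an
  -- error outside that space counts as ∞.
  rcases eq_or_ne t ∞ with htop | htop
  · rw [htop]
    exact le_top
  obtain ⟨g, hg⟩ := hshift G hG
  have hgδ := hg.trans hGδ
  set H := {x | g + σ • Ψ x ∈ G} with hH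
  have hcoe : ∀ x, (SobolevSpace.toL2 d μ r (g + σ • Ψ x) : BallFun d μ)
      = (SobolevSpace.toL2 d μ r g : BallFun d μ) + σ • (Ψq x : BallFun d μ) := fun x => by
    rw [← hΨ, map_add, map_smul]
    rfl
  have herr : ∀ x, x ∉ H → ∃ hf : (SobolevSpace.toL2 d μ r (g + σ • Ψ x) : BallFun d μ) ∈
      weightedLq d μ q, eLpNorm ((SobolevSpace.toL2 d μ r (g + σ • Ψ x) : BallFun d μ)
        - (T ⟨_, hf⟩ : BallFun d μ) : BallFun d μ) q (ballMeasure d μ) ≤ t := by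
    intro x hx
    have h1 := le_iSup₂ (f := fun (f : BallFun d μ)
      (_ : f ∈ (fun f => (SobolevSpace.toL2 d μ r f : BallFun d μ)) '' Gᶜ) =>
      ⨅ hf : f ∈ weightedLq d μ q,
        eLpNorm (f - (T ⟨f, hf⟩ : BallFun d μ) : BallFun d μ) q (ballMeasure d μ))
      (SobolevSpace.toL2 d μ r (g + σ • Ψ x) : BallFun d μ) ⟨_, hx, rfl⟩
    change _ ≤ t at h1
    by_cases hf : (SobolevSpace.toL2 d μ r (g + σ • Ψ x) : BallFun d μ) ∈ weightedLq d μ q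
    · rw [iInf_pos hf] at h1
      exact ⟨hf, h1⟩
    · rw [iInf_neg hf] at h1
      exact absurd (top_le_iff.1 h1) htop
  -- Since δ < 1 some x₀ is not exceptional. Subtracting σΨx₀ shows that g lies in `L_{q,μ}`,
  -- without a Sobolev embedding theorem.
  obtain ⟨x₀, hx₀⟩ : ∃ x, x ∉ H := by
    by_contra! h
    rw [Set.eq_univ_of_forall h, measure_univ, ENNReal.one_le_ofReal] at hgδ
    linarith
  have hgq : (SobolevSpace.toL2 d μ r g : BallFun d μ) ∈ weightedLq d μ q := by
    obtain ⟨hf, -⟩ := herr x₀ hx₀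
    rw [hcoe] at hf
    exact (Submodule.add_mem_iff_left _ ((weightedLq d μ q).smul_mem σ (Ψq x₀).2)).1 hf
  set gq : weightedLq d μ q := ⟨_, hgq⟩
  set S : (Fin N → ℝ) →ₗ[ℝ] (Fin N → ℝ) := A ∘ₗ T ∘ₗ Ψq with hS
  -- Applying A to the error at g + σΨx gives σ(x - Sx) - b, where b depends only on g.
  set b := A (T gq - gq) with hb
  set L : (Fin N → ℝ) →ₗ[ℝ] (Fin N → ℝ) := σ • (LinearMap.id - S) with hL
  have hkey : ∀ x, x ∉ H → ‖WithLp.toLp q (L x - b)‖ ≤ κ * t.toReal := by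
    intro x hx
    obtain ⟨hf, hle⟩ := herr x hx
    have hu : (⟨_, hf⟩ : weightedLq d μ q) = gq + σ • Ψq x := Subtype.ext (hcoe x)
    have h1 : L x - b = A ((⟨_, hf⟩ : weightedLq d μ q) - T ⟨_, hf⟩) := by
      rw [hu]
      simp only [hL, hS, hb, LinearMap.smul_apply, LinearMap.sub_apply, LinearMap.id_apply,
        LinearMap.comp_apply, map_add, map_sub, map_smul, hAΨ]
      module
    rw [← ENNReal.ofReal_le_ofReal_iff (by positivity), h1, ENNReal.ofReal_mul hκ.le,
      ENNReal.ofReal_toReal htop]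
    refine (hA _).trans ?_
    gcongr
    exact hle
  have hp : Measurable fun x : Fin N → ℝ => ‖WithLp.toLp q x‖ :=
    (continuous_norm.comp (PiLp.continuous_toLp q _)).measurable
  -- Anderson's inequality removes the unknown shift b at no cost in measure.
  have hand := gammaStd_shift_le (fun x => ‖WithLp.toLp q x‖) hp
    (fun x y => by
      rw [WithLp.toLp_add]
      exact norm_add_le (WithLp.toLp q x) (WithLp.toLp q y))
    (fun c x => by
      rw [WithLp.toLp_smul]
      exact norm_smul c (WithLp.toLp q x)) L b (κ * t.toReal)
  have hLm : Measurable L := (LinearMap.continuous_of_finiteDimensional L).measurable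
  set G' := {x | ‖WithLp.toLp q (L x)‖ ≤ κ * t.toReal}ᶜ with hG'
  have hG'm : MeasurableSet {x | ‖WithLp.toLp q (L x)‖ ≤ κ * t.toReal} :=
    measurableSet_le (hp.comp hLm) measurable_const
  have hG'δ : gammaStd N G' ≤ ENNReal.ofReal δ := by
    refine le_trans ?_ hgδ
    have h1 : gammaStd N Hᶜ ≤ gammaStd N {x | ‖WithLp.toLp q (L x)‖ ≤ κ * t.toReal} :=
      (measure_mono fun x hx => hkey x hx).trans hand
    have h2 : 1 ≤ gammaStd N H + gammaStd N Hᶜ := by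
      rw [← measure_univ (μ := gammaStd N), ← Set.union_compl_self H]
      exact measure_union_le _ _
    rw [hG', prob_compl_eq_one_sub hG'm]
    refine tsub_le_iff_right.2 (h2.trans ?_)
    gcongr
  have hSrank : S.rank ≤ n :=
    (LinearMap.rank_comp_le_right _ _).trans ((LinearMap.rank_comp_le_left _ _).trans hT)
  have hfin := matrixProbLinearWidth_le (q := q) hSrank hG'm.compl hG'δ
    (b := ENNReal.ofReal (κ * t.toReal / σ)) fun x hx => by
      rw [Set.notMem_compl_iff] at hx
      have h1 : ‖WithLp.toLp q (L x)‖ = σ * ‖WithLp.toLp q (x - S x)‖ := by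
        have h2 := norm_smul σ (WithLp.toLp q (x - S x))
        rw [Real.norm_of_nonneg hσ.le] at h2
        exact h2
      refine ENNReal.ofReal_le_ofReal ?_
      rw [le_div_iff₀ hσ, mul_comm, ← h1]
      exact hx
  calc _ ≤ ENNReal.ofReal (σ / κ) * ENNReal.ofReal (κ * t.toReal / σ) := by gcongr
    _ = ENNReal.ofReal t.toReal := by
      rw [← ENNReal.ofReal_mul (by positivity)]
      congr 1
      field_simp
    _ = t := ENNReal.ofReal_toReal htop

/-- Absorbs into a constant a ratio known only to lie in [1, Z], whatever the sign of the exponent.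
-/
theorem min_one_rpow_le {y Z e : ℝ} (hy : 1 ≤ y) (hyZ : y ≤ Z) : min 1 (Z ^ e) ≤ y ^ e := by
  rcases le_total 0 e with he | he
  · exact (min_le_left _ _).trans (Real.one_le_rpow hy he)
  · exact (min_le_right _ _).trans
      (Real.rpow_le_rpow_of_nonpos (by linarith) hyZ he)

end Comparison

end

/-! ### Choice of parameters and computation of the exponent. -/

theorem theorem4p4 (d : ℕ) [NeZero d] (μ : ℝ≥0) (q : ℝ≥0∞) (hq : 1 ≤ q) (r s : ℝ)
    (hr : ((d : ℝ) + 2 * (μ : ℝ)) * max (1 / 2 - (q⁻¹).toReal) 0 < r) (hs : (d : ℝ) < s)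
    (K : ℝ) (hK : 2 ≤ K) :
    ∃ c : ℝ, 0 < c ∧
      ∀ ν : Measure (SobolevSpace d μ r), IsSobolevGaussian d μ r s ν →
      ∀ n N : ℕ, 1 ≤ n → 2 * n ≤ N → (N : ℝ) ≤ K * n →
      ∀ δ : ℝ, 0 < δ → δ < 1 →
        ENNReal.ofReal (c * (n : ℝ) ^ (-(r + s / 2) / d + 1 / 2 - (q⁻¹).toReal)) *
            matrixProbLinearWidth N q LinearMap.id n δ
          ≤ probLinearWidth d μ r q ν n δ := by
  have hd : (1 : ℝ) ≤ d := by exact_mod_cast NeZero.one_le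
  have hμ := μ.coe_nonneg
  have hr0 : 0 < r := lt_of_le_of_lt (mul_nonneg (by positivity) (le_max_right _ _)) hr
  have hs0 : 0 ≤ s := by linarith
  obtain ⟨k, hk⟩ := exists_nat_ge (r + s / 2)
  set ρ := r + s / 2 with hρ
  have hρ0 : 0 < ρ := by positivity
  obtain ⟨C, hC1, hC⟩ := exists_bump_system d μ k
  have hC0 : 0 < C := by linarith
  set θ := 1 - 1 / q.toReal with hθ
  set e := -ρ / d + 1 / 2 - (q⁻¹).toReal with he
  have heθ : e = -ρ / d - 1 / 2 + θ := by
    rw [he, hθ, ENNReal.toReal_inv]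
    ring
  -- The first factor comes from σ and the next two from κ = P (C/X)^θ; the last replaces X = R^d by
  -- n, using 1 ≤ X/n ≤ CK.
  refine ⟨(Real.sqrt (1 + C))⁻¹ * (Real.sqrt C)⁻¹ * (C ^ θ)⁻¹ * min 1 ((C * K) ^ e), by positivity,
    fun ν hν n N hn hnN hNK δ hδ0 hδ1 => ?_⟩
  obtain ⟨R, F, B, hR, hNR, hRN, hF, hB, hdisj, hFB, hFX, hBX, hF0, hF1, hFL⟩ := hC N (by omega)
  have hR0 : 0 < R := by linarith
  set X := R ^ d with hX
  have hX0 : 0 < X := by positivity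
  set P := Real.sqrt (C * X) with hP
  have hFP : ∀ j x, |F j x| ≤ P := fun j x => Real.le_sqrt_of_sq_le (hFX j x)
  -- The largest σ allowed by the Bernstein inequality at L = R²: the factor R^{4k} from k
  -- applications of the operator is cancelled by L^{-2k}, leaving (1 + C) R^{2ρ}.
  set σ := (Real.sqrt ((1 + C) * (R ^ 2) ^ ρ))⁻¹ with hσ
  have hσ0 : 0 < σ := by positivity
  have hσsq : σ ^ 2 * ((1 + C) * (R ^ 2) ^ ρ) = 1 := by
    rw [hσ, inv_pow, Real.sq_sqrt (by positivity), inv_mul_cancel₀ (by positivity)]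
  have hmul0 : ∀ i j, i ≠ j → ∀ x, F i x * F j x = 0 := fun i j hij x => by
    by_cases hx : x ∈ B i
    · rw [hFB j x (Set.disjoint_left.1 (hdisj hij) hx), mul_zero]
    · rw [hFB i x hx, zero_mul]
  obtain ⟨Ψ, hΨ, hshift⟩ := exists_sobolev_shift μ hr0 hs0 hν F hF hF0 (σ := σ) fun a => by
    have hsm : ContDiff ℝ (⊤ : ℕ∞) (∑ j, a j • F j : C(EucSp d, ℝ)) := by
      have hcoe : ⇑(∑ j, a j • F j : C(EucSp d, ℝ)) = fun x => ∑ j, a j * F j x := by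
        ext x
        simp
      rw [hcoe]
      exact ContDiff.sum fun j _ => contDiff_const.mul (hF j)
    have h1 := (summable_rpow_mul_projV μ _ hsm hρ0.le (by linarith : ρ ≤ 2 * k)
      (by positivity : 0 < R ^ 2)).2
    obtain ⟨h2, h3⟩ := hFL a hsm
    rw [h2] at h1
    have hsum : 0 ≤ ∑ j, a j ^ 2 := Finset.sum_nonneg fun j _ => sq_nonneg _
    calc σ ^ 2 * _ ≤ σ ^ 2 * ((R ^ 2) ^ ρ * (∑ j, a j ^ 2
          + (R ^ 2)⁻¹ ^ (2 * k) * (C * R ^ (4 * k) * ∑ j, a j ^ 2))) := by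
          refine mul_le_mul_of_nonneg_left (h1.trans ?_) (sq_nonneg _)
          gcongr
      _ = σ ^ 2 * ((1 + C) * (R ^ 2) ^ ρ) * ∑ j, a j ^ 2 := by
          have h4 : (R ^ 2)⁻¹ ^ (2 * k) * R ^ (4 * k) = 1 := by
            rw [inv_pow, ← pow_mul, show 2 * (2 * k) = 4 * k by ring,
              inv_mul_cancel₀ (by positivity)]
          linear_combination σ ^ 2 * (R ^ 2) ^ ρ * C * (∑ j, a j ^ 2) * h4
      _ = ∑ j, a j ^ 2 := by rw [hσsq, one_mul]
  have hκ0 : 0 < P * (C / X) ^ θ := by positivity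
  refine le_trans ?_ (mul_matrixProbLinearWidth_le hq (n := n) hδ1 hσ0 hκ0 (coeffMap hq F hFP) Ψ
    (synthesisMap μ q F)
    (ofReal_norm_coeffMap_le hq F (Real.sqrt_nonneg _) hFP hB hdisj hFB hBX)
    (fun x => congrArg Subtype.val (hΨ x)) (coeffMap_synthesisMap hq F hFP hmul0 hF1) hshift)
  gcongr
  have hn0 : (0 : ℝ) < n := by exact_mod_cast hn
  have hnN' : (n : ℝ) ≤ N := by exact_mod_cast (by omega : n ≤ N)
  have hXn : min 1 ((C * K) ^ e) ≤ (X / n) ^ e := by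
    refine min_one_rpow_le ?_ ?_
    · rw [le_div_iff₀ hn0]
      linarith
    · rw [div_le_iff₀ hn0]
      nlinarith [mul_le_mul_of_nonneg_left hNK hC0.le]
  have hXe : (X / n) ^ e * (n : ℝ) ^ e = X ^ e := by
    rw [← Real.mul_rpow (by positivity) hn0.le, div_mul_cancel₀ _ hn0.ne']
  have hRX : (R ^ 2) ^ ρ = X ^ (2 * ρ / d) := by
    rw [hX, ← Real.rpow_natCast R d, ← Real.rpow_mul hR0.le, ← Real.rpow_natCast R 2,
      ← Real.rpow_mul hR0.le]
    congr 1
    field_simp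
    norm_cast
  have hσe : σ = (Real.sqrt (1 + C))⁻¹ * X ^ (-ρ / d) := by
    rw [hσ, Real.sqrt_mul (by positivity), mul_inv, hRX, Real.sqrt_eq_rpow (X ^ _),
      ← Real.rpow_mul hX0.le, ← Real.rpow_neg hX0.le]
    congr 2
    ring
  have hκe : (P * (C / X) ^ θ)⁻¹ = (Real.sqrt C)⁻¹ * (C ^ θ)⁻¹ * X ^ (-1 / 2 + θ) := by
    rw [hP, Real.sqrt_mul hC0.le, Real.div_rpow hC0.le hX0.le, Real.sqrt_eq_rpow X,
      Real.rpow_add hX0, neg_div, Real.rpow_neg hX0.le]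
    field_simp
  calc _ = (Real.sqrt (1 + C))⁻¹ * (Real.sqrt C)⁻¹ * (C ^ θ)⁻¹ *
        (min 1 ((C * K) ^ e) * (n : ℝ) ^ e) := by ring
    _ ≤ (Real.sqrt (1 + C))⁻¹ * (Real.sqrt C)⁻¹ * (C ^ θ)⁻¹ * X ^ e := by
        rw [← hXe]
        gcongr
    _ = σ / (P * (C / X) ^ θ) := by
        rw [div_eq_mul_inv, hκe, hσe, heθ, show -ρ / d - 1 / 2 + θ = -ρ / d + (-1 / 2 + θ) by ring,
          Real.rpow_add hX0]
        ring
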